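/- Let $\mathbb K$ be a field of characteristic $0$, and let $(A,d)$ be a chain complex of $\mathbb K$-vector spaces: $A=\bigoplus_{i\in\mathbb Z}A^i$ and $d\colon A\to A$ is linear of degree $+1$ with $d^2=0$. For a graded vector space $W$ write $W[n]^i=W^{i+n}$; write $\overline{S(W)}=\bigoplus_{n\ge 1}\bigodot^n W$ for the reduced graded symmetric coalgebra cogenerated by $W$, and $D(W)=\operatorname{Hom}^*(\overline{S(W)},W)$. Each $g\in D(W)$ is identified with the coderivation $\hat g$ of $\overline{S(W)}$ with corestriction $g$, that is $$\hat g(a_1\odot\cdots\odot a_n)=\sum_{p=1}^{n}\ \sum_{\sigma}\varepsilon(\sigma)\, g(a_{\sigma(1)}\odot\cdots\odot a_{\sigma(p)})\odot a_{\sigma(p+1)}\odot\cdots\odot a_{\sigma(n)},$$ where $\sigma$ runs over the $(p,n-p)$-unshuffles and $\varepsilon(\sigma)$ is the Koszul sign. Let $[f,g]=f\circ\hat g-(-1)^{|f||g|}g\circ\hat f$ be the graded Lie bracket on $D(W)$ corresponding to the graded commutator of coderivations. An $L_\infty$-structure on $W[-1]$ is a degree $1$ element $\partial\in D(W)$ with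 $[\partial,\partial]=0$; an $L_\infty$-isomorphism is an isomorphism of graded coalgebras commuting with the coderivations $\hat\partial$. A DGLA $(L,d,[\,,])$ is regarded as an $L_\infty$-algebra through the element of $D(L[1])$ given by $d$ on $L[1]$, by $a\odot b\mapsto(-1)^{|a|}[a,b]$ with $|a|$ the degree in $L[1]$, and by $0$ on $\bigodot^n L[1]$ for $n\ge 3$. Let $k\in\mathbb Z$ and let $R\in\operatorname{Hom}^{-2k}(A\odot A,A)$, i.e. $R$ is a bilinear map with $R(A^i,A^j)\subseteq A^{i+j-2k}$ and $R(a,b)=(-1)^{|a||b|}R(b,a)$ for homogeneous $a,b$. Consider $R$ as a degree zero element of $D(A[2k])$, consider $d$ as a degree one element of $D(A[2k])$, let $Q=[R,d]$, and set $$[a,b]_Q=(-1)^{|a|}Q(a,b),$$ where $|a|$ is the degree of $a$ in $A$. If $[R,Q]=0$ in $D(A[2k])$, then $(A[2k-1],d,[\,,]_Q)$ is a differential graded Lie algebra, and it is (1) formal, i.e. connected by a zigzag of quasi-isomorphisms of DGLAs to its cohomology (with zero differential and the induced bracket), and (2) homotopy abelian, i.e. connected by a zigzag of quasi-isomorphisms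 of DGLAs to a DGLA with zero bracket. More precisely, the coderivation $\hat R$ of $\overline{S(A[2k])}$ is locally nilpotent, and its exponential $e^{\hat R}=\sum_{n\ge 0}\hat R^{\,n}/n!$ is an $L_\infty$-isomorphism from the abelian DGLA $(A[2k-1],d,0)$ to the DGLA $(A[2k-1],d,[\,,]_Q)$. -/

import Mathlib

/-! Conventions.  A graded vector space over a field `K` is a `K`-vector space `M` together with
a family `𝒱 : ℤ → Submodule K M` such that `M = ⨁ i, 𝒱 i` (`DirectSum.Decomposition 𝒱`).
Differentials have degree `+1`. -/

namespace FormalityCriterion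

open scoped TensorProduct DirectSum

noncomputable section

universe u v w

/-! ### Graded vector spaces -/

section Graded

variable {K : Type u} [Field K] {M : Type v} [AddCommGroup M] [Module K M]

/-- The shifted graded space `V[n]`, i.e. `V[n]^i = V^(i+n)`. -/
def shift (𝒱 : ℤ → Submodule K M) (n : ℤ) : ℤ → Submodule K M := fun i => 𝒱 (i + n)

theorem shift_isInternal (𝒱 : ℤ → Submodule K M) [DirectSum.Decomposition 𝒱] (n : ℤ) :
    DirectSum.IsInternal (shift 𝒱 n) := by
  have h := (DirectSum.isInternal_submodule_iff_iSupIndep_and_iSup_eq_top 𝒱).1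
    (DirectSum.Decomposition.isInternal 𝒱)
  refine (DirectSum.isInternal_submodule_iff_iSupIndep_and_iSup_eq_top _).2 ⟨?_, ?_⟩
  · exact h.1.comp (add_left_injective n)
  · rw [← h.2]
    exact (Equiv.addRight n).iSup_comp (g := 𝒱)

instance shiftDecomposition (𝒱 : ℤ → Submodule K M) [DirectSum.Decomposition 𝒱] (n : ℤ) :
    DirectSum.Decomposition (shift 𝒱 n) :=
  (shift_isInternal 𝒱 n).chooseDecomposition

/-- The linear involution `a ↦ (-1)^|a| a`. -/
def signMap (𝒱 : ℤ → Submodule K M) [DirectSum.Decomposition 𝒱] : M →ₗ[K] M :=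
  DirectSum.toModule K ℤ M (fun i => ((-1 : K) ^ i) • (𝒱 i).subtype) ∘ₗ
    (DirectSum.decomposeLinearEquiv 𝒱).toLinearMap

theorem signMap_apply (𝒱 : ℤ → Submodule K M) [DirectSum.Decomposition 𝒱] {i : ℤ} {a : M}
    (ha : a ∈ 𝒱 i) : signMap 𝒱 a = ((-1 : K) ^ i) • a := by
  simp only [signMap, LinearMap.comp_apply, LinearEquiv.coe_coe,
    DirectSum.decomposeLinearEquiv_apply, DirectSum.decompose_of_mem 𝒱 ha]
  rw [← DirectSum.lof_eq_of K, DirectSum.toModule_lof]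
  rfl

/-- Graded symmetry of a bilinear map: `B(a,b) = (-1)^(|a||b|) B(b,a)`.  Graded symmetric bilinear
maps are the same thing as linear maps on `V ⊙ V`. -/
def IsGrSymm {N : Type w} [AddCommGroup N] [Module K N] (𝒱 : ℤ → Submodule K M)
    (B : M →ₗ[K] M →ₗ[K] N) : Prop :=
  ∀ i j : ℤ, ∀ a ∈ 𝒱 i, ∀ b ∈ 𝒱 j, B a b = ((-1 : K) ^ (i * j)) • B b a

theorem neg_one_zpow_eq_of_even_sub {i j : ℤ} (h : Even (i - j)) :
    (-1 : K) ^ i = (-1 : K) ^ j := by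
  have h0 : (-1 : K) ≠ 0 := neg_ne_zero.2 one_ne_zero
  have : i = (i - j) + j := by ring
  rw [this, zpow_add₀ h0, h.neg_one_zpow, one_mul]

/-- Graded symmetry is not affected by an even shift. -/
theorem IsGrSymm.shift_even {N : Type w} [AddCommGroup N] [Module K N]
    {𝒱 : ℤ → Submodule K M} {B : M →ₗ[K] M →ₗ[K] N} (h : IsGrSymm 𝒱 B) (k : ℤ) :
    IsGrSymm (shift 𝒱 (2 * k)) B := by
  intro i j a ha b hb
  rw [h _ _ a ha b hb]
  congr 1
  apply neg_one_zpow_eq_of_even_sub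
  exact ⟨k * (i + j + 2 * k), by ring⟩

end Graded

/-! ### The graded symmetric bialgebra `S(V)` -/

section GrSym

variable {K : Type u} [Field K] {M : Type v} [AddCommGroup M] [Module K M]

/-- The relation `v ⊗ w ~ (-1)^(|v||w|) w ⊗ v` on the tensor algebra. -/
inductive SymRel (𝒱 : ℤ → Submodule K M) : TensorAlgebra K M → TensorAlgebra K M → Prop
  | swap (i j : ℤ) (a b : M) (ha : a ∈ 𝒱 i) (hb : b ∈ 𝒱 j) :
      SymRel 𝒱 (TensorAlgebra.ι K a * TensorAlgebra.ι K b)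
        (((-1 : K) ^ (i * j)) • (TensorAlgebra.ι K b * TensorAlgebra.ι K a))

/-- The graded symmetric algebra `S(V) = ⊕_{n ≥ 0} ⊙^n V`; its product is written `⊙` in the
literature and `*` here. -/
abbrev GrSym (𝒱 : ℤ → Submodule K M) := RingQuot (SymRel 𝒱)

namespace GrSym

/-- The inclusion `V → S(V)`. -/
def ι (𝒱 : ℤ → Submodule K M) : M →ₗ[K] GrSym 𝒱 :=
  (RingQuot.mkAlgHom K (SymRel 𝒱)).toLinearMap ∘ₗ TensorAlgebra.ι K

theorem ι_comm (𝒱 : ℤ → Submodule K M) {i j : ℤ} {a b : M} (ha : a ∈ 𝒱 i) (hb : b ∈ 𝒱 j) :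
    ι 𝒱 a * ι 𝒱 b = ((-1 : K) ^ (i * j)) • (ι 𝒱 b * ι 𝒱 a) := by
  have := RingQuot.mkAlgHom_rel K (SymRel.swap (𝒱 := 𝒱) i j a b ha hb)
  simpa [ι] using this

/-- The universal property of `S(V)`. -/
def lift (𝒱 : ℤ → Submodule K M) {B : Type w} [Semiring B] [Algebra K B] (f : M →ₗ[K] B)
    (hf : ∀ i j : ℤ, ∀ a ∈ 𝒱 i, ∀ b ∈ 𝒱 j, f a * f b = ((-1 : K) ^ (i * j)) • (f b * f a)) :
    GrSym 𝒱 →ₐ[K] B :=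
  RingQuot.liftAlgHom K ⟨TensorAlgebra.lift K f, by
    rintro _ _ ⟨i, j, a, b, ha, hb⟩
    simpa using hf i j a ha b hb⟩

@[simp] theorem lift_ι (𝒱 : ℤ → Submodule K M) {B : Type w} [Semiring B] [Algebra K B]
    (f : M →ₗ[K] B)
    (hf : ∀ i j : ℤ, ∀ a ∈ 𝒱 i, ∀ b ∈ 𝒱 j, f a * f b = ((-1 : K) ^ (i * j)) • (f b * f a))
    (a : M) : lift 𝒱 f hf (ι 𝒱 a) = f a := by
  simp [lift, ι]

theorem algHom_ext {𝒱 : ℤ → Submodule K M} {B : Type w} [Semiring B] [Algebra K B]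
    {f g : GrSym 𝒱 →ₐ[K] B} (h : ∀ a, f (ι 𝒱 a) = g (ι 𝒱 a)) : f = g := by
  apply RingQuot.ringQuot_ext'
  apply TensorAlgebra.hom_ext
  ext a
  exact h a

/-- The counit `S(V) → K`, killing `V`. -/
def counit (𝒱 : ℤ → Submodule K M) : GrSym 𝒱 →ₐ[K] K :=
  lift 𝒱 (0 : M →ₗ[K] K) (by simp)

/-- The elements of total degree `n` in `S(V)`: linear combinations of products
`a_1 ⊙ ⋯ ⊙ a_r` of homogeneous elements with `|a_1| + ⋯ + |a_r| = n`. -/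
def deg (𝒱 : ℤ → Submodule K M) (n : ℤ) : Submodule K (GrSym 𝒱) :=
  Submodule.span K {x | ∃ l : List (Σ i : ℤ, 𝒱 i),
    (l.map Sigma.fst).sum = n ∧ (l.map fun a => ι 𝒱 (a.2 : M)).prod = x}

theorem ι_mem_deg (𝒱 : ℤ → Submodule K M) {i : ℤ} (a : 𝒱 i) : ι 𝒱 (a : M) ∈ deg 𝒱 i :=
  Submodule.subset_span ⟨[⟨i, a⟩], by simp, by simp⟩

instance degGradedMonoid (𝒱 : ℤ → Submodule K M) : SetLike.GradedMonoid (deg 𝒱) where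
  one_mem := Submodule.subset_span ⟨[], by simp, by simp⟩
  mul_mem := by
    intro i j x y hx hy
    have h : deg 𝒱 i * deg 𝒱 j ≤ deg 𝒱 (i + j) := by
      rw [deg, deg, Submodule.span_mul_span]
      apply Submodule.span_le.2
      rintro _ ⟨_, ⟨l, hl, rfl⟩, _, ⟨l', hl', rfl⟩, rfl⟩
      exact Submodule.subset_span ⟨l ++ l', by simp [hl, hl'], by simp⟩
    exact h (Submodule.mul_mem_mul hx hy)

/-- Auxiliary: `V → ⨁ n, S(V)^n`. -/
def degι (𝒱 : ℤ → Submodule K M) [DirectSum.Decomposition 𝒱] : M →ₗ[K] ⨁ n, deg 𝒱 n :=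
  DirectSum.toModule K ℤ _ (fun i => DirectSum.lof K ℤ (fun n => deg 𝒱 n) i ∘ₗ
      LinearMap.codRestrict (deg 𝒱 i) (ι 𝒱 ∘ₗ (𝒱 i).subtype) (fun a => ι_mem_deg 𝒱 a)) ∘ₗ
    (DirectSum.decomposeLinearEquiv 𝒱).toLinearMap

theorem degι_apply (𝒱 : ℤ → Submodule K M) [DirectSum.Decomposition 𝒱] {i : ℤ} (a : 𝒱 i) :
    degι 𝒱 (a : M) = DirectSum.of (fun n => deg 𝒱 n) i ⟨ι 𝒱 (a : M), ι_mem_deg 𝒱 a⟩ := by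
  simp only [degι, LinearMap.comp_apply, LinearEquiv.coe_coe,
    DirectSum.decomposeLinearEquiv_apply, DirectSum.decompose_coe]
  rw [← DirectSum.lof_eq_of K, DirectSum.toModule_lof]
  rfl

theorem degι_comm (𝒱 : ℤ → Submodule K M) [DirectSum.Decomposition 𝒱] (i j : ℤ) (a : M)
    (ha : a ∈ 𝒱 i) (b : M) (hb : b ∈ 𝒱 j) :
    degι 𝒱 a * degι 𝒱 b = ((-1 : K) ^ (i * j)) • (degι 𝒱 b * degι 𝒱 a) := by
  have h1 := degι_apply 𝒱 (⟨a, ha⟩ : 𝒱 i)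
  have h2 := degι_apply 𝒱 (⟨b, hb⟩ : 𝒱 j)
  dsimp only at h1 h2
  rw [h1, h2, DirectSum.of_mul_of, DirectSum.of_mul_of]
  rw [← DirectSum.lof_eq_of K, ← DirectSum.lof_eq_of K, ← map_smul, DirectSum.lof_eq_of,
    DirectSum.lof_eq_of]
  apply DirectSum.of_eq_of_gradedMonoid_eq
  exact Sigma.subtype_ext (add_comm _ _) (ι_comm 𝒱 ha hb)

/-- Auxiliary: the decomposition of `S(V)` by total degree. -/
def degLift (𝒱 : ℤ → Submodule K M) [DirectSum.Decomposition 𝒱] :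
    GrSym 𝒱 →ₐ[K] ⨁ n, deg 𝒱 n :=
  lift 𝒱 (degι 𝒱) (degι_comm 𝒱)

instance degGradedAlgebra (𝒱 : ℤ → Submodule K M) [DirectSum.Decomposition 𝒱] :
    GradedAlgebra (deg 𝒱) :=
  GradedAlgebra.ofAlgHom (deg 𝒱) (degLift 𝒱)
    (by
      apply algHom_ext
      intro a
      induction a using DirectSum.Decomposition.inductionOn 𝒱 with
      | zero => simp
      | add a b ha hb => rw [map_add, map_add, ha, hb, map_add]
      | homogeneous a =>
        simp only [AlgHom.comp_apply, degLift, lift_ι, degι_apply, DirectSum.coeAlgHom_of,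
          AlgHom.id_apply])
    (by
      rintro n ⟨x, hx⟩
      dsimp only
      induction hx using Submodule.span_induction with
      | mem x hx =>
        obtain ⟨l, rfl, rfl⟩ := hx
        induction l with
        | nil =>
          simp only [List.map_nil, List.prod_nil, map_one]
          rfl
        | cons a l ih =>
          simp only [List.map_cons, List.prod_cons, map_mul]
          rw [ih, degLift, lift_ι, degι_apply, DirectSum.of_mul_of]
          apply DirectSum.of_eq_of_gradedMonoid_eq
          exact Sigma.subtype_ext List.sum_cons.symm rfl
      | zero =>
        rw [map_zero]
        exact (map_zero (DirectSum.of (fun i => ↥(deg 𝒱 i)) n)).symm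
      | add x y hx hy ihx ihy =>
        rw [map_add, ihx, ihy, ← map_add]
        rfl
      | smul c x hx ih =>
        rw [map_smul, ih, ← DirectSum.lof_eq_of K, ← map_smul]
        rfl)

/-- `v ↦ v ⊗ 1 + 1 ⊗ v`, with values in the graded tensor product algebra, in which
`(x ⊗ y)(x' ⊗ y') = (-1)^(|y||x'|) xx' ⊗ yy'`. -/
def comulι (𝒱 : ℤ → Submodule K M) [DirectSum.Decomposition 𝒱] :
    M →ₗ[K] (deg 𝒱 ᵍ⊗[K] deg 𝒱) :=
  (GradedTensorProduct.includeLeft (deg 𝒱) (deg 𝒱)).toLinearMap ∘ₗ ι 𝒱 +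
    (GradedTensorProduct.includeRight (deg 𝒱) (deg 𝒱)).toLinearMap ∘ₗ ι 𝒱

theorem comulι_comm (𝒱 : ℤ → Submodule K M) [DirectSum.Decomposition 𝒱] (i j : ℤ) (a : M)
    (ha : a ∈ 𝒱 i) (b : M) (hb : b ∈ 𝒱 j) :
    comulι 𝒱 a * comulι 𝒱 b = ((-1 : K) ^ (i * j)) • (comulι 𝒱 b * comulι 𝒱 a) := by
  have hs : ∀ (n : ℤ) (x : deg 𝒱 ᵍ⊗[K] deg 𝒱), ((-1 : ℤˣ) ^ n) • x = ((-1 : K) ^ n) • x := by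
    intro n x
    rcases Int.even_or_odd n with h | h
    · rw [h.neg_one_zpow, h.neg_one_zpow, one_smul, one_smul]
    · rw [h.neg_one_zpow, h.neg_one_zpow, neg_smul, one_smul, Units.smul_def]
      simp
  have h2 : ∀ n : ℤ, ((-1 : K) ^ n) * (-1 : K) ^ n = 1 := by
    intro n
    rw [← mul_zpow]; simp
  have e1 := GradedTensorProduct.tmul_coe_mul_coe_tmul (R := K) (deg 𝒱) (deg 𝒱)
    1 (⟨ι 𝒱 a, ι_mem_deg 𝒱 ⟨a, ha⟩⟩ : deg 𝒱 i) (⟨ι 𝒱 b, ι_mem_deg 𝒱 ⟨b, hb⟩⟩ : deg 𝒱 j) 1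
  have e2 := GradedTensorProduct.tmul_coe_mul_coe_tmul (R := K) (deg 𝒱) (deg 𝒱)
    1 (⟨ι 𝒱 b, ι_mem_deg 𝒱 ⟨b, hb⟩⟩ : deg 𝒱 j) (⟨ι 𝒱 a, ι_mem_deg 𝒱 ⟨a, ha⟩⟩ : deg 𝒱 i) 1
  have e1' := e1.trans (hs (i * j) _)
  have e2' := e2.trans (hs (j * i) _)
  have f1 := GradedTensorProduct.tmul_one_mul_one_tmul (R := K) (deg 𝒱) (deg 𝒱) (ι 𝒱 a) (ι 𝒱 b)
  have f2 := GradedTensorProduct.tmul_one_mul_one_tmul (R := K) (deg 𝒱) (deg 𝒱) (ι 𝒱 b) (ι 𝒱 a)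
  have c1 := ι_comm 𝒱 ha hb
  have g1 := congrArg (GradedTensorProduct.includeLeft (deg 𝒱) (deg 𝒱)) c1
  have g2 := congrArg (GradedTensorProduct.includeRight (deg 𝒱) (deg 𝒱)) c1
  rw [map_smul, map_mul, map_mul] at g1 g2
  simp only [comulι, LinearMap.add_apply, LinearMap.comp_apply, AlgHom.toLinearMap_apply]
  simp only [one_mul, mul_one] at e1' e2'
  rw [add_mul, mul_add, mul_add, add_mul, mul_add, mul_add, g1, g2]
  simp only [GradedTensorProduct.includeLeft_apply, GradedTensorProduct.includeRight_apply]
  rw [f1, f2, e1', e2']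
  simp only [smul_add, smul_smul]
  rw [mul_comm j i, h2, one_smul]
  abel

/-- The coproduct of `S(V)`: the algebra morphism with `Δ(v) = v ⊗ 1 + 1 ⊗ v` for `v ∈ V`. Thus
`Δ(a_1 ⊙ ⋯ ⊙ a_n)` is the sum over all unshuffles `σ` of
`ε(σ) (a_σ(1) ⊙ ⋯ ⊙ a_σ(p)) ⊗ (a_σ(p+1) ⊙ ⋯ ⊙ a_σ(n))`, `0 ≤ p ≤ n`, with `ε(σ)` the Koszul
sign. -/
def comul (𝒱 : ℤ → Submodule K M) [DirectSum.Decomposition 𝒱] :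
    GrSym 𝒱 →ₗ[K] GrSym 𝒱 ⊗[K] GrSym 𝒱 :=
  (GradedTensorProduct.of K (deg 𝒱) (deg 𝒱)).symm.toLinearMap ∘ₗ
    (lift 𝒱 (comulι 𝒱) (comulι_comm 𝒱)).toLinearMap

/-- Left multiplication by `(0, v, 0)`, `v ∈ V`, in the algebra `K ⊕ V ⊕ N` with product
`(b, x, y)(b', x', y') = (b b', b x' + b' x, b y' + b' y + B(x, x'))`. -/
def mulOp {N : Type w} [AddCommGroup N] [Module K N] (B : M →ₗ[K] M →ₗ[K] N) :
    M →ₗ[K] Module.End K (K × M × N) :=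
  LinearMap.mk₂ K (fun v p => (0, p.1 • v, B v p.2.1))
    (by intro v v' p; simp)
    (by intro c v p; ext <;> simp [smul_comm p.1 c v])
    (by intro v p p'; simp [add_smul])
    (by intro c v p; simp [mul_smul])

theorem mulOp_comm {N : Type w} [AddCommGroup N] [Module K N] {𝒱 : ℤ → Submodule K M}
    {B : M →ₗ[K] M →ₗ[K] N} (h : IsGrSymm 𝒱 B) (i j : ℤ) (a : M)
    (ha : a ∈ 𝒱 i) (b : M) (hb : b ∈ 𝒱 j) :
    mulOp B a * mulOp B b = ((-1 : K) ^ (i * j)) • (mulOp B b * mulOp B a) := by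
  apply LinearMap.ext
  intro p
  have := h i j a ha b hb
  simp [mulOp, this, smul_comm p.1 ((-1 : K) ^ (i * j)) (B b a)]

/-- The linear map `S(V) → K ⊕ V ⊕ N` that is `(1, 0, 0)` on `1`, `(0, a, 0)` on `a ∈ V`,
`(0, 0, B(a,b))` on `a ⊙ b`, and zero on `⊙^n V` for `n ≥ 3`. -/
def components {N : Type w} [AddCommGroup N] [Module K N] (𝒱 : ℤ → Submodule K M)
    (B : M →ₗ[K] M →ₗ[K] N) (h : IsGrSymm 𝒱 B) : GrSym 𝒱 →ₗ[K] K × M × N :=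
  LinearMap.applyₗ ((1, 0, 0) : K × M × N) ∘ₗ
    (lift 𝒱 (mulOp B) (mulOp_comm h)).toLinearMap

/-- The projection `S(V) → V`. -/
def toV (𝒱 : ℤ → Submodule K M) : GrSym 𝒱 →ₗ[K] M :=
  LinearMap.fst K M M ∘ₗ LinearMap.snd K K (M × M) ∘ₗ
    components 𝒱 (0 : M →ₗ[K] M →ₗ[K] M) (by intro i j a _ b _; simp)

/-- The linear map `S(V) → N` given by `B` on `V ⊙ V` and zero on `⊙^n V` for `n ≠ 2`. -/
def quadratic {N : Type w} [AddCommGroup N] [Module K N] (𝒱 : ℤ → Submodule K M)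
    (B : M →ₗ[K] M →ₗ[K] N) (h : IsGrSymm 𝒱 B) : GrSym 𝒱 →ₗ[K] N :=
  LinearMap.snd K M N ∘ₗ LinearMap.snd K K (M × N) ∘ₗ components 𝒱 B h

end GrSym

end GrSym

/-! ### The reduced symmetric coalgebra, its coderivations and `D(V)` -/

section Coalgebra

variable {K : Type u} [Field K] {M : Type v} [AddCommGroup M] [Module K M]

/-- The underlying space `⊕_{n ≥ 1} ⊙^n V` of the reduced symmetric coalgebra: the kernel of the
counit of `S(V)`. -/
def redSub (𝒱 : ℤ → Submodule K M) : Submodule K (GrSym 𝒱) :=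
  LinearMap.ker (GrSym.counit 𝒱).toLinearMap

theorem mem_redSub {𝒱 : ℤ → Submodule K M} {x : GrSym 𝒱} :
    x ∈ redSub 𝒱 ↔ GrSym.counit 𝒱 x = 0 := Iff.rfl

/-- The reduced symmetric coalgebra cogenerated by `V`. -/
abbrev RedSym (𝒱 : ℤ → Submodule K M) := ↥(redSub 𝒱)

namespace RedSym

theorem counit_ι (𝒱 : ℤ → Submodule K M) (a : M) : GrSym.counit 𝒱 (GrSym.ι 𝒱 a) = 0 := by
  simp [GrSym.counit]

/-- The inclusion of `V` in the reduced symmetric coalgebra. -/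
def ι (𝒱 : ℤ → Submodule K M) : M →ₗ[K] RedSym 𝒱 :=
  LinearMap.codRestrict (redSub 𝒱) (GrSym.ι 𝒱) (fun a => mem_redSub.2 (counit_ι 𝒱 a))

/-- The projection `x ↦ x - ε(x) 1` of `S(V)` onto `⊕_{n ≥ 1} ⊙^n V`. -/
def proj (𝒱 : ℤ → Submodule K M) : GrSym 𝒱 →ₗ[K] RedSym 𝒱 :=
  LinearMap.codRestrict (redSub 𝒱)
    (LinearMap.id - Algebra.linearMap K (GrSym 𝒱) ∘ₗ (GrSym.counit 𝒱).toLinearMap)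
    (fun x => mem_redSub.2 (by simp))

@[simp] theorem coe_ι (𝒱 : ℤ → Submodule K M) (a : M) :
    (ι 𝒱 a : GrSym 𝒱) = GrSym.ι 𝒱 a := rfl

@[simp] theorem coe_proj (𝒱 : ℤ → Submodule K M) (x : GrSym 𝒱) :
    (proj 𝒱 x : GrSym 𝒱) = x - algebraMap K (GrSym 𝒱) (GrSym.counit 𝒱 x) := rfl

/-- The product `x ⊙ y` of the (non-unital) algebra `⊕_{n ≥ 1} ⊙^n V`. -/
def mul (𝒱 : ℤ → Submodule K M) (x y : RedSym 𝒱) : RedSym 𝒱 :=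
  ⟨(x : GrSym 𝒱) * (y : GrSym 𝒱), mem_redSub.2 (by
    rw [map_mul, mem_redSub.1 x.2, zero_mul])⟩

@[simp] theorem coe_mul (𝒱 : ℤ → Submodule K M) (x y : RedSym 𝒱) :
    (mul 𝒱 x y : GrSym 𝒱) = x * y := rfl

/-- The coproduct of the reduced symmetric coalgebra, `x ↦ Δ(x) - x ⊗ 1 - 1 ⊗ x`: the sum over
unshuffles with both blocks nonempty. -/
def comul (𝒱 : ℤ → Submodule K M) [DirectSum.Decomposition 𝒱] :
    RedSym 𝒱 →ₗ[K] RedSym 𝒱 ⊗[K] RedSym 𝒱 :=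
  TensorProduct.map (proj 𝒱) (proj 𝒱) ∘ₗ GrSym.comul 𝒱 ∘ₗ (redSub 𝒱).subtype

end RedSym

/-- `D(V)`, the space of linear maps from the reduced symmetric coalgebra to `V`. -/
abbrev D (𝒱 : ℤ → Submodule K M) := RedSym 𝒱 →ₗ[K] M

/-- `f ∈ D(V)` is homogeneous of degree `p`. -/
def D.HasDegree {𝒱 : ℤ → Submodule K M} (f : D 𝒱) (p : ℤ) : Prop :=
  ∀ i : ℤ, ∀ x : RedSym 𝒱, (x : GrSym 𝒱) ∈ GrSym.deg 𝒱 i → f x ∈ 𝒱 (i + p)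

/-- A linear endomorphism of `V` as an element of `D_0(V) ⊂ D(V)`. -/
def D.ofLinear (𝒱 : ℤ → Submodule K M) (f : M →ₗ[K] M) : D 𝒱 :=
  f ∘ₗ GrSym.toV 𝒱 ∘ₗ (redSub 𝒱).subtype

/-- A graded symmetric bilinear map as an element of `D_1(V) = Hom(V ⊙ V, V) ⊂ D(V)`. -/
def D.ofBilinear (𝒱 : ℤ → Submodule K M) (B : M →ₗ[K] M →ₗ[K] M) (h : IsGrSymm 𝒱 B) : D 𝒱 :=
  GrSym.quadratic 𝒱 B h ∘ₗ (redSub 𝒱).subtype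

/-- The bilinear map `(a, b) ↦ f(a ⊙ b)`. -/
def D.bilinear {𝒱 : ℤ → Submodule K M} (f : D 𝒱) : M →ₗ[K] M →ₗ[K] M :=
  LinearMap.mk₂ K (fun a b => f (RedSym.mul 𝒱 (RedSym.ι 𝒱 a) (RedSym.ι 𝒱 b)))
    (by intro a a' b; rw [← map_add]; congr 1; ext; simp [RedSym.mul, add_mul])
    (by intro c a b; rw [← map_smul]; congr 1; ext; simp [RedSym.mul])
    (by intro a b b'; rw [← map_add]; congr 1; ext; simp [RedSym.mul, mul_add])
    (by intro c a b; rw [← map_smul]; congr 1; ext; simp [RedSym.mul])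

/-- The coderivation of the reduced symmetric coalgebra with corestriction `g ∈ D(V)`. It is
`x ↦ ∑ g(x') ⊙ x''` where `Δ(x) = ∑ x' ⊗ x''` is the coproduct of `S(V)` (and `g(1) = 0`), that is
`a_1 ⊙ ⋯ ⊙ a_n ↦ ∑ ε(σ) g(a_σ(1) ⊙ ⋯ ⊙ a_σ(p)) ⊙ a_σ(p+1) ⊙ ⋯ ⊙ a_σ(n)`, the sum being over all
`(p, n-p)`-unshuffles, `1 ≤ p ≤ n`. -/
def coder {𝒱 : ℤ → Submodule K M} [DirectSum.Decomposition 𝒱] (g : D 𝒱) :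
    Module.End K (RedSym 𝒱) :=
  LinearMap.codRestrict (redSub 𝒱)
    (LinearMap.mul' K (GrSym 𝒱) ∘ₗ
      TensorProduct.map (GrSym.ι 𝒱 ∘ₗ g ∘ₗ RedSym.proj 𝒱) LinearMap.id ∘ₗ
      GrSym.comul 𝒱 ∘ₗ (redSub 𝒱).subtype)
    (fun x => mem_redSub.2 (by
      have h : (GrSym.counit 𝒱).toLinearMap ∘ₗ LinearMap.mul' K (GrSym 𝒱) ∘ₗ
          TensorProduct.map (GrSym.ι 𝒱 ∘ₗ g ∘ₗ RedSym.proj 𝒱) LinearMap.id = 0 := by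
        apply TensorProduct.ext'
        intro y z
        simp [RedSym.counit_ι]
      exact LinearMap.congr_fun h (GrSym.comul 𝒱 x)))

theorem coe_coder {𝒱 : ℤ → Submodule K M} [DirectSum.Decomposition 𝒱] (g : D 𝒱) (x : RedSym 𝒱) :
    (coder g x : GrSym 𝒱) = LinearMap.mul' K (GrSym 𝒱)
      (TensorProduct.map (GrSym.ι 𝒱 ∘ₗ g ∘ₗ RedSym.proj 𝒱) LinearMap.id
        (GrSym.comul 𝒱 (x : GrSym 𝒱))) := rfl

/-- `f • g`, the corestriction of the composition of the coderivations of `f` and `g`: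
`(f • g)(a_1, …, a_n) = ∑ ε(σ) f(g(a_σ(1), …, a_σ(p)), a_σ(p+1), …, a_σ(n))`. -/
def bullet {𝒱 : ℤ → Submodule K M} [DirectSum.Decomposition 𝒱] (f g : D 𝒱) : D 𝒱 :=
  f ∘ₗ coder g

/-- The graded Lie bracket `[f, g] = f • g - (-1)^(p q) g • f` of `D(V)`, for `f` of degree `p` and
`g` of degree `q`. -/
def bracketD {𝒱 : ℤ → Submodule K M} [DirectSum.Decomposition 𝒱] (p q : ℤ) (f g : D 𝒱) : D 𝒱 :=
  bullet f g - ((-1 : K) ^ (p * q)) • bullet g f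

/-- The exponential `∑ f^n / n!` of a locally nilpotent endomorphism. -/
def expLN {X : Type w} [AddCommGroup X] [Module K X] (f : Module.End K X)
    (hf : ∀ x, ∃ n : ℕ, (f ^ n) x = 0) : Module.End K X :=
  have hfin : ∀ x, (Function.support fun n : ℕ => ((n.factorial : K)⁻¹) • (f ^ n) x).Finite := by
    intro x
    obtain ⟨N, hN⟩ := hf x
    apply (Set.finite_lt_nat N).subset
    intro n hn
    by_contra hlt
    apply hn
    have hle : N ≤ n := not_lt.1 hlt
    have : (f ^ n) x = 0 := by
      rw [← Nat.sub_add_cancel hle, pow_add, Module.End.mul_apply, hN, map_zero]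
    simp [this]
  { toFun := fun x => ∑ᶠ n : ℕ, ((n.factorial : K)⁻¹) • (f ^ n) x
    map_add' := by
      intro x y
      rw [← finsum_add_distrib (hfin x) (hfin y)]
      simp only [map_add, smul_add]
    map_smul' := by
      intro c x
      rw [RingHom.id_apply, smul_finsum' c (hfin x)]
      simp only [map_smul, smul_comm c] }

end Coalgebra

/-! ### Differential graded Lie algebras -/

/-- `(L, d, [,])` is a differential graded Lie algebra, where `L = ⨁ i, ℒ i`. -/
structure IsDGLA {K : Type u} [Field K] {L : Type v} [AddCommGroup L] [Module K L]
    (ℒ : ℤ → Submodule K L) (d : L →ₗ[K] L) (br : L →ₗ[K] L →ₗ[K] L) : Prop where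
  d_mem : ∀ i : ℤ, ∀ a ∈ ℒ i, d a ∈ ℒ (i + 1)
  d_d : ∀ a, d (d a) = 0
  br_mem : ∀ i j : ℤ, ∀ a ∈ ℒ i, ∀ b ∈ ℒ j, br a b ∈ ℒ (i + j)
  br_symm : ∀ i j : ℤ, ∀ a ∈ ℒ i, ∀ b ∈ ℒ j, br a b = -((-1 : K) ^ (i * j)) • br b a
  leibniz : ∀ i : ℤ, ∀ a ∈ ℒ i, ∀ b, d (br a b) = br (d a) b + ((-1 : K) ^ i) • br a (d b)
  jacobi : ∀ i j : ℤ, ∀ a ∈ ℒ i, ∀ b ∈ ℒ j, ∀ c,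
    br a (br b c) = br (br a b) c + ((-1 : K) ^ (i * j)) • br b (br a c)

/-- A differential graded Lie algebra over `K`. -/
structure DGLA (K : Type u) [Field K] where
  carrier : Type v
  [addCommGroup : AddCommGroup carrier]
  [module : Module K carrier]
  gr : ℤ → Submodule K carrier
  [decomposition : DirectSum.Decomposition gr]
  d : carrier →ₗ[K] carrier
  br : carrier →ₗ[K] carrier →ₗ[K] carrier
  isDGLA : IsDGLA gr d br

attribute [instance] DGLA.addCommGroup DGLA.module DGLA.decomposition

/-- Bundling. -/
def IsDGLA.toDGLA {K : Type u} [Field K] {L : Type v} [AddCommGroup L] [Module K L]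
    {ℒ : ℤ → Submodule K L} [DirectSum.Decomposition ℒ] {d : L →ₗ[K] L}
    {br : L →ₗ[K] L →ₗ[K] L} (h : IsDGLA ℒ d br) : DGLA.{u, v} K where
  carrier := L
  gr := ℒ
  d := d
  br := br
  isDGLA := h

namespace DGLA

variable {K : Type u} [Field K]

/-- The cocycles of `L`. -/
abbrev cocycles (L : DGLA.{u, v} K) : Submodule K L.carrier := LinearMap.ker L.d

/-- The coboundaries of `L`, as a subspace of the cocycles. -/
abbrev coboundaries (L : DGLA.{u, v} K) : Submodule K L.cocycles :=
  (LinearMap.range L.d).submoduleOf L.cocycles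

/-- The (total) cohomology `H(L) = ker d / im d`. -/
abbrev Cohomology (L : DGLA.{u, v} K) := L.cocycles ⧸ L.coboundaries

/-- The cohomology class of a cocycle. -/
abbrev cls (L : DGLA.{u, v} K) : L.cocycles →ₗ[K] L.Cohomology := L.coboundaries.mkQ

/-- `H^i(L)`: the classes of cocycles of degree `i`. -/
def cohomologyGr (L : DGLA.{u, v} K) (i : ℤ) : Submodule K L.Cohomology :=
  ((L.gr i).submoduleOf L.cocycles).map L.cls

/-- The component of degree `i`. -/
def component (L : DGLA.{u, v} K) (i : ℤ) : L.carrier →ₗ[K] L.carrier :=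
  (L.gr i).subtype ∘ₗ DirectSum.component K ℤ (fun i => L.gr i) i ∘ₗ
    (DirectSum.decomposeLinearEquiv L.gr).toLinearMap

theorem component_of_mem (L : DGLA.{u, v} K) {i : ℤ} {a : L.carrier} (ha : a ∈ L.gr i) :
    L.component i a = a := by
  exact DirectSum.decompose_of_mem_same L.gr ha

theorem component_of_mem_ne (L : DGLA.{u, v} K) {i j : ℤ} {a : L.carrier} (ha : a ∈ L.gr i)
    (h : i ≠ j) : L.component j a = 0 := by
  exact DirectSum.decompose_of_mem_ne L.gr ha h

theorem component_mem (L : DGLA.{u, v} K) (i : ℤ) (a : L.carrier) : L.component i a ∈ L.gr i :=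
  (DirectSum.decompose L.gr a i).2

theorem component_d (L : DGLA.{u, v} K) (i : ℤ) (a : L.carrier) :
    L.component (i + 1) (L.d a) = L.d (L.component i a) := by
  induction a using DirectSum.Decomposition.inductionOn L.gr with
  | zero => simp
  | add a b ha hb => simp only [map_add, ha, hb]
  | @homogeneous j a =>
    by_cases h : j = i
    · subst h
      rw [L.component_of_mem a.2, L.component_of_mem (L.isDGLA.d_mem _ _ a.2)]
    · rw [L.component_of_mem_ne a.2 h, map_zero,
        L.component_of_mem_ne (L.isDGLA.d_mem _ _ a.2) (by omega)]

/-- The component of degree `i` of a cocycle. -/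
def componentCocycles (L : DGLA.{u, v} K) (i : ℤ) : L.cocycles →ₗ[K] L.cocycles :=
  (L.component i).restrict (fun a ha => LinearMap.mem_ker.2 (by
    rw [← component_d, LinearMap.mem_ker.1 ha, map_zero]))

/-- The component of degree `i` of a cohomology class. -/
def componentCohomology (L : DGLA.{u, v} K) (i : ℤ) : L.Cohomology →ₗ[K] L.Cohomology :=
  Submodule.mapQ _ _ (L.componentCocycles i) (by
    rintro ⟨a, ha⟩ ⟨b, hb⟩
    have hb' : L.d b = a := hb
    refine ⟨L.component (i - 1) b, ?_⟩
    change _ = L.component i a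
    rw [← component_d, sub_add_cancel, hb'])

theorem componentCohomology_of_mem (L : DGLA.{u, v} K) {i : ℤ} {a : L.Cohomology}
    (ha : a ∈ L.cohomologyGr i) : L.componentCohomology i a = a := by
  obtain ⟨z, hz, rfl⟩ := ha
  change L.cls (L.componentCocycles i z) = L.cls z
  congr 1
  exact Subtype.ext (L.component_of_mem hz)

theorem componentCohomology_of_mem_ne (L : DGLA.{u, v} K) {i j : ℤ} {a : L.Cohomology}
    (ha : a ∈ L.cohomologyGr i) (h : i ≠ j) : L.componentCohomology j a = 0 := by
  obtain ⟨z, hz, rfl⟩ := ha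
  change L.cls (L.componentCocycles j z) = 0
  rw [show L.componentCocycles j z = 0 from Subtype.ext (L.component_of_mem_ne hz h), map_zero]

theorem cohomology_isInternal (L : DGLA.{u, v} K) : DirectSum.IsInternal L.cohomologyGr := by
  constructor
  · rw [injective_iff_map_eq_zero]
    intro x hx
    have key : ∀ (y : ⨁ i, L.cohomologyGr i) (i : ℤ),
        L.componentCohomology i (DirectSum.coeAddMonoidHom L.cohomologyGr y) = y i := by
      intro y i
      induction y using DirectSum.induction_on with
      | zero => simp
      | of j y =>
        rw [DirectSum.coeAddMonoidHom_of]
        by_cases h : j = i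
        · subst h
          rw [L.componentCohomology_of_mem y.2, DirectSum.of_eq_same]
        · rw [L.componentCohomology_of_mem_ne y.2 h, DirectSum.of_eq_of_ne _ _ _ (Ne.symm h)]
          rfl
      | add y z hy hz => simp only [map_add, hy, hz, DirectSum.add_apply, Submodule.coe_add]
    ext i
    rw [← key x i, hx, map_zero]
    rfl
  · intro a
    obtain ⟨⟨z, hz⟩, rfl⟩ := Submodule.mkQ_surjective _ a
    classical
    refine ⟨∑ i ∈ (DirectSum.decompose L.gr z).support,
      DirectSum.of (fun i => L.cohomologyGr i) i
        ⟨L.cls (L.componentCocycles i ⟨z, hz⟩), ⟨_, L.component_mem i z, rfl⟩⟩, ?_⟩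
    rw [map_sum]
    simp only [DirectSum.coeAddMonoidHom_of]
    rw [← map_sum]
    congr 1
    apply Subtype.ext
    rw [Submodule.coe_sum]
    exact DirectSum.sum_support_decompose L.gr z

instance cohomologyDecomposition (L : DGLA.{u, v} K) :
    DirectSum.Decomposition L.cohomologyGr :=
  L.cohomology_isInternal.chooseDecomposition

theorem leibniz' (L : DGLA.{u, v} K) (a b : L.carrier) :
    L.d (L.br a b) = L.br (L.d a) b + L.br (signMap L.gr a) (L.d b) := by
  induction a using DirectSum.Decomposition.inductionOn L.gr with
  | zero => simp
  | add a a' ha ha' =>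
    simp only [map_add, LinearMap.add_apply, ha, ha']
    abel
  | @homogeneous i a =>
    rw [L.isDGLA.leibniz i a a.2, signMap_apply L.gr a.2]
    simp

theorem signMap_signMap (L : DGLA.{u, v} K) (a : L.carrier) :
    signMap L.gr (signMap L.gr a) = a := by
  induction a using DirectSum.Decomposition.inductionOn L.gr with
  | zero => simp
  | add a a' ha ha' => simp only [map_add, ha, ha']
  | @homogeneous i a =>
    rw [signMap_apply L.gr a.2, map_smul, signMap_apply L.gr a.2, smul_smul, ← mul_zpow]
    simp

theorem d_signMap (L : DGLA.{u, v} K) (a : L.carrier) :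
    L.d (signMap L.gr a) = -signMap L.gr (L.d a) := by
  induction a using DirectSum.Decomposition.inductionOn L.gr with
  | zero => simp
  | add a a' ha ha' =>
    simp only [map_add, ha, ha']
    abel
  | @homogeneous i a =>
    rw [signMap_apply L.gr a.2, map_smul, signMap_apply L.gr (L.isDGLA.d_mem _ _ a.2),
      zpow_add₀ (neg_ne_zero.2 one_ne_zero)]
    simp

/-- The bracket of two cocycles. -/
def brCocycles (L : DGLA.{u, v} K) : L.cocycles →ₗ[K] L.cocycles →ₗ[K] L.cocycles :=
  LinearMap.mk₂ K (fun a b => ⟨L.br a b, LinearMap.mem_ker.2 (by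
      rw [leibniz', LinearMap.mem_ker.1 a.2, LinearMap.mem_ker.1 b.2]
      simp)⟩)
    (by intro a a' b; ext; simp) (by intro c a b; ext; simp)
    (by intro a b b'; ext; simp) (by intro c a b; ext; simp)

/-- The bracket induced in cohomology: `[cls a, cls b] = cls [a, b]`. -/
def brCohomology (L : DGLA.{u, v} K) : L.Cohomology →ₗ[K] L.Cohomology →ₗ[K] L.Cohomology :=
  Submodule.liftQ _
    { toFun := fun a => Submodule.mapQ _ _ (L.brCocycles a) (by
        rintro ⟨b, hb⟩ ⟨c, hc⟩
        have hc' : L.d c = b := hc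
        have ha : L.d a = 0 := a.2
        refine ⟨L.br (signMap L.gr a) c, ?_⟩
        change _ = L.br a b
        rw [leibniz', d_signMap, ha, signMap_signMap, hc']
        simp)
      map_add' := by
        intro a a'
        apply Submodule.linearMap_qext
        ext b
        simp
      map_smul' := by
        intro c a
        apply Submodule.linearMap_qext
        ext b
        simp }
    (by
      rintro ⟨a, ha⟩ ⟨c, hc⟩
      have hc' : L.d c = a := hc
      rw [LinearMap.mem_ker]
      apply Submodule.linearMap_qext
      ext b
      have hb : L.d b = 0 := b.2
      change L.cls (L.brCocycles ⟨a, ha⟩ b) = 0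
      rw [Submodule.mkQ_apply, Submodule.Quotient.mk_eq_zero]
      refine ⟨L.br c b, ?_⟩
      change _ = L.br a b
      rw [leibniz', hb, hc']
      simp)

theorem brCohomology_cls (L : DGLA.{u, v} K) (a b : L.cocycles) :
    L.brCohomology (L.cls a) (L.cls b) = L.cls (L.brCocycles a b) := rfl

/-- The cohomology of a DGLA, as a DGLA with zero differential and the induced bracket. -/
def cohomology (L : DGLA.{u, v} K) : DGLA.{u, v} K where
  carrier := L.Cohomology
  gr := L.cohomologyGr
  d := 0
  br := L.brCohomology
  isDGLA :=
    { d_mem := by intro i a _; simp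
      d_d := by simp
      br_mem := by
        rintro i j _ ⟨a, ha, rfl⟩ _ ⟨b, hb, rfl⟩
        exact ⟨L.brCocycles a b, L.isDGLA.br_mem i j a ha b hb, rfl⟩
      br_symm := by
        rintro i j _ ⟨a, ha, rfl⟩ _ ⟨b, hb, rfl⟩
        rw [brCohomology_cls, brCohomology_cls, ← map_smul]
        congr 1
        exact Subtype.ext (L.isDGLA.br_symm i j a ha b hb)
      leibniz := by intro i a _ b; simp
      jacobi := by
        rintro i j _ ⟨a, ha, rfl⟩ _ ⟨b, hb, rfl⟩ c
        obtain ⟨c, rfl⟩ := Submodule.mkQ_surjective _ c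
        simp only [brCohomology_cls]
        rw [← map_smul, ← map_add]
        congr 1
        exact Subtype.ext (L.isDGLA.jacobi i j a ha b hb c) }

/-- Morphisms of differential graded Lie algebras. -/
structure Hom (L L' : DGLA.{u, v} K) where
  toLin : L.carrier →ₗ[K] L'.carrier
  map_mem : ∀ i : ℤ, ∀ a ∈ L.gr i, toLin a ∈ L'.gr i
  map_d : ∀ a, toLin (L.d a) = L'.d (toLin a)
  map_br : ∀ a b, toLin (L.br a b) = L'.br (toLin a) (toLin b)

/-- The map induced in cohomology. -/
def Hom.onCohomology {L L' : DGLA.{u, v} K} (f : L.Hom L') : L.Cohomology →ₗ[K] L'.Cohomology :=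
  Submodule.mapQ _ _
    (f.toLin.restrict (p := L.cocycles) (q := L'.cocycles) (fun a ha => LinearMap.mem_ker.2 (by
      rw [← f.map_d, LinearMap.mem_ker.1 ha, map_zero])))
    (by
      rintro ⟨a, ha⟩ ⟨b, hb⟩
      have hb' : L.d b = a := hb
      refine ⟨f.toLin b, ?_⟩
      change _ = f.toLin a
      rw [← f.map_d, hb'])

/-- A quasi-isomorphism: a morphism of DGLAs inducing an isomorphism in cohomology. -/
def Hom.IsQuasiIso {L L' : DGLA.{u, v} K} (f : L.Hom L') : Prop :=
  Function.Bijective f.onCohomology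

/-- Two DGLAs are quasi-isomorphic (isomorphic in the homotopy category) if they are connected by a
zigzag of quasi-isomorphisms. -/
def QuasiIsomorphic : DGLA.{u, v} K → DGLA.{u, v} K → Prop :=
  Relation.EqvGen fun L L' => ∃ f : L.Hom L', f.IsQuasiIso

/-- Formality: being quasi-isomorphic to the cohomology. -/
def IsFormal (L : DGLA.{u, v} K) : Prop := QuasiIsomorphic L L.cohomology

/-- A DGLA is abelian if its bracket is zero. -/
def IsAbelian (L : DGLA.{u, v} K) : Prop := L.br = 0

/-- Homotopy abelianity: being quasi-isomorphic to an abelian DGLA. -/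
def IsHomotopyAbelian (L : DGLA.{u, v} K) : Prop :=
  ∃ N : DGLA.{u, v} K, N.IsAbelian ∧ QuasiIsomorphic L N

end DGLA

/-! ### `L_∞`-structures -/

section LInfinity

variable {K : Type u} [Field K] {M : Type v} [AddCommGroup M] [Module K M]

/-- An `L_∞`-structure on `V[-1]`: an element `∂ ∈ D(V)` of degree `1` with `[∂, ∂] = 0`. -/
structure IsLInfinity (𝒱 : ℤ → Submodule K M) [DirectSum.Decomposition 𝒱] (δ : D 𝒱) : Prop where
  degree : δ.HasDegree 1
  bracket : bracketD 1 1 δ δ = 0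

/-- An `L_∞`-isomorphism from `(V[-1], δ)` to `(W[-1], ε)`: a bijective linear map of degree zero
between the reduced symmetric coalgebras of `V` and `W`, which is a morphism of coalgebras and
commutes with the codifferentials given by `δ` and `ε`. -/
structure IsLInfinityIso {N : Type w} [AddCommGroup N] [Module K N]
    (𝒱 : ℤ → Submodule K M) [DirectSum.Decomposition 𝒱] (δ : D 𝒱)
    (𝒲 : ℤ → Submodule K N) [DirectSum.Decomposition 𝒲] (ε : D 𝒲)
    (F : RedSym 𝒱 →ₗ[K] RedSym 𝒲) : Prop where
  source : IsLInfinity 𝒱 δ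
  target : IsLInfinity 𝒲 ε
  bijective : Function.Bijective F
  degree : ∀ i : ℤ, ∀ x : RedSym 𝒱, (x : GrSym 𝒱) ∈ GrSym.deg 𝒱 i → (F x : GrSym 𝒲) ∈ GrSym.deg 𝒲 i
  map_comul : ∀ x, RedSym.comul 𝒲 (F x) = TensorProduct.map F F (RedSym.comul 𝒱 x)
  map_coder : ∀ x, F (coder δ x) = coder ε (F x)

/-- The bilinear map `(a, b) ↦ (-1)^|a| B(a, b)`. -/
def decalage (𝒱 : ℤ → Submodule K M) [DirectSum.Decomposition 𝒱] (B : M →ₗ[K] M →ₗ[K] M) :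
    M →ₗ[K] M →ₗ[K] M :=
  B ∘ₗ signMap 𝒱

theorem IsDGLA.decalage_symm {ℒ : ℤ → Submodule K M} {d : M →ₗ[K] M} {br : M →ₗ[K] M →ₗ[K] M}
    (h : IsDGLA ℒ d br) {𝒱 : ℤ → Submodule K M} [DirectSum.Decomposition 𝒱]
    (h𝒱 : ∀ i, 𝒱 i = ℒ (i + 1)) : IsGrSymm 𝒱 (decalage 𝒱 br) := by
  intro i j a ha b hb
  have h0 : (-1 : K) ≠ 0 := neg_ne_zero.2 one_ne_zero
  have ha' := ha
  have hb' := hb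
  rw [h𝒱] at ha' hb'
  simp only [decalage, LinearMap.comp_apply, signMap_apply 𝒱 ha, signMap_apply 𝒱 hb, map_smul,
    LinearMap.smul_apply]
  rw [h.br_symm _ _ a ha' b hb', smul_smul, smul_smul]
  congr 1
  have h1 : -((-1 : K) ^ ((i + 1) * (j + 1))) = (-1 : K) ^ ((i + 1) * (j + 1) + 1) := by
    rw [zpow_add_one₀ h0]; ring
  rw [h1, ← zpow_add₀ h0, ← zpow_add₀ h0]
  apply neg_one_zpow_eq_of_even_sub
  exact ⟨i + 1, by ring⟩

/-- The `L_∞`-structure of a DGLA `(L, d, [,])` in `D(V)`, where `V = L[1]`: it is `d` on `V`,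
`(-1)^|a| [a, b]` on `a ⊙ b ∈ V ⊙ V` (with `|a|` the degree in `V`), and zero on `⊙^n V` for
`n ≥ 3`. -/
def IsDGLA.toD {ℒ : ℤ → Submodule K M} {d : M →ₗ[K] M} {br : M →ₗ[K] M →ₗ[K] M}
    (h : IsDGLA ℒ d br) (𝒱 : ℤ → Submodule K M) [DirectSum.Decomposition 𝒱]
    (h𝒱 : ∀ i, 𝒱 i = ℒ (i + 1)) : D 𝒱 :=
  D.ofLinear 𝒱 d + D.ofBilinear 𝒱 (decalage 𝒱 br) (h.decalage_symm h𝒱)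

/-- `A[2k] = (A[2k-1])[1]`. -/
theorem shift_two_mul (𝒱 : ℤ → Submodule K M) (k i : ℤ) :
    shift 𝒱 (2 * k) i = shift 𝒱 (2 * k - 1) (i + 1) := by
  change 𝒱 (i + 2 * k) = 𝒱 (i + 1 + (2 * k - 1))
  congr 1
  ring

end LInfinity

end

end FormalityCriterion

open FormalityCriterion

namespace FormalityCriterion

open scoped TensorProduct DirectSum

noncomputable section

universe u v w

/-! Let `r`, `δ`, `q` be the coderivations of `S(A[2k])` with corestrictions `R`, `d`, `Q`. A
coderivation is determined by its corestriction (`GrSym.toV_hat`) and the graded commutator of two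
coderivations is again one (`GrSym.hat_commutator`). So the hypotheses become operator identities:
`δ² = 0`, `q = rδ - δr`, `rq = qr`. Then `δq + qδ = [r, δ²] = 0`, and applying `[r, ·]` to this
relation gives `2q² = 0` (`commutator_sq_eq_zero`). Hence `(δ + q)² = 0`. Read on words of three
letters, `q² = 0` is the Jacobi identity of the bracket; the Leibniz rule is `[d, Q] = 0`, which
follows from the explicit formula for `Q`.

The operator `r` replaces two letters by one, so it is locally nilpotent. Since `[r, [r, δ]] = 0`,
the expansion of `e^r δ e^(-r)` stops at `δ + q` (`expLN_conj`). The coproduct intertwines `r` with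
`r ⊗ 1 + 1 ⊗ r`, a sum of two commuting operators, so `e^r` is a morphism of coalgebras
(`comul_expLN`), with inverse `e^(-r)`.

Formality and homotopy abelianity are not deduced from the `L_∞`-isomorphism but from an explicit
zigzag of DGLAs. The family `e^(tr)` moves `δ` to `δ + tq`; this path is encoded by the bracket
`t[a,b] + dt ρ(a,b)` on `A[t, dt]`, where `ρ` is `R` up to sign. Its Leibniz rule uses `Q = [R, d]`,
and its Jacobi identity uses `[Q, Q] = 0` and `[R, Q] = 0`; there is no condition quadratic in `ρ`
because `dt² = 0` (`Path.isDGLA`). Evaluations at `t = 1` and `t = 0` are quasi-isomorphisms, with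
integration as homotopy, onto the given DGLA and onto the complex with zero bracket. On cocycles the
bracket is `d(ρ(a,b))`, so the cohomology has zero bracket, and a degree-preserving choice of
representatives maps it quasi-isomorphically to the complex with zero bracket. -/

theorem neg_one_zpow_add {K : Type u} [Field K] (m n : ℤ) :
    (-1 : K) ^ (m + n) = (-1 : K) ^ m * (-1 : K) ^ n :=
  zpow_add₀ (neg_ne_zero.2 one_ne_zero) m n

theorem neg_one_zpow_mul_self {K : Type u} [Field K] (n : ℤ) :
    (-1 : K) ^ n * (-1 : K) ^ n = 1 := by
  rw [← mul_zpow]; simp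

/-! ### Words in the graded symmetric algebra -/

namespace GrSym

variable {K : Type u} [Field K] {M : Type v} [AddCommGroup M] [Module K M]
variable {𝒱 : ℤ → Submodule K M}

/-- Left multiplication by `v ∈ V` in `S(V)`. -/
def mulι (𝒱 : ℤ → Submodule K M) (v : M) : Module.End K (GrSym 𝒱) :=
  LinearMap.mulLeft K (ι 𝒱 v)

@[simp] theorem mulι_apply (v : M) (x : GrSym 𝒱) : mulι 𝒱 v x = ι 𝒱 v * x := rfl

theorem ι_mem_deg' {i : ℤ} {v : M} (hv : v ∈ 𝒱 i) : ι 𝒱 v ∈ deg 𝒱 i :=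
  ι_mem_deg 𝒱 ⟨v, hv⟩

theorem mulι_mem_deg {i j : ℤ} {v : M} (hv : v ∈ 𝒱 i) {x : GrSym 𝒱} (hx : x ∈ deg 𝒱 j) :
    ι 𝒱 v * x ∈ deg 𝒱 (i + j) :=
  SetLike.mul_mem_graded (ι_mem_deg' hv) hx

/-- A submodule of `S(V)` containing `1` and stable under multiplication by homogeneous elements
of `V` is everything. -/
theorem word_induction [DirectSum.Decomposition 𝒱] {P : GrSym 𝒱 → Prop}
    (zero : P 0) (add : ∀ x y, P x → P y → P (x + y)) (smul : ∀ (c : K) x, P x → P (c • x))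
    (one : P 1) (mul : ∀ (i : ℤ) (v : M), v ∈ 𝒱 i → ∀ y, P y → P (ι 𝒱 v * y))
    (x : GrSym 𝒱) : P x := by
  let S : Submodule K (GrSym 𝒱) :=
    { carrier := {x | P x}, zero_mem' := zero, add_mem' := fun ha hb => add _ _ ha hb
      smul_mem' := fun c x hx => smul c x hx }
  have key : ∀ n, deg 𝒱 n ≤ S := by
    intro n
    apply Submodule.span_le.2
    rintro _ ⟨l, -, rfl⟩
    induction l with
    | nil => exact one
    | cons a l ih =>
      rw [List.map_cons, List.prod_cons]
      exact mul _ _ a.2.2 _ ih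
  induction x using DirectSum.Decomposition.inductionOn (deg 𝒱) with
  | zero => exact zero
  | add a b ha hb => exact add _ _ ha hb
  | homogeneous a => exact key _ a.2

theorem linearMap_ext {N : Type w} [AddCommGroup N] [Module K N] [DirectSum.Decomposition 𝒱]
    {f g : GrSym 𝒱 →ₗ[K] N} (h : ∀ i, ∀ x ∈ deg 𝒱 i, f x = g x) : f = g := by
  apply LinearMap.ext
  intro x
  induction x using DirectSum.Decomposition.inductionOn (deg 𝒱) with
  | zero => simp
  | add a b ha hb => rw [map_add, map_add, ha, hb]
  | homogeneous a => exact h _ _ a.2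

theorem tensor_ext {N : Type w} [AddCommGroup N] [Module K N] [DirectSum.Decomposition 𝒱]
    {f g : GrSym 𝒱 ⊗[K] GrSym 𝒱 →ₗ[K] N}
    (h : ∀ i j, ∀ x ∈ deg 𝒱 i, ∀ y ∈ deg 𝒱 j, f (x ⊗ₜ y) = g (x ⊗ₜ y)) : f = g := by
  apply TensorProduct.ext
  apply linearMap_ext
  intro i x hx
  apply linearMap_ext
  intro j y hy
  exact h i j x hx y hy

/-! ### Koszul signs as operators -/

section Sign

variable (𝒱) [DirectSum.Decomposition 𝒱]

/-- The map `x ↦ (-1)^(p |x|) x` on `S(V)`. -/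
def sgn (p : ℤ) : Module.End K (GrSym 𝒱) :=
  DirectSum.toModule K ℤ _ (fun i => ((-1 : K) ^ (p * i)) • (deg 𝒱 i).subtype) ∘ₗ
    (DirectSum.decomposeLinearEquiv (deg 𝒱)).toLinearMap

variable {𝒱}

theorem sgn_apply (p : ℤ) {i : ℤ} {x : GrSym 𝒱} (hx : x ∈ deg 𝒱 i) :
    sgn 𝒱 p x = ((-1 : K) ^ (p * i)) • x := by
  simp only [sgn, LinearMap.comp_apply, LinearEquiv.coe_coe,
    DirectSum.decomposeLinearEquiv_apply, DirectSum.decompose_of_mem (deg 𝒱) hx]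
  rw [← DirectSum.lof_eq_of K, DirectSum.toModule_lof]
  rfl

variable (𝒱) in
theorem sgn_zero : sgn 𝒱 0 = LinearMap.id := by
  apply linearMap_ext
  intro i x hx
  rw [sgn_apply 0 hx]
  simp

variable (𝒱) in
theorem sgn_add (p q : ℤ) : sgn 𝒱 (p + q) = sgn 𝒱 p ∘ₗ sgn 𝒱 q := by
  apply linearMap_ext
  intro i x hx
  rw [LinearMap.comp_apply, sgn_apply q hx, map_smul, sgn_apply p hx, sgn_apply _ hx, smul_smul,
    add_mul, neg_one_zpow_add, mul_comm]

theorem sgn_comp_of_mem_deg (p q : ℤ) {f : Module.End K (GrSym 𝒱)}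
    (hf : ∀ i, ∀ x ∈ deg 𝒱 i, f x ∈ deg 𝒱 (i + q)) :
    sgn 𝒱 p ∘ₗ f = ((-1 : K) ^ (p * q)) • (f ∘ₗ sgn 𝒱 p) := by
  apply linearMap_ext
  intro i x hx
  rw [LinearMap.comp_apply, sgn_apply p (hf i x hx), LinearMap.smul_apply, LinearMap.comp_apply,
    sgn_apply p hx, map_smul, smul_smul, mul_add, neg_one_zpow_add, mul_comm]

theorem sgn_comp_mulι (p : ℤ) {i : ℤ} {v : M} (hv : v ∈ 𝒱 i) :
    sgn 𝒱 p ∘ₗ mulι 𝒱 v = ((-1 : K) ^ (p * i)) • (mulι 𝒱 v ∘ₗ sgn 𝒱 p) :=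
  sgn_comp_of_mem_deg p i fun j x hx => by
    rw [add_comm]; exact mulι_mem_deg hv hx

end Sign

/-! ### The coproduct, one letter at a time -/

section Comul

variable [DirectSum.Decomposition 𝒱]

theorem comul_one : comul 𝒱 1 = 1 ⊗ₜ 1 := by
  simp only [comul, LinearMap.comp_apply, AlgHom.toLinearMap_apply, map_one]
  rfl

/-- In the graded tensor product algebra, `v ⊗ 1` multiplies the left factor, while `1 ⊗ v` must
first cross the left factor. The sign of this crossing is the operator `sgn 𝒱 i`, so that from here
on only the ordinary tensor product is needed. -/
theorem of_symm_comulι_mul {i : ℤ} {v : M} (hv : v ∈ 𝒱 i) (z : deg 𝒱 ᵍ⊗[K] deg 𝒱) :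
    (GradedTensorProduct.of K (deg 𝒱) (deg 𝒱)).symm (comulι 𝒱 v * z) =
      TensorProduct.map (mulι 𝒱 v) LinearMap.id
          ((GradedTensorProduct.of K (deg 𝒱) (deg 𝒱)).symm z) +
        TensorProduct.map (sgn 𝒱 i) (mulι 𝒱 v)
          ((GradedTensorProduct.of K (deg 𝒱) (deg 𝒱)).symm z) := by
  obtain ⟨z, rfl⟩ := (GradedTensorProduct.of K (deg 𝒱) (deg 𝒱)).surjective z
  have hs : ∀ (n : ℤ) (x : deg 𝒱 ᵍ⊗[K] deg 𝒱), ((-1 : ℤˣ) ^ n) • x = ((-1 : K) ^ n) • x := by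
    intro n x
    rcases Int.even_or_odd n with h | h
    · rw [h.neg_one_zpow, h.neg_one_zpow, one_smul, one_smul]
    · rw [h.neg_one_zpow, h.neg_one_zpow, neg_smul, one_smul, Units.smul_def]
      simp
  suffices H : (GradedTensorProduct.of K (deg 𝒱) (deg 𝒱)).symm.toLinearMap ∘ₗ
      GradedTensorProduct.mulHom (deg 𝒱) (deg 𝒱) (comulι 𝒱 v) ∘ₗ
        (GradedTensorProduct.of K (deg 𝒱) (deg 𝒱)).toLinearMap =
      TensorProduct.map (mulι 𝒱 v) LinearMap.id + TensorProduct.map (sgn 𝒱 i) (mulι 𝒱 v) from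
    LinearMap.congr_fun H z
  apply tensor_ext
  intro j l x hx y hy
  have e1 := GradedTensorProduct.tmul_one_mul_coe_tmul (R := K) (deg 𝒱) (deg 𝒱)
    (ι 𝒱 v) (⟨x, hx⟩ : deg 𝒱 j) y
  have e2 := (GradedTensorProduct.tmul_coe_mul_coe_tmul (R := K) (deg 𝒱) (deg 𝒱)
    1 (⟨ι 𝒱 v, ι_mem_deg' hv⟩ : deg 𝒱 i) (⟨x, hx⟩ : deg 𝒱 j) y).trans (hs (i * j) _)
  have e3 : comulι 𝒱 v * GradedTensorProduct.of K (deg 𝒱) (deg 𝒱) (x ⊗ₜ y) =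
      GradedTensorProduct.of K (deg 𝒱) (deg 𝒱) ((ι 𝒱 v * x) ⊗ₜ y) +
        ((-1 : K) ^ (i * j)) •
          GradedTensorProduct.of K (deg 𝒱) (deg 𝒱) ((1 * x) ⊗ₜ (ι 𝒱 v * y)) := by
    refine Eq.trans ?_ (congrArg₂ (· + ·) e1 e2)
    rw [← add_mul]
    rfl
  simp only [LinearMap.comp_apply, LinearEquiv.coe_coe, ← GradedTensorProduct.mul_def, e3,
    LinearMap.add_apply, TensorProduct.map_tmul, sgn_apply i hx, map_add, map_smul,
    GradedTensorProduct.of_symm_of, one_mul, mulι_apply, LinearMap.id_apply,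
    TensorProduct.smul_tmul']

theorem comul_ι_mul {i : ℤ} {v : M} (hv : v ∈ 𝒱 i) (x : GrSym 𝒱) :
    comul 𝒱 (ι 𝒱 v * x) = TensorProduct.map (mulι 𝒱 v) LinearMap.id (comul 𝒱 x) +
      TensorProduct.map (sgn 𝒱 i) (mulι 𝒱 v) (comul 𝒱 x) := by
  simp only [comul, LinearMap.comp_apply, AlgHom.toLinearMap_apply, map_mul, lift_ι,
    LinearEquiv.coe_coe]
  exact of_symm_comulι_mul hv _

end Comul

/-! ### The projections to the parts of word length at most two -/

section Components

variable {N : Type w} [AddCommGroup N] [Module K N]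

theorem counit_ι_mul (v : M) (x : GrSym 𝒱) : counit 𝒱 (ι 𝒱 v * x) = 0 := by
  simp [counit]

theorem components_one (B : M →ₗ[K] M →ₗ[K] N) (h : IsGrSymm 𝒱 B) :
    components 𝒱 B h 1 = (1, 0, 0) := by
  simp [components]

theorem components_ι_mul (B : M →ₗ[K] M →ₗ[K] N) (h : IsGrSymm 𝒱 B) (v : M) (x : GrSym 𝒱) :
    components 𝒱 B h (ι 𝒱 v * x) =
      (0, (components 𝒱 B h x).1 • v, B v (components 𝒱 B h x).2.1) := by
  simp [components, mulOp]

theorem toV_one : toV 𝒱 1 = 0 := by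
  exact congrArg (fun p => p.2.1) (components_one (0 : M →ₗ[K] M →ₗ[K] M) _)

theorem quadratic_one (B : M →ₗ[K] M →ₗ[K] N) (h : IsGrSymm 𝒱 B) : quadratic 𝒱 B h 1 = 0 := by
  simp [quadratic, components_one]

variable [DirectSum.Decomposition 𝒱]

theorem components_fst (B : M →ₗ[K] M →ₗ[K] N) (h : IsGrSymm 𝒱 B) (x : GrSym 𝒱) :
    (components 𝒱 B h x).1 = counit 𝒱 x := by
  induction x using word_induction with
  | zero => simp
  | add x y hx hy => simp [hx, hy]
  | smul c x hx => simp [hx]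
  | one => simp [components_one]
  | mul i v hv y hy => rw [components_ι_mul, counit_ι_mul]

theorem toV_ι_mul (v : M) (x : GrSym 𝒱) : toV 𝒱 (ι 𝒱 v * x) = counit 𝒱 x • v := by
  have h := components_ι_mul (𝒱 := 𝒱) (0 : M →ₗ[K] M →ₗ[K] M) (by intro i j a _ b _; simp) v x
  exact (congrArg (fun p => p.2.1) h).trans
    (congrArg (· • v) (components_fst (0 : M →ₗ[K] M →ₗ[K] M) _ x))

theorem toV_ι (v : M) : toV 𝒱 (ι 𝒱 v) = v := by
  simpa using toV_ι_mul v (1 : GrSym 𝒱)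

theorem components_snd_fst (B : M →ₗ[K] M →ₗ[K] N) (h : IsGrSymm 𝒱 B) (x : GrSym 𝒱) :
    (components 𝒱 B h x).2.1 = toV 𝒱 x := by
  induction x using word_induction with
  | zero => simp
  | add x y hx hy => simp [hx, hy]
  | smul c x hx => simp [hx]
  | one => simp [components_one, toV_one]
  | mul i v hv y hy => rw [components_ι_mul, toV_ι_mul, components_fst]

theorem quadratic_ι_mul (B : M →ₗ[K] M →ₗ[K] N) (h : IsGrSymm 𝒱 B) (v : M) (x : GrSym 𝒱) :
    quadratic 𝒱 B h (ι 𝒱 v * x) = B v (toV 𝒱 x) := by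
  simp [quadratic, components_ι_mul, components_snd_fst]

end Components

/-! ### Coderivations of the symmetric coalgebra -/

section Hat

/-- `G : S(V) → V` is homogeneous of degree `p`. -/
def HasDeg (G : GrSym 𝒱 →ₗ[K] M) (p : ℤ) : Prop :=
  ∀ i, ∀ x ∈ deg 𝒱 i, G x ∈ 𝒱 (i + p)

/-- Allows inductions on words in which `G` is generalized: removing the first letter `v` replaces
`G` by `G ∘ₗ mulι 𝒱 v`. This operation does not preserve vanishing on `1`, which is why `G` is
defined on all of `S(V)` and not only on its reduced part. -/
theorem HasDeg.comp_mulι {G : GrSym 𝒱 →ₗ[K] M} {p : ℤ} (hG : HasDeg G p) {i : ℤ} {v : M}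
    (hv : v ∈ 𝒱 i) : HasDeg (G ∘ₗ mulι 𝒱 v) (p + i) := by
  intro j x hx
  have := hG _ _ (mulι_mem_deg hv hx)
  rwa [show i + j + p = j + (p + i) by ring] at this

variable [DirectSum.Decomposition 𝒱]

/-- The coderivation `x ↦ ∑ G(x') ⊙ x''` of `S(V)` with corestriction `G : S(V) → V`. -/
def hat (G : GrSym 𝒱 →ₗ[K] M) : Module.End K (GrSym 𝒱) :=
  LinearMap.mul' K (GrSym 𝒱) ∘ₗ TensorProduct.map (ι 𝒱 ∘ₗ G) LinearMap.id ∘ₗ comul 𝒱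

theorem hat_apply (G : GrSym 𝒱 →ₗ[K] M) (x : GrSym 𝒱) :
    hat G x = LinearMap.mul' K (GrSym 𝒱)
      (TensorProduct.map (ι 𝒱 ∘ₗ G) LinearMap.id (comul 𝒱 x)) := rfl

theorem hat_add (F G : GrSym 𝒱 →ₗ[K] M) : hat (F + G) = hat F + hat G := by
  ext x
  simp [hat_apply, LinearMap.comp_add, TensorProduct.map_add_left]

theorem hat_smul (c : K) (G : GrSym 𝒱 →ₗ[K] M) : hat (c • G) = c • hat G := by
  ext x
  simp [hat_apply, LinearMap.comp_smul, TensorProduct.map_smul_left]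

theorem hat_zero : hat (0 : GrSym 𝒱 →ₗ[K] M) = 0 := by
  ext x
  simp [hat_apply]

@[simp] theorem hat_one (G : GrSym 𝒱 →ₗ[K] M) : hat G 1 = ι 𝒱 (G 1) := by
  simp [hat_apply, comul_one]

/-- In each term of the sum over unshuffles, `v` is either an argument of `G` or outside it. This
recursion is the basis of all later computations with coderivations. -/
theorem hat_ι_mul {G : GrSym 𝒱 →ₗ[K] M} {p : ℤ} (hG : HasDeg G p) {i : ℤ} {v : M}
    (hv : v ∈ 𝒱 i) (x : GrSym 𝒱) :
    hat G (ι 𝒱 v * x) =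
      hat (G ∘ₗ mulι 𝒱 v) x + ((-1 : K) ^ (p * i)) • (ι 𝒱 v * hat G x) := by
  rw [hat_apply, comul_ι_mul hv, map_add, map_add]
  congr 1
  · rw [hat_apply, ← LinearMap.comp_apply (TensorProduct.map _ _), ← TensorProduct.map_comp]
    rfl
  · rw [hat_apply]
    generalize comul 𝒱 x = z
    suffices H : LinearMap.mul' K (GrSym 𝒱) ∘ₗ TensorProduct.map (ι 𝒱 ∘ₗ G) LinearMap.id ∘ₗ
        TensorProduct.map (sgn 𝒱 i) (mulι 𝒱 v) =
        ((-1 : K) ^ (p * i)) • (mulι 𝒱 v ∘ₗ LinearMap.mul' K (GrSym 𝒱) ∘ₗ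
          TensorProduct.map (ι 𝒱 ∘ₗ G) LinearMap.id) from LinearMap.congr_fun H z
    apply tensor_ext
    intro j l x hx y hy
    simp only [LinearMap.comp_apply, TensorProduct.map_tmul, sgn_apply i hx, map_smul,
      LinearMap.mul'_apply, LinearMap.id_apply, mulι_apply, LinearMap.smul_apply, smul_mul_assoc,
      ← mul_assoc]
    -- Moving `v` across `x` and back across `G x` leaves only the sign of crossing the degree `p`
    -- of `G`.
    rw [ι_comm 𝒱 (hG j x hx) hv, smul_mul_assoc, smul_smul, add_mul, neg_one_zpow_add,
      mul_comm j i, ← mul_assoc, neg_one_zpow_mul_self, one_mul]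

theorem counit_hat (G : GrSym 𝒱 →ₗ[K] M) (x : GrSym 𝒱) : counit 𝒱 (hat G x) = 0 := by
  have h : (counit 𝒱).toLinearMap ∘ₗ LinearMap.mul' K (GrSym 𝒱) ∘ₗ
      TensorProduct.map (ι 𝒱 ∘ₗ G) LinearMap.id = 0 := by
    apply TensorProduct.ext'
    intro y z
    simp [counit_ι_mul]
  exact LinearMap.congr_fun h (comul 𝒱 x)

theorem hat_mem_deg {G : GrSym 𝒱 →ₗ[K] M} {p : ℤ} (hG : HasDeg G p) {n : ℤ} {x : GrSym 𝒱}
    (hx : x ∈ deg 𝒱 n) : hat G x ∈ deg 𝒱 (n + p) := by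
  suffices H : deg 𝒱 n ≤ (deg 𝒱 (n + p)).comap (hat G) from H hx
  apply Submodule.span_le.2
  clear hx
  rintro _ ⟨l, rfl, rfl⟩
  rw [SetLike.mem_coe, Submodule.mem_comap]
  induction l generalizing G p with
  | nil =>
    simp only [List.map_nil, List.prod_nil, List.sum_nil, hat_one]
    exact ι_mem_deg' (hG 0 1 SetLike.GradedOne.one_mem)
  | cons a l ih =>
    simp only [List.map_cons, List.prod_cons, List.sum_cons]
    rw [hat_ι_mul hG a.2.2]
    have h1 := ih (hG.comp_mulι a.2.2)
    have h2 := mulι_mem_deg a.2.2 (ih hG)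
    apply add_mem
    · convert h1 using 2; ring
    · apply Submodule.smul_mem
      convert h2 using 2; ring

/-- A term `G(x') ⊙ x''` has a component in `V` only when `x''` is a scalar, which leaves `G x`
itself. Thus a coderivation is determined by its corestriction. -/
theorem toV_hat {G : GrSym 𝒱 →ₗ[K] M} {p : ℤ} (hG : HasDeg G p) (x : GrSym 𝒱) :
    toV 𝒱 (hat G x) = G x := by
  induction x using word_induction generalizing G p with
  | zero => simp
  | add x y hx hy => rw [map_add, map_add, map_add, hx hG, hy hG]
  | smul c x hx => rw [map_smul, map_smul, map_smul, hx hG]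
  | one => rw [hat_one, toV_ι]
  | mul i v hv y hy =>
    rw [hat_ι_mul hG hv, map_add, hy (hG.comp_mulι hv), map_smul, toV_ι_mul, counit_hat]
    simp

/-- The graded commutator of two coderivations is a coderivation. -/
theorem hat_commutator {F G : GrSym 𝒱 →ₗ[K] M} {p q : ℤ} (hF : HasDeg F p) (hG : HasDeg G q)
    (x : GrSym 𝒱) :
    hat F (hat G x) - ((-1 : K) ^ (p * q)) • hat G (hat F x) =
      hat (F ∘ₗ hat G - ((-1 : K) ^ (p * q)) • (G ∘ₗ hat F)) x := by
  induction x using word_induction generalizing F G p q with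
  | zero => simp
  | add x y hx hy =>
    simp only [map_add, smul_add, ← hx hF hG, ← hy hF hG]
    abel
  | smul c x hx =>
    simp only [map_smul, ← hx hF hG, smul_sub]
    rw [smul_comm]
  | one =>
    have h1 : F 1 ∈ 𝒱 p := by simpa using hF 0 1 SetLike.GradedOne.one_mem
    have h2 : G 1 ∈ 𝒱 q := by simpa using hG 0 1 SetLike.GradedOne.one_mem
    have e1 := hat_ι_mul hF h2 1
    have e2 := hat_ι_mul hG h1 1
    rw [mul_one] at e1 e2
    simp only [hat_one, e1, e2, LinearMap.sub_apply, LinearMap.comp_apply, LinearMap.smul_apply,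
      mulι_apply, mul_one, map_sub, map_smul]
    rw [ι_comm 𝒱 h1 h2, mul_comm q p]
    simp only [smul_add, smul_smul, neg_one_zpow_mul_self]
    module
  | mul i v hv y hy =>
    have hFG : HasDeg (F ∘ₗ hat G - ((-1 : K) ^ (p * q)) • (G ∘ₗ hat F)) (p + q) := by
      intro j x hx
      refine sub_mem ?_ (Submodule.smul_mem _ _ ?_)
      · have := hF _ _ (hat_mem_deg hG hx)
        rwa [show j + q + p = j + (p + q) by ring] at this
      · have := hG _ _ (hat_mem_deg hF hx)
        rwa [show j + p + q = j + (p + q) by ring] at this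
    have i1 := hy hF (hG.comp_mulι hv)
    have i2 := hy (hF.comp_mulι hv) hG
    have i3 := hy hF hG
    -- Derivation rule: with `G_v = G ∘ₗ mulι 𝒱 v`, one has `[F, G]_v = [F, G_v] ± [F_v, G]`. The
    -- induction hypotheses for these two brackets are `i1` and `i2`; `i3` serves the term in which
    -- `v` stays outside.
    have hsplit : (F ∘ₗ hat G - ((-1 : K) ^ (p * q)) • (G ∘ₗ hat F)) ∘ₗ mulι 𝒱 v =
        (F ∘ₗ hat (G ∘ₗ mulι 𝒱 v) -
          ((-1 : K) ^ (p * (q + i))) • ((G ∘ₗ mulι 𝒱 v) ∘ₗ hat F)) +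
        ((-1 : K) ^ (q * i)) • ((F ∘ₗ mulι 𝒱 v) ∘ₗ hat G -
          ((-1 : K) ^ ((p + i) * q)) • (G ∘ₗ hat (F ∘ₗ mulι 𝒱 v))) := by
      ext z
      simp only [LinearMap.sub_apply, LinearMap.comp_apply, LinearMap.smul_apply,
        LinearMap.add_apply, mulι_apply, hat_ι_mul hF hv, hat_ι_mul hG hv, map_add, map_smul]
      rw [mul_add, add_mul, neg_one_zpow_add, neg_one_zpow_add, mul_comm i q]
      have := neg_one_zpow_mul_self (K := K) (q * i)
      linear_combination (norm := module)
        ((-1 : K) ^ (p * q)) • this • G (hat (F ∘ₗ mulι 𝒱 v) z)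
    rw [hat_ι_mul hFG hv, hsplit, hat_add, LinearMap.add_apply, hat_smul, LinearMap.smul_apply,
      ← i1, ← i2, ← i3]
    simp only [hat_ι_mul hF hv, hat_ι_mul hG hv, map_add, map_smul]
    rw [mul_add, add_mul, add_mul, neg_one_zpow_add, neg_one_zpow_add, neg_one_zpow_add,
      mul_comm i q]
    simp only [mul_sub, smul_sub, mul_smul_comm]
    have := neg_one_zpow_mul_self (K := K) (q * i)
    linear_combination (norm := module)
      ((-1 : K) ^ (p * q)) • this • hat G (hat (F ∘ₗ mulι 𝒱 v) y)

/-- `Δ ∘ Ĝ = (Ĝ ⊗ 1 + 1 ⊗ Ĝ) ∘ Δ`, with Koszul signs. -/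
theorem comul_hat {G : GrSym 𝒱 →ₗ[K] M} {p : ℤ} (hG : HasDeg G p) (x : GrSym 𝒱) :
    comul 𝒱 (hat G x) = TensorProduct.map (hat G) LinearMap.id (comul 𝒱 x) +
      TensorProduct.map (sgn 𝒱 p) (hat G) (comul 𝒱 x) := by
  induction x using word_induction generalizing G p with
  | zero => simp
  | add x y hx hy =>
    simp only [map_add, hx hG, hy hG]
    abel
  | smul c x hx => simp only [map_smul, hx hG, smul_add]
  | one =>
    have h1 : G 1 ∈ 𝒱 p := by simpa using hG 0 1 SetLike.GradedOne.one_mem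
    have e1 := comul_ι_mul h1 1
    rw [mul_one] at e1
    rw [hat_one, e1, comul_one]
    simp only [TensorProduct.map_tmul, mulι_apply, hat_one, mul_one, LinearMap.id_apply]
  | mul i v hv y hy =>
    have hm : hat G ∘ₗ mulι 𝒱 v =
        hat (G ∘ₗ mulι 𝒱 v) + ((-1 : K) ^ (p * i)) • (mulι 𝒱 v ∘ₗ hat G) :=
      LinearMap.ext fun z => hat_ι_mul hG hv z
    have hs : hat G ∘ₗ sgn 𝒱 i = ((-1 : K) ^ (p * i)) • (sgn 𝒱 i ∘ₗ hat G) := by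
      rw [sgn_comp_of_mem_deg i p fun j x hx => hat_mem_deg hG hx, smul_smul, mul_comm i p,
        neg_one_zpow_mul_self, one_smul]
    -- The identity holds for every tensor `z`, not only for `comul 𝒱 y`: it compares the ways in
    -- which multiplication by `v` and the coderivation act on the two factors.
    have hz : ∀ z : GrSym 𝒱 ⊗[K] GrSym 𝒱,
        TensorProduct.map (hat (G ∘ₗ mulι 𝒱 v)) LinearMap.id z +
          TensorProduct.map (sgn 𝒱 (p + i)) (hat (G ∘ₗ mulι 𝒱 v)) z +
        ((-1 : K) ^ (p * i)) • (
          TensorProduct.map (mulι 𝒱 v) LinearMap.id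
            (TensorProduct.map (hat G) LinearMap.id z + TensorProduct.map (sgn 𝒱 p) (hat G) z) +
          TensorProduct.map (sgn 𝒱 i) (mulι 𝒱 v)
            (TensorProduct.map (hat G) LinearMap.id z + TensorProduct.map (sgn 𝒱 p) (hat G) z)) =
        TensorProduct.map (hat G) LinearMap.id (TensorProduct.map (mulι 𝒱 v) LinearMap.id z +
          TensorProduct.map (sgn 𝒱 i) (mulι 𝒱 v) z) +
        TensorProduct.map (sgn 𝒱 p) (hat G) (TensorProduct.map (mulι 𝒱 v) LinearMap.id z +
          TensorProduct.map (sgn 𝒱 i) (mulι 𝒱 v) z) := by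
      intro z
      simp only [map_add, ← LinearMap.comp_apply, ← TensorProduct.map_comp, hm, hs, ← sgn_add,
        sgn_comp_mulι p hv, LinearMap.id_comp, LinearMap.comp_id, TensorProduct.map_add_left,
        TensorProduct.map_add_right, TensorProduct.map_smul_left, TensorProduct.map_smul_right,
        LinearMap.add_apply, LinearMap.smul_apply, smul_add]
      rw [add_comm i p]
      abel
    rw [hat_ι_mul hG hv, map_add, map_smul, hy (hG.comp_mulι hv), comul_ι_mul hv, comul_ι_mul hv,
      hy hG]
    exact hz _

end Hat

/-! ### Word length and local nilpotency -/

section Length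

variable (𝒱) in
/-- The span of the products of `n` homogeneous elements of `V`. -/
def len (n : ℤ) : Submodule K (GrSym 𝒱) :=
  Submodule.span K {x | ∃ l : List (Σ i : ℤ, 𝒱 i),
    (l.length : ℤ) = n ∧ (l.map fun a => ι 𝒱 (a.2 : M)).prod = x}

/-- Lengths are integers so that `n + 1 - m` in `hat_mem_len` needs no truncated subtraction;
negative lengths then have to be harmless. -/
theorem len_of_neg {n : ℤ} (hn : n < 0) : len 𝒱 n = ⊥ := by
  rw [len, Submodule.span_eq_bot]
  rintro x ⟨l, hl, -⟩
  omega

theorem mulι_mem_len {i n : ℤ} {v : M} (hv : v ∈ 𝒱 i) {x : GrSym 𝒱} (hx : x ∈ len 𝒱 n) :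
    ι 𝒱 v * x ∈ len 𝒱 (1 + n) := by
  suffices H : len 𝒱 n ≤ (len 𝒱 (1 + n)).comap (mulι 𝒱 v) from H hx
  apply Submodule.span_le.2
  rintro _ ⟨l, rfl, rfl⟩
  exact Submodule.subset_span ⟨⟨i, v, hv⟩ :: l, by simp [add_comm], by simp⟩

theorem one_mem_len : (1 : GrSym 𝒱) ∈ len 𝒱 0 :=
  Submodule.subset_span ⟨[], by simp, by simp⟩

theorem ι_mem_len {i : ℤ} {v : M} (hv : v ∈ 𝒱 i) : ι 𝒱 v ∈ len 𝒱 1 := by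
  simpa using mulι_mem_len hv one_mem_len

/-- `G : S(V) → V` vanishes on products of `n ≠ m` elements. -/
def HasArity (G : GrSym 𝒱 →ₗ[K] M) (m : ℤ) : Prop :=
  ∀ n, n ≠ m → ∀ x ∈ len 𝒱 n, G x = 0

theorem HasArity.comp_mulι {G : GrSym 𝒱 →ₗ[K] M} {m : ℤ} (hG : HasArity G m) {i : ℤ} {v : M}
    (hv : v ∈ 𝒱 i) : HasArity (G ∘ₗ mulι 𝒱 v) (m - 1) := fun n hn _ hx =>
  hG (1 + n) (by omega) _ (mulι_mem_len hv hx)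

/-- The coderivation consumes `m` letters and returns one. -/
theorem hat_mem_len [DirectSum.Decomposition 𝒱] {G : GrSym 𝒱 →ₗ[K] M} {p m : ℤ}
    (hG : HasDeg G p) (hm : HasArity G m) {n : ℤ} {x : GrSym 𝒱} (hx : x ∈ len 𝒱 n) :
    hat G x ∈ len 𝒱 (n + 1 - m) := by
  suffices H : len 𝒱 n ≤ (len 𝒱 (n + 1 - m)).comap (hat G) from H hx
  apply Submodule.span_le.2
  clear hx
  rintro _ ⟨l, rfl, rfl⟩
  rw [SetLike.mem_coe, Submodule.mem_comap]
  induction l generalizing G p m with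
  | nil =>
    simp only [List.map_nil, List.prod_nil, List.length_nil, hat_one]
    by_cases h : m = 0
    · subst h
      exact ι_mem_len (hG 0 1 SetLike.GradedOne.one_mem)
    · rw [hm 0 (Ne.symm h) 1 one_mem_len, map_zero]
      exact zero_mem _
  | cons a l ih =>
    simp only [List.map_cons, List.prod_cons, List.length_cons]
    rw [hat_ι_mul hG a.2.2]
    have h1 := ih (hG.comp_mulι a.2.2) (hm.comp_mulι a.2.2)
    have h2 := mulι_mem_len a.2.2 (ih hG hm)
    apply add_mem
    · convert h1 using 2; push_cast; ring
    · apply Submodule.smul_mem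
      convert h2 using 2; push_cast; ring

/-- Coderivations of arity at least two are locally nilpotent. -/
theorem exists_hat_pow_apply_eq_zero [DirectSum.Decomposition 𝒱] {G : GrSym 𝒱 →ₗ[K] M} {p m : ℤ}
    (hG : HasDeg G p) (hm : HasArity G m) (h2 : 2 ≤ m) (x : GrSym 𝒱) :
    ∃ n : ℕ, (hat G ^ n) x = 0 := by
  have mono : ∀ {a b : ℕ} {x : GrSym 𝒱}, a ≤ b → (hat G ^ a) x = 0 → (hat G ^ b) x = 0 := by
    intro a b x hab h
    rw [← Nat.sub_add_cancel hab, pow_add, Module.End.mul_apply, h, map_zero]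
  -- Since `m` is at least two, each application lowers the length by at least one, and after `n`
  -- applications the length would be negative.
  have key : ∀ (n : ℕ) (N : ℤ) (x : GrSym 𝒱), x ∈ len 𝒱 N → N < n → (hat G ^ n) x = 0 := by
    intro n
    induction n with
    | zero =>
      intro N x hx hN
      rw [len_of_neg (by simpa using hN)] at hx
      rw [(Submodule.mem_bot K).1 hx, map_zero]
    | succ n ih =>
      intro N x hx hN
      rw [pow_succ, Module.End.mul_apply]
      exact ih _ _ (hat_mem_len hG hm hx) (by push_cast at hN; omega)
  induction x using DirectSum.Decomposition.inductionOn (deg 𝒱) with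
  | zero => exact ⟨0, map_zero _⟩
  | add x y hx hy =>
    obtain ⟨a, ha⟩ := hx
    obtain ⟨b, hb⟩ := hy
    exact ⟨max a b, by
      rw [map_add, mono (le_max_left a b) ha, mono (le_max_right a b) hb, add_zero]⟩
  | @homogeneous i x =>
    obtain ⟨x, hx⟩ := x
    induction hx using Submodule.span_induction with
    | mem x hx =>
      obtain ⟨l, -, rfl⟩ := hx
      exact ⟨l.length + 1, key _ l.length _ (Submodule.subset_span ⟨l, rfl, rfl⟩) (by simp)⟩
    | zero => exact ⟨0, map_zero _⟩
    | add x y _ _ hx hy =>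
      obtain ⟨a, ha⟩ := hx
      obtain ⟨b, hb⟩ := hy
      exact ⟨max a b, by
        change (hat G ^ max a b) (x + y) = 0
        rw [map_add, mono (le_max_left a b) ha, mono (le_max_right a b) hb, add_zero]⟩
    | smul c x _ hx =>
      obtain ⟨a, ha⟩ := hx
      exact ⟨a, by
        change (hat G ^ a) (c • x) = 0
        rw [map_smul, ha, smul_zero]⟩

theorem linearMap_ext_len {N : Type w} [AddCommGroup N] [Module K N] [DirectSum.Decomposition 𝒱]
    {f g : GrSym 𝒱 →ₗ[K] N} (h : ∀ n, ∀ x ∈ len 𝒱 n, f x = g x) : f = g := by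
  apply linearMap_ext
  intro i x hx
  have H : deg 𝒱 i ≤ LinearMap.eqLocus f g := by
    apply Submodule.span_le.2
    rintro _ ⟨l, -, rfl⟩
    exact h l.length _ (Submodule.subset_span ⟨l, rfl, rfl⟩)
  exact H hx

end Length

end GrSym

/-! ### Exponentials of locally nilpotent operators -/

section Exponential

variable {K : Type u} [Field K] {X : Type v} [AddCommGroup X] [Module K X]
  {Y : Type w} [AddCommGroup Y] [Module K Y]

/-- Local nilpotency of an endomorphism. -/
def LocallyNilpotent (f : Module.End K X) : Prop := ∀ x, ∃ n : ℕ, (f ^ n) x = 0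

theorem pow_apply_eq_zero_of_le {f : Module.End K X} {x : X} {m n : ℕ} (h : m ≤ n)
    (hm : (f ^ m) x = 0) : (f ^ n) x = 0 := by
  rw [← Nat.sub_add_cancel h, pow_add, Module.End.mul_apply, hm, map_zero]

theorem expLN_apply {f : Module.End K X} (hf : ∀ x, ∃ n : ℕ, (f ^ n) x = 0) {x : X} {N : ℕ}
    (hN : (f ^ N) x = 0) :
    expLN f hf x = ∑ n ∈ Finset.range N, ((n.factorial : K)⁻¹) • (f ^ n) x := by
  change ∑ᶠ n : ℕ, ((n.factorial : K)⁻¹) • (f ^ n) x = _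
  apply finsum_eq_sum_of_support_subset
  intro n hn
  by_contra hlt
  apply hn
  simp only [Finset.coe_range, Set.mem_Iio, not_lt] at hlt
  simp [pow_apply_eq_zero_of_le hlt hN]

theorem expLN_mem {f : Module.End K X} (hf : ∀ x, ∃ n : ℕ, (f ^ n) x = 0) {S : Submodule K X}
    {x : X} (h : ∀ n, (f ^ n) x ∈ S) : expLN f hf x ∈ S := by
  obtain ⟨N, hN⟩ := hf x
  rw [expLN_apply hf hN]
  exact Submodule.sum_mem _ fun n _ => Submodule.smul_mem _ _ (h n)

theorem map_pow_apply {f : Module.End K X} {g : Module.End K Y} (φ : X →ₗ[K] Y)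
    (h : ∀ x, φ (f x) = g (φ x)) (n : ℕ) (x : X) : φ ((f ^ n) x) = (g ^ n) (φ x) := by
  induction n generalizing x with
  | zero => rfl
  | succ n ih => rw [pow_succ, pow_succ, Module.End.mul_apply, Module.End.mul_apply, ih, h]

/-- An intertwiner of `f` and `g` carries the exponential series term by term. It is applied to the
coproduct and to the maps that fix one tensor factor. -/
theorem map_expLN {f : Module.End K X} {g : Module.End K Y} (hf : LocallyNilpotent f)
    (hg : LocallyNilpotent g) (φ : X →ₗ[K] Y) (h : ∀ x, φ (f x) = g (φ x)) (x : X) :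
    φ (expLN f hf x) = expLN g hg (φ x) := by
  obtain ⟨N, hN⟩ := hf x
  have hN' : (g ^ N) (φ x) = 0 := by rw [← map_pow_apply φ h, hN, map_zero]
  rw [expLN_apply hf hN, expLN_apply hg hN', map_sum]
  simp only [map_smul, map_pow_apply φ h]

theorem expLN_zero (h : LocallyNilpotent (0 : Module.End K X)) (x : X) : expLN 0 h x = x := by
  rw [expLN_apply h (N := 1) (by simp)]
  simp

theorem LocallyNilpotent.rTensor {f : Module.End K X} (hf : LocallyNilpotent f) :
    LocallyNilpotent (TensorProduct.map f (LinearMap.id : Y →ₗ[K] Y)) := by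
  intro z
  induction z using TensorProduct.induction_on with
  | zero => exact ⟨0, map_zero _⟩
  | tmul x y =>
    obtain ⟨n, hn⟩ := hf x
    refine ⟨n, ?_⟩
    have := map_pow_apply (g := TensorProduct.map f (LinearMap.id : Y →ₗ[K] Y))
      ((TensorProduct.mk K X Y).flip y) (fun x => rfl) n x
    simp only [hn, map_zero] at this
    exact this.symm
  | add z z' hz hz' =>
    obtain ⟨a, ha⟩ := hz
    obtain ⟨b, hb⟩ := hz'
    exact ⟨max a b, by rw [map_add, pow_apply_eq_zero_of_le (le_max_left a b) ha,
      pow_apply_eq_zero_of_le (le_max_right a b) hb, add_zero]⟩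

theorem LocallyNilpotent.lTensor {f : Module.End K X} (hf : LocallyNilpotent f) :
    LocallyNilpotent (TensorProduct.map (LinearMap.id : Y →ₗ[K] Y) f) := by
  intro z
  induction z using TensorProduct.induction_on with
  | zero => exact ⟨0, map_zero _⟩
  | tmul y x =>
    obtain ⟨n, hn⟩ := hf x
    refine ⟨n, ?_⟩
    have := map_pow_apply (g := TensorProduct.map (LinearMap.id : Y →ₗ[K] Y) f)
      (TensorProduct.mk K Y X y) (fun x => rfl) n x
    simp only [hn, map_zero] at this
    exact this.symm
  | add z z' hz hz' =>
    obtain ⟨a, ha⟩ := hz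
    obtain ⟨b, hb⟩ := hz'
    exact ⟨max a b, by rw [map_add, pow_apply_eq_zero_of_le (le_max_left a b) ha,
      pow_apply_eq_zero_of_le (le_max_right a b) hb, add_zero]⟩

variable [CharZero K]

/-- The binomial theorem divided by `k!`, which is where characteristic zero enters. -/
theorem inv_factorial_smul_add_pow {f g : Module.End K X} (hc : Commute f g) (k : ℕ) (x : X) :
    ((k.factorial : K)⁻¹) • ((f + g) ^ k) x = ∑ p ∈ Finset.HasAntidiagonal.antidiagonal k,
      ((p.1.factorial : K)⁻¹ * (p.2.factorial : K)⁻¹) • (f ^ p.1) ((g ^ p.2) x) := by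
  rw [hc.add_pow', LinearMap.sum_apply, Finset.smul_sum]
  apply Finset.sum_congr rfl
  rintro ⟨i, j⟩ hp
  obtain rfl : i + j = k := by simpa using hp
  rw [LinearMap.smul_apply, Module.End.mul_apply, ← Nat.cast_smul_eq_nsmul K, smul_smul]
  congr 1
  have h := Nat.add_choose_mul_factorial_mul_factorial j i
  rw [add_comm j i, mul_right_comm] at h
  have h1 : (i.factorial : K) ≠ 0 := Nat.cast_ne_zero.2 i.factorial_ne_zero
  have h2 : (j.factorial : K) ≠ 0 := Nat.cast_ne_zero.2 j.factorial_ne_zero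
  have h3 : ((i + j).factorial : K) ≠ 0 := Nat.cast_ne_zero.2 (i + j).factorial_ne_zero
  have h' : ((i + j).choose i : K) * i.factorial * j.factorial = (i + j).factorial := by
    exact_mod_cast h
  field_simp
  rw [← h']

theorem LocallyNilpotent.add {f g : Module.End K X} (hf : LocallyNilpotent f)
    (hg : LocallyNilpotent g) (hc : Commute f g) : LocallyNilpotent (f + g) := by
  intro x
  obtain ⟨a, ha⟩ := hf x
  obtain ⟨b, hb⟩ := hg x
  refine ⟨a + b, ?_⟩
  have h := inv_factorial_smul_add_pow hc (a + b) x
  rw [Finset.sum_eq_zero] at h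
  · exact (smul_eq_zero.1 h).resolve_left
      (inv_ne_zero (Nat.cast_ne_zero.2 (a + b).factorial_ne_zero))
  · rintro ⟨i, j⟩ hp
    have hp : i + j = a + b := by simpa using hp
    rcases le_or_gt a i with hi | hi
    · rw [← Module.End.mul_apply, (hc.pow_pow i j).eq, Module.End.mul_apply,
        pow_apply_eq_zero_of_le hi ha, map_zero, smul_zero]
    · rw [pow_apply_eq_zero_of_le (by omega) hb, map_zero, smul_zero]

theorem expLN_add {f g : Module.End K X} (hf : LocallyNilpotent f) (hg : LocallyNilpotent g)
    (hfg : LocallyNilpotent (f + g)) (hc : Commute f g) (x : X) :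
    expLN (f + g) hfg x = expLN f hf (expLN g hg x) := by
  obtain ⟨a, ha⟩ := hf x
  obtain ⟨b, hb⟩ := hg x
  obtain ⟨c, hfgc⟩ := hfg x
  -- By commutation, either exponent being large is enough, so the double series is supported in the
  -- rectangle `i < a`, `j < b`.
  have hz : ∀ i j, a ≤ i ∨ b ≤ j → (f ^ i) ((g ^ j) x) = 0 := by
    rintro i j (hi | hj)
    · rw [← Module.End.mul_apply, (hc.pow_pow i j).eq, Module.End.mul_apply,
        pow_apply_eq_zero_of_le hi ha, map_zero]
    · rw [pow_apply_eq_zero_of_le hj hb, map_zero]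
  have hfa : (f ^ a) (expLN g hg x) = 0 := by
    rw [expLN_apply hg hb, map_sum]
    exact Finset.sum_eq_zero fun j _ => by rw [map_smul, hz a j (Or.inl le_rfl), smul_zero]
  rw [expLN_apply hf hfa, expLN_apply hg hb,
    expLN_apply hfg (pow_apply_eq_zero_of_le (le_max_left c (a + b)) hfgc)]
  simp only [inv_factorial_smul_add_pow hc, map_sum, map_smul, Finset.smul_sum, smul_smul]
  -- The sum over the rectangle is regrouped along the antidiagonals `i + j = k`. The cutoff `max c
  -- (a + b)` covers every antidiagonal meeting the rectangle, and the antidiagonal terms outside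
  -- the rectangle vanish by `hz`.
  rw [← Finset.sum_product', ← Finset.sum_fiberwise_of_maps_to
    (t := Finset.range (max c (a + b))) (g := fun p : ℕ × ℕ => p.1 + p.2)]
  · apply Finset.sum_congr rfl
    intro k _
    symm
    apply Finset.sum_subset
    · rintro ⟨i, j⟩ hp
      simpa using (Finset.mem_filter.1 hp).2
    · rintro ⟨i, j⟩ hp hp'
      rw [hz, smul_zero]
      by_contra h
      push Not at h
      apply hp'
      simpa [h.1, h.2] using hp
  · rintro ⟨i, j⟩ hp
    simp only [Finset.mem_product, Finset.mem_range] at hp ⊢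
    omega

/-- The inverse is `e^(-f)`, by `expLN_add` for the commuting operators `f` and `-f`. -/
theorem expLN_bijective {f : Module.End K X} (hf : ∀ x, ∃ n : ℕ, (f ^ n) x = 0) :
    Function.Bijective (expLN f hf) := by
  have hn : LocallyNilpotent (-f) := fun x => (hf x).imp fun n hn => by
    rw [neg_pow, Module.End.mul_apply, hn, map_zero]
  have hz : LocallyNilpotent (0 : Module.End K X) := fun x => ⟨1, by simp⟩
  have h1 : LocallyNilpotent (f + -f) := by rwa [add_neg_cancel]
  have h2 : LocallyNilpotent (-f + f) := by rwa [neg_add_cancel]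
  have e1 : ∀ x, expLN f hf (expLN (-f) hn x) = x := by
    intro x
    rw [← expLN_add hf hn h1 (Commute.refl f).neg_right]
    simp only [add_neg_cancel]
    exact expLN_zero hz x
  have e2 : ∀ x, expLN (-f) hn (expLN f hf x) = x := by
    intro x
    rw [← expLN_add hn hf h2 (Commute.refl f).neg_left]
    simp only [neg_add_cancel]
    exact expLN_zero hz x
  exact Function.bijective_iff_has_inverse.2 ⟨_, e2, e1⟩

/-- The exponential of a locally nilpotent coderivation is a morphism of coalgebras. -/
theorem comul_expLN {f : Module.End K X} (hf : ∀ x, ∃ n : ℕ, (f ^ n) x = 0) (Δ : X →ₗ[K] X ⊗[K] X)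
    (hΔ : ∀ x, Δ (f x) = TensorProduct.map f LinearMap.id (Δ x) +
      TensorProduct.map LinearMap.id f (Δ x)) (x : X) :
    Δ (expLN f hf x) = TensorProduct.map (expLN f hf) (expLN f hf) (Δ x) := by
  have hc : Commute (TensorProduct.map f (LinearMap.id : X →ₗ[K] X))
      (TensorProduct.map (LinearMap.id : X →ₗ[K] X) f) := by
    change _ ∘ₗ _ = _ ∘ₗ _
    rw [← TensorProduct.map_comp, ← TensorProduct.map_comp]
    rfl
  have hr := LocallyNilpotent.rTensor (Y := X) hf
  have hl := LocallyNilpotent.lTensor (Y := X) hf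
  -- This uses `e^(f ⊗ 1 + 1 ⊗ f) = e^(f ⊗ 1) e^(1 ⊗ f)`; each factor is then computed on pure
  -- tensors.
  rw [map_expLN hf (hr.add hl hc) Δ hΔ, expLN_add hr hl _ hc]
  generalize Δ x = z
  induction z using TensorProduct.induction_on with
  | zero => simp
  | tmul y z =>
    have h1 := map_expLN hf hl (TensorProduct.mk K X X y) (fun x => rfl) z
    have h2 := map_expLN hf hr ((TensorProduct.mk K X X).flip (expLN f hf z)) (fun x => rfl) y
    simp only [TensorProduct.mk_apply, LinearMap.flip_apply] at h1 h2
    rw [← h1, ← h2, TensorProduct.map_tmul]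
  | add z z' hz hz' => rw [map_add, map_add, map_add, hz, hz']

/-- If `[f, δ] = q` and `[f, q] = 0` then `e^f δ = (δ + q) e^f`. -/
theorem expLN_conj {f δ q : Module.End K X} (hf : ∀ x, ∃ n : ℕ, (f ^ n) x = 0)
    (h1 : ∀ x, f (δ x) - δ (f x) = q x) (h2 : ∀ x, f (q x) = q (f x)) (x : X) :
    expLN f hf (δ x) = δ (expLN f hf x) + q (expLN f hf x) := by
  -- Moving `δ` to the left across `f ^ (n + 1)` produces one `q` per crossing, and all of these
  -- agree because `q` commutes with `f`.
  have key : ∀ (n : ℕ) (x : X),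
      (f ^ (n + 1)) (δ x) = δ ((f ^ (n + 1)) x) + ((n + 1 : ℕ) : K) • q ((f ^ n) x) := by
    intro n
    induction n with
    | zero => intro x; simp [← h1]
    | succ n ih =>
      intro x
      have e1 : f (δ x) = δ (f x) + q x := by rw [← h1]; abel
      have e2 : (f ^ (n + 1)) (q x) = q ((f ^ (n + 1)) x) :=
        (map_pow_apply q (fun x => (h2 x).symm) (n + 1) x).symm
      rw [pow_succ f (n + 1), Module.End.mul_apply, e1, map_add, ih, e2, Module.End.mul_apply,
        ← Module.End.mul_apply (f ^ n), ← pow_succ]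
      push_cast
      module
  obtain ⟨N, hN⟩ := hf x
  have hN1 : (f ^ (N + 1)) x = 0 := pow_apply_eq_zero_of_le N.le_succ hN
  have hN2 : (f ^ (N + 1)) (δ x) = 0 := by rw [key, hN1, hN]; simp
  rw [expLN_apply hf hN2, Finset.sum_range_succ']
  -- The series under `δ` is cut at `N + 1` and the one under `q` at `N`: the term `n + 1` on the
  -- left contributes the term `n` of the series under `q`.
  conv_rhs => rw [expLN_apply hf hN1]
  conv_rhs => enter [2]; rw [← expLN_apply hf hN1, expLN_apply hf hN]
  rw [Finset.sum_range_succ']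
  simp only [key, map_add, map_sum, map_smul, smul_add, Finset.sum_add_distrib]
  have hk : ∀ n : ℕ, (((n + 1).factorial : K)⁻¹) * ((n + 1 : ℕ) : K) = (n.factorial : K)⁻¹ := by
    intro n
    have h1 : (n.factorial : K) ≠ 0 := Nat.cast_ne_zero.2 n.factorial_ne_zero
    have h2 : ((n + 1 : ℕ) : K) ≠ 0 := Nat.cast_ne_zero.2 n.succ_ne_zero
    rw [Nat.factorial_succ, Nat.cast_mul]
    field_simp
  simp only [smul_smul, hk, pow_zero, Module.End.one_apply]
  abel

end Exponential

/-! ### Gradings on coefficients times homogeneous symbols -/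

section FinsuppGrading

variable {K : Type u} [Field K] {A : Type v} [AddCommGroup A] [Module K A] {J : Type}

/-- The grading of `A ⊗ ⟨J⟩`, where `J` is a set of homogeneous symbols of degrees `wt`. -/
def finsuppGr (ℒ : ℤ → Submodule K A) (wt : J → ℤ) (i : ℤ) : Submodule K (J →₀ A) where
  carrier := {p | ∀ x, p x ∈ ℒ (i - wt x)}
  zero_mem' := fun _ => zero_mem _
  add_mem' := fun ha hb x => add_mem (ha x) (hb x)
  smul_mem' := fun c _ ha x => Submodule.smul_mem _ c (ha x)

variable {ℒ : ℤ → Submodule K A} {wt : J → ℤ}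

theorem single_mem_finsuppGr {i j : ℤ} {x : J} {a : A} (ha : a ∈ ℒ i) (h : j = i + wt x) :
    Finsupp.single x a ∈ finsuppGr ℒ wt j := by
  classical
  intro y
  rw [Finsupp.single_apply]
  split_ifs with hxy
  · subst hxy h
    simpa using ha
  · exact zero_mem _

@[elab_as_elim]
theorem finsuppGr_induction {i : ℤ} {P : (p : J →₀ A) → p ∈ finsuppGr ℒ wt i → Prop}
    (zero : P 0 (zero_mem _))
    (add : ∀ p q hp hq, P p hp → P q hq → P (p + q) (add_mem hp hq))
    (single : ∀ x a, (ha : a ∈ ℒ (i - wt x)) →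
      P (Finsupp.single x a) (single_mem_finsuppGr ha (sub_add_cancel _ _).symm)) {p : J →₀ A}
    (hp : p ∈ finsuppGr ℒ wt i) : P p hp := by
  have key : ∃ h, P (p.sum Finsupp.single) h :=
    Finset.sum_induction _ (fun p => ∃ h, P p h)
      (fun _ _ ⟨h, ha⟩ ⟨h', hb⟩ => ⟨add_mem h h', add _ _ h h' ha hb⟩) ⟨zero_mem _, zero⟩
      fun x _ => ⟨_, single x _ (hp x)⟩
  simp only [Finsupp.sum_single] at key
  exact key.2

variable [DirectSum.Decomposition ℒ]

theorem finsuppGr_isInternal (ℒ : ℤ → Submodule K A) [DirectSum.Decomposition ℒ] (wt : J → ℤ) :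
    DirectSum.IsInternal (finsuppGr ℒ wt) := by
  -- The projection to degree `i`: the coefficient of the symbol `x` is replaced by its component of
  -- degree `i - wt x`.
  let c : ℤ → (J →₀ A) →ₗ[K] (J →₀ A) := fun i => Finsupp.lsum K fun x =>
    Finsupp.lsingle x ∘ₗ (ℒ (i - wt x)).subtype ∘ₗ
      DirectSum.component K ℤ (fun i => ℒ i) (i - wt x) ∘ₗ
      (DirectSum.decomposeLinearEquiv ℒ).toLinearMap
  have hc : ∀ i x a, c i (Finsupp.single x a) =
      Finsupp.single x (DirectSum.decompose ℒ a (i - wt x) : A) := by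
    intro i x a
    simp only [c, Finsupp.lsum_single]
    rfl
  have hc1 : ∀ i, ∀ p ∈ finsuppGr ℒ wt i, c i p = p := by
    intro i p hp
    induction hp using finsuppGr_induction with
    | zero => simp
    | add p q _ _ hp hq => rw [map_add, hp, hq]
    | single x a ha => rw [hc, DirectSum.decompose_of_mem_same ℒ ha]
  have hc2 : ∀ i j, i ≠ j → ∀ p ∈ finsuppGr ℒ wt i, c j p = 0 := by
    intro i j hij p hp
    induction hp using finsuppGr_induction with
    | zero => simp
    | add p q _ _ hp hq => rw [map_add, hp, hq, add_zero]
    | single x a ha =>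
      rw [hc, DirectSum.decompose_of_mem_ne ℒ ha (by omega), Finsupp.single_zero]
  constructor
  · rw [injective_iff_map_eq_zero]
    intro x hx
    have key : ∀ (y : ⨁ i, finsuppGr ℒ wt i) (i : ℤ),
        c i (DirectSum.coeAddMonoidHom (finsuppGr ℒ wt) y) = y i := by
      intro y i
      induction y using DirectSum.induction_on with
      | zero => simp
      | of j y =>
        rw [DirectSum.coeAddMonoidHom_of]
        by_cases h : j = i
        · subst h
          rw [hc1 _ _ y.2, DirectSum.of_eq_same]
        · rw [hc2 _ _ h _ y.2, DirectSum.of_eq_of_ne _ _ _ (Ne.symm h)]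
          rfl
      | add y z hy hz => simp only [map_add, hy, hz, DirectSum.add_apply, Submodule.coe_add]
    apply DFinsupp.ext
    intro i
    apply Subtype.ext
    rw [← key x i, hx, map_zero]
    rfl
  · intro p
    induction p using Finsupp.induction_linear with
    | zero => exact ⟨0, map_zero _⟩
    | add p q hp hq =>
      obtain ⟨y, rfl⟩ := hp
      obtain ⟨z, rfl⟩ := hq
      exact ⟨y + z, map_add _ _ _⟩
    | single x a =>
      induction a using DirectSum.Decomposition.inductionOn ℒ with
      | zero => exact ⟨0, by simp⟩
      | add a b ha hb =>
        obtain ⟨y, hy⟩ := ha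
        obtain ⟨z, hz⟩ := hb
        exact ⟨y + z, by rw [map_add, hy, hz, Finsupp.single_add]⟩
      | @homogeneous i a =>
        exact ⟨DirectSum.of (fun i => finsuppGr ℒ wt i) (i + wt x)
          ⟨Finsupp.single x a, single_mem_finsuppGr a.2 rfl⟩, DirectSum.coeAddMonoidHom_of _ _ _⟩

instance finsuppGrDecomposition : DirectSum.Decomposition (finsuppGr ℒ wt) :=
  (finsuppGr_isInternal ℒ wt).chooseDecomposition

end FinsuppGrading

/-- A homotopy `ρ` of degree `-1` trivializing the bracket of a DGLA compatibly with the Jacobi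
identity. -/
structure IsTrivialization {K : Type u} [Field K] {A : Type v} [AddCommGroup A] [Module K A]
    (ℒ : ℤ → Submodule K A) (d : A →ₗ[K] A) (br ρ : A →ₗ[K] A →ₗ[K] A) : Prop where
  mem : ∀ i j : ℤ, ∀ a ∈ ℒ i, ∀ b ∈ ℒ j, ρ a b ∈ ℒ (i + j - 1)
  symm : ∀ i j : ℤ, ∀ a ∈ ℒ i, ∀ b ∈ ℒ j, ρ a b = -((-1 : K) ^ (i * j)) • ρ b a
  br_eq : ∀ i : ℤ, ∀ a ∈ ℒ i, ∀ b, br a b = d (ρ a b) + ρ (d a) b + ((-1 : K) ^ i) • ρ a (d b)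
  jacobi : ∀ i j : ℤ, ∀ a ∈ ℒ i, ∀ b ∈ ℒ j, ∀ c,
    ρ a (br b c) + ((-1 : K) ^ i) • br a (ρ b c) = ρ (br a b) c + br (ρ a b) c +
      ((-1 : K) ^ (i * j)) • (ρ b (br a c) + ((-1 : K) ^ j) • br b (ρ a c))

/-! ### The DGLA `A[t, dt]` with bracket `t [a, b] + dt ρ(a, b)` -/

namespace Path

variable {K : Type u} [Field K] {A : Type v} [AddCommGroup A] [Module K A]

/-- The degrees of the symbols `t^m` (left) and `dt t^m` (right). -/
def wt : ℕ ⊕ ℕ → ℤ := Sum.elim (fun _ => 0) (fun _ => 1)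

/-- `a t^m`. -/
abbrev fn (m : ℕ) (a : A) : ℕ ⊕ ℕ →₀ A := Finsupp.single (Sum.inl m) a

/-- `dt a t^m`. -/
abbrev form (m : ℕ) (a : A) : ℕ ⊕ ℕ →₀ A := Finsupp.single (Sum.inr m) a

/-- The differential of `A[t, dt]`. -/
def diff (d : A →ₗ[K] A) : (ℕ ⊕ ℕ →₀ A) →ₗ[K] (ℕ ⊕ ℕ →₀ A) :=
  Finsupp.lsum K (Sum.elim
    (fun m => Finsupp.lsingle (Sum.inl m) ∘ₗ d + (m : K) • Finsupp.lsingle (Sum.inr (m - 1)))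
    (fun m => -(Finsupp.lsingle (Sum.inr m) ∘ₗ d)))

@[simp] theorem diff_fn (d : A →ₗ[K] A) (m : ℕ) (a : A) :
    diff d (fn m a) = fn m (d a) + (m : K) • form (m - 1) a := by
  simp [diff]

@[simp] theorem diff_form (d : A →ₗ[K] A) (m : ℕ) (a : A) :
    diff d (form m a) = -form m (d a) := by
  simp [diff]

section Grading

variable {ℒ : ℤ → Submodule K A}

theorem fn_mem {i : ℤ} (m : ℕ) {a : A} (ha : a ∈ ℒ i) : fn m a ∈ finsuppGr ℒ wt i :=
  single_mem_finsuppGr ha (by simp [wt])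

theorem form_mem {i j : ℤ} (m : ℕ) {a : A} (ha : a ∈ ℒ j) (h : i = j + 1) :
    form m a ∈ finsuppGr ℒ wt i :=
  single_mem_finsuppGr ha h

@[elab_as_elim]
theorem induction_of_mem {i : ℤ} {P : (p : ℕ ⊕ ℕ →₀ A) → p ∈ finsuppGr ℒ wt i → Prop}
    (zero : P 0 (zero_mem _))
    (add : ∀ p q hp hq, P p hp → P q hq → P (p + q) (add_mem hp hq))
    (fn : ∀ m a, (ha : a ∈ ℒ i) → P (fn m a) (fn_mem m ha))
    (form : ∀ m a, (ha : a ∈ ℒ (i - 1)) → P (form m a) (form_mem m ha (sub_add_cancel _ _).symm))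
    {p : ℕ ⊕ ℕ →₀ A} (hp : p ∈ finsuppGr ℒ wt i) : P p hp := by
  induction hp using finsuppGr_induction with
  | zero => exact zero
  | add p q hp hq ihp ihq => exact add p q hp hq ihp ihq
  | single x a ha =>
    rcases x with m | m
    · exact fn m a (by simpa [wt] using ha)
    · exact form m a ha

@[elab_as_elim]
theorem induction {P : (ℕ ⊕ ℕ →₀ A) → Prop} (zero : P 0)
    (add : ∀ p q, P p → P q → P (p + q)) (fn : ∀ m a, P (fn m a))
    (form : ∀ m a, P (form m a)) (p : ℕ ⊕ ℕ →₀ A) : P p := by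
  induction p using Finsupp.induction_linear with
  | zero => exact zero
  | add p q hp hq => exact add p q hp hq
  | single x a =>
    rcases x with m | m
    · exact fn m a
    · exact form m a

end Grading

variable (ℒ : ℤ → Submodule K A) [DirectSum.Decomposition ℒ]

/-- Auxiliary: the bracket on symbols. -/
def brAux (br ρ : A →ₗ[K] A →ₗ[K] A) : ℕ ⊕ ℕ → ℕ ⊕ ℕ → A →ₗ[K] A →ₗ[K] (ℕ ⊕ ℕ →₀ A)
  | Sum.inl m, Sum.inl n => br.compr₂ (Finsupp.lsingle (Sum.inl (m + n + 1))) +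
      ρ.compr₂ (Finsupp.lsingle (Sum.inr (m + n)))
  | Sum.inr m, Sum.inl n => br.compr₂ (Finsupp.lsingle (Sum.inr (m + n + 1)))
  | Sum.inl m, Sum.inr n => (br ∘ₗ signMap ℒ).compr₂ (Finsupp.lsingle (Sum.inr (m + n + 1)))
  | Sum.inr _, Sum.inr _ => 0

/-- The bracket `t [a, b] + dt ρ(a, b)` of `A[t, dt]`, extended `K[t, dt]`-bilinearly. -/
def bracket (br ρ : A →ₗ[K] A →ₗ[K] A) :
    (ℕ ⊕ ℕ →₀ A) →ₗ[K] (ℕ ⊕ ℕ →₀ A) →ₗ[K] (ℕ ⊕ ℕ →₀ A) :=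
  Finsupp.lsum K fun x => LinearMap.flip (Finsupp.lsum K fun y => (brAux ℒ br ρ x y).flip)

section

variable (br ρ : A →ₗ[K] A →ₗ[K] A)

@[simp] theorem bracket_fn_fn (m n : ℕ) (a b : A) : bracket ℒ br ρ (fn m a) (fn n b) =
    fn (m + n + 1) (br a b) + form (m + n) (ρ a b) := by
  simp [bracket, brAux]

@[simp] theorem bracket_form_fn (m n : ℕ) (a b : A) : bracket ℒ br ρ (form m a) (fn n b) =
    form (m + n + 1) (br a b) := by
  simp [bracket, brAux]

@[simp] theorem bracket_fn_form (m n : ℕ) (a b : A) : bracket ℒ br ρ (fn m a) (form n b) =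
    form (m + n + 1) (br (signMap ℒ a) b) := by
  simp [bracket, brAux]

@[simp] theorem bracket_form_form (m n : ℕ) (a b : A) :
    bracket ℒ br ρ (form m a) (form n b) = 0 := by
  simp [bracket, brAux]

end

variable {ℒ}

/-- The exponent `m - 1` is truncated at `m = 0`, where the coefficient coming from the derivative
of `t^m` vanishes. -/
theorem natCast_smul_form (m : ℕ) (a : A) (n : ℕ) :
    (m : K) • form (m - 1 + n + 1) a = (m : K) • form (m + n) a := by
  cases m with
  | zero => simp
  | succ m => rw [show m + 1 - 1 + n + 1 = m + 1 + n by omega]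

theorem natCast_smul_form' (m : ℕ) (a : A) (n : ℕ) :
    (m : K) • form (n + (m - 1) + 1) a = (m : K) • form (n + m) a := by
  rw [add_comm n, natCast_smul_form, add_comm]

variable {d : A →ₗ[K] A} {br ρ : A →ₗ[K] A →ₗ[K] A}

theorem signMap_bracket (h : IsDGLA ℒ d br) {i j : ℤ} {a b : A} (ha : a ∈ ℒ i) (hb : b ∈ ℒ j) :
    signMap ℒ (br a b) = ((-1 : K) ^ i * (-1 : K) ^ j) • br a b := by
  rw [signMap_apply ℒ (h.br_mem i j a ha b hb), neg_one_zpow_add]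

/-- For the Leibniz rule on functions, differentiating `t^(m+n+1)` gives `m + n + 1` copies of `br a
b`, while the derivatives of `t^m` and `t^n` account for `m + n`; `ht.br_eq` supplies the remaining
one. For the Jacobi identity on functions, the part without `dt` is the identity for `br`, and the
`dt` part is `ht.jacobi`. With one form argument only the axioms for `br` remain, and with two every
term vanishes because `dt² = 0`. -/
theorem isDGLA (h : IsDGLA ℒ d br) (ht : IsTrivialization ℒ d br ρ) :
    IsDGLA (finsuppGr ℒ wt) (diff d) (bracket ℒ br ρ) where
  d_mem := by
    intro i p hp
    induction hp using induction_of_mem with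
    | zero => simp
    | add p q _ _ hp hq => rw [map_add]; exact add_mem hp hq
    | fn m a ha =>
      rw [diff_fn]
      exact add_mem (fn_mem m (h.d_mem i a ha)) (Submodule.smul_mem _ _ (form_mem _ ha rfl))
    | form m a ha =>
      rw [diff_form]
      exact neg_mem (form_mem m (h.d_mem _ a ha) (by ring))
  d_d := by
    intro p
    induction p using induction with
    | zero => simp
    | add p q hp hq => rw [map_add, map_add, hp, hq, add_zero]
    | fn m a => simp [h.d_d]
    | form m a => simp [h.d_d]
  br_mem := by
    intro i j p hp q hq
    induction hp using induction_of_mem with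
    | zero => simp
    | add p p' _ _ hp hp' => rw [map_add]; exact add_mem hp hp'
    | fn m a ha =>
      induction hq using induction_of_mem with
      | zero => simp
      | add p p' _ _ hp hp' => rw [map_add]; exact add_mem hp hp'
      | fn n b hb =>
        rw [bracket_fn_fn]
        exact add_mem (fn_mem _ (h.br_mem i j a ha b hb))
          (form_mem _ (ht.mem i j a ha b hb) (by ring))
      | form n b hb =>
        rw [bracket_fn_form, signMap_apply ℒ ha]
        exact form_mem _ (h.br_mem i _ _ (Submodule.smul_mem _ _ ha) b hb) (by ring)
    | form m a ha =>
      induction hq using induction_of_mem with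
      | zero => simp
      | add p p' _ _ hp hp' => rw [map_add]; exact add_mem hp hp'
      | fn n b hb =>
        rw [bracket_form_fn]
        exact form_mem _ (h.br_mem _ j a ha b hb) (by ring)
      | form n b hb => simp
  br_symm := by
    intro i j p hp q hq
    induction hp using induction_of_mem with
    | zero => simp
    | add p p' _ _ hp hp' => simp only [map_add, LinearMap.add_apply, hp, hp', smul_add]
    | fn m a ha =>
      induction hq using induction_of_mem with
      | zero => simp
      | add p p' _ _ hp hp' => simp only [map_add, LinearMap.add_apply, hp, hp', smul_add]
      | fn n b hb =>
        rw [bracket_fn_fn, bracket_fn_fn, h.br_symm i j a ha b hb, ht.symm i j a ha b hb,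
          add_comm m n, smul_add, Finsupp.smul_single, Finsupp.smul_single]
      | form n b hb =>
        rw [bracket_fn_form, bracket_form_fn, signMap_apply ℒ ha, map_smul, LinearMap.smul_apply,
          h.br_symm i _ a ha b hb, add_comm m n, smul_smul, Finsupp.smul_single]
        congr 2
        rw [mul_neg, ← neg_one_zpow_add]
        congr 2
        ring
    | form m a ha =>
      induction hq using induction_of_mem with
      | zero => simp
      | add p p' _ _ hp hp' => simp only [map_add, LinearMap.add_apply, hp, hp', smul_add]
      | fn n b hb =>
        rw [bracket_fn_form, bracket_form_fn, signMap_apply ℒ hb, map_smul, LinearMap.smul_apply,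
          h.br_symm _ _ a ha b hb, add_comm m n, Finsupp.smul_single, smul_smul]
        congr 2
        rw [neg_mul, ← neg_one_zpow_add]
        congr 1
        apply neg_one_zpow_eq_of_even_sub
        exact ⟨-j, by ring⟩
      | form n b hb => simp
  leibniz := by
    intro i p hp q
    induction hp using induction_of_mem with
    | zero => simp
    | add p p' _ _ hp hp' =>
      simp only [map_add, LinearMap.add_apply, hp, hp', smul_add]
      abel
    | fn m a ha =>
      induction q using induction with
      | zero => simp
      | add p p' hp hp' =>
        simp only [map_add, hp, hp', smul_add]
        abel
      | fn n b =>
        have e1 := congrArg (fn (m + n + 1)) (h.leibniz i a ha b)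
        have e2 := congrArg (form (m + n)) (ht.br_eq i a ha b)
        have e3 := natCast_smul_form (K := K) m (br a b) n
        have e4 := natCast_smul_form' (K := K) n (br a b) m
        have e5 := neg_one_zpow_mul_self (K := K) i
        simp only [Finsupp.single_add, ← Finsupp.smul_single] at e1 e2
        simp only [bracket_fn_fn, diff_fn, map_add, map_smul, diff_form, LinearMap.add_apply,
          LinearMap.smul_apply, bracket_form_fn, bracket_fn_form, signMap_apply ℒ ha,
          ← Finsupp.smul_single, add_tsub_cancel_right, smul_add, e3, e1]
        rw [smul_comm (n : K), e4, smul_smul, e5]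
        push_cast
        linear_combination (norm := module) e2
      | form n b =>
        have e1 := congrArg (form (m + n + 1)) (h.leibniz i a ha b)
        simp only [Finsupp.single_add, ← Finsupp.smul_single] at e1
        simp only [bracket_fn_form, diff_fn, map_add, map_smul, map_neg, diff_form,
          LinearMap.add_apply, LinearMap.smul_apply, bracket_form_form, signMap_apply ℒ ha,
          signMap_apply ℒ (h.d_mem i a ha), ← Finsupp.smul_single, e1, neg_one_zpow_add,
          zpow_one]
        module
    | form m a ha =>
      -- The coefficient of `dt` has degree one less than the form, so the total degree is written
      -- as a successor.
      obtain ⟨i, rfl⟩ : ∃ l, i = l + 1 := ⟨i - 1, by ring⟩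
      rw [add_sub_cancel_right] at ha
      induction q using induction with
      | zero => simp
      | add p p' hp hp' =>
        simp only [map_add, hp, hp', smul_add]
        abel
      | fn n b =>
        have e1 := congrArg (form (m + n + 1)) (h.leibniz i a ha b)
        simp only [Finsupp.single_add, ← Finsupp.smul_single] at e1
        simp only [bracket_form_fn, diff_fn, map_add, map_smul, map_neg, diff_form,
          LinearMap.neg_apply, bracket_form_form, e1, neg_one_zpow_add, zpow_one]
        module
      | form n b => simp
  jacobi := by
    intro i j p hp q hq r
    induction hp using induction_of_mem with
    | zero => simp
    | add p p' _ _ hp hp' =>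
      simp only [map_add, LinearMap.add_apply, hp, hp', smul_add]
      abel
    | fn m a ha =>
      induction hq using induction_of_mem with
      | zero => simp
      | add p p' _ _ hp hp' =>
        simp only [map_add, LinearMap.add_apply, hp, hp', smul_add]
        abel
      | fn n b hb =>
        induction r using induction with
        | zero => simp
        | add p p' hp hp' =>
          simp only [map_add, hp, hp', smul_add]
          abel
        | fn l c =>
          have e1 := congrArg (fn (m + n + l + 2)) (h.jacobi i j a ha b hb c)
          have e2 := congrArg (form (m + n + l + 1)) (ht.jacobi i j a ha b hb c)
          simp only [Finsupp.single_add, ← Finsupp.smul_single] at e1 e2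
          simp only [bracket_fn_fn, map_add, LinearMap.add_apply, bracket_fn_form,
            bracket_form_fn, signMap_apply ℒ ha, signMap_apply ℒ hb, map_smul,
            LinearMap.smul_apply, ← Finsupp.smul_single]
          rw [show m + (n + l + 1) + 1 = m + n + l + 2 by ring,
            show m + n + 1 + l + 1 = m + n + l + 2 by ring,
            show n + (m + l + 1) + 1 = m + n + l + 2 by ring,
            show m + (n + l + 1) = m + n + l + 1 by ring,
            show m + n + 1 + l = m + n + l + 1 by ring,
            show n + (m + l + 1) = m + n + l + 1 by ring,
            show m + (n + l) + 1 = m + n + l + 1 by ring,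
            show n + (m + l) + 1 = m + n + l + 1 by ring]
          linear_combination (norm := module) e1 + e2
        | form l c =>
          have e1 := congrArg (form (m + n + l + 2)) (h.jacobi i j a ha b hb c)
          simp only [Finsupp.single_add, ← Finsupp.smul_single] at e1
          simp only [bracket_fn_fn, map_add, LinearMap.add_apply, bracket_fn_form,
            bracket_form_form, signMap_apply ℒ ha, signMap_apply ℒ hb, map_smul,
            signMap_bracket h ha hb, LinearMap.smul_apply, ← Finsupp.smul_single]
          rw [show m + (n + l + 1) + 1 = m + n + l + 2 by ring,
            show m + n + 1 + l + 1 = m + n + l + 2 by ring,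
            show n + (m + l + 1) + 1 = m + n + l + 2 by ring]
          linear_combination (norm := module) ((-1 : K) ^ i * (-1 : K) ^ j) • e1
      | form n b hb =>
        obtain ⟨j, rfl⟩ : ∃ l, j = l + 1 := ⟨j - 1, by ring⟩
        rw [add_sub_cancel_right] at hb
        induction r using induction with
        | zero => simp
        | add p p' hp hp' =>
          simp only [map_add, hp, hp', smul_add]
          abel
        | fn l c =>
          have e1 := congrArg (form (m + n + l + 2)) (h.jacobi i j a ha b hb c)
          simp only [Finsupp.single_add, ← Finsupp.smul_single] at e1
          simp only [bracket_fn_fn, map_add, bracket_fn_form,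
            bracket_form_form, bracket_form_fn, signMap_apply ℒ ha, map_smul,
            LinearMap.smul_apply, ← Finsupp.smul_single]
          rw [show m + (n + l + 1) + 1 = m + n + l + 2 by ring,
            show m + n + 1 + l + 1 = m + n + l + 2 by ring,
            show n + (m + l + 1) + 1 = m + n + l + 2 by ring, mul_add, mul_one, neg_one_zpow_add]
          linear_combination (norm := module) ((-1 : K) ^ i) • e1
        | form l c => simp
    | form m a ha =>
      obtain ⟨i, rfl⟩ : ∃ l, i = l + 1 := ⟨i - 1, by ring⟩
      rw [add_sub_cancel_right] at ha
      induction hq using induction_of_mem with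
      | zero => simp
      | add p p' _ _ hp hp' =>
        simp only [map_add, LinearMap.add_apply, hp, hp', smul_add]
        abel
      | fn n b hb =>
        induction r using induction with
        | zero => simp
        | add p p' hp hp' =>
          simp only [map_add, hp, hp', smul_add]
          abel
        | fn l c =>
          have e1 := congrArg (form (m + n + l + 2)) (h.jacobi i j a ha b hb c)
          have e2 := neg_one_zpow_mul_self (K := K) j
          simp only [Finsupp.single_add, ← Finsupp.smul_single] at e1
          simp only [bracket_fn_fn, map_add, bracket_fn_form,
            bracket_form_form, bracket_form_fn, signMap_apply ℒ hb, map_smul,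
            LinearMap.smul_apply, ← Finsupp.smul_single]
          rw [show m + (n + l + 1) + 1 = m + n + l + 2 by ring,
            show m + n + 1 + l + 1 = m + n + l + 2 by ring,
            show n + (m + l + 1) + 1 = m + n + l + 2 by ring, add_mul, one_mul, neg_one_zpow_add,
            smul_smul, mul_assoc, e2]
          linear_combination (norm := module) e1
        | form l c => simp
      | form n b hb =>
        induction r using induction with
        | zero => simp
        | add p p' hp hp' =>
          simp only [map_add, hp, hp', smul_add]
          abel
        | fn l c => simp
        | form l c => simp

/-! ### Evaluation at `t = c` -/

/-- The value of a polynomial form at `t = c`. -/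
def eval (c : K) : (ℕ ⊕ ℕ →₀ A) →ₗ[K] A :=
  Finsupp.lsum K (Sum.elim (fun m => c ^ m • LinearMap.id) (fun _ => (0 : A →ₗ[K] A)))

@[simp] theorem eval_fn (c : K) (m : ℕ) (a : A) : eval c (fn m a) = c ^ m • a := by
  simp [eval]

@[simp] theorem eval_form (c : K) (m : ℕ) (a : A) : eval c (form m a) = 0 :=
  Finsupp.lsum_single ..

/-- Integration from `c` to `t`. -/
def integral (c : K) : (ℕ ⊕ ℕ →₀ A) →ₗ[K] (ℕ ⊕ ℕ →₀ A) :=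
  Finsupp.lsum K (Sum.elim (fun _ => 0) (fun m => ((m + 1 : ℕ) : K)⁻¹ •
    (Finsupp.lsingle (Sum.inl (m + 1)) - c ^ (m + 1) • Finsupp.lsingle (Sum.inl 0))))

@[simp] theorem integral_fn (c : K) (m : ℕ) (a : A) : integral c (fn m a) = 0 :=
  Finsupp.lsum_single ..

@[simp] theorem integral_form (c : K) (m : ℕ) (a : A) : integral c (form m a) =
    ((m + 1 : ℕ) : K)⁻¹ • (fn (m + 1) a - c ^ (m + 1) • fn 0 a) := by
  simp [integral]

/-- The fundamental theorem of calculus: integration from `c` contracts `A[t, dt]` onto the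
constants. Characteristic zero is needed to divide by `m + 1`. -/
theorem diff_integral_add [CharZero K] (d : A →ₗ[K] A) (c : K) (p : ℕ ⊕ ℕ →₀ A) :
    diff d (integral c p) + integral c (diff d p) = p - fn 0 (eval c p) := by
  induction p using induction with
  | zero => simp
  | add p q hp hq =>
    simp only [map_add, Finsupp.single_add]
    linear_combination (norm := module) hp + hq
  | fn m a =>
    rw [integral_fn, diff_fn, map_add, integral_fn, map_zero, map_smul, integral_form, eval_fn]
    cases m with
    | zero => simp
    | succ m =>
      rw [add_tsub_cancel_right, smul_smul,
        mul_inv_cancel₀ (Nat.cast_ne_zero.2 m.succ_ne_zero)]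
      simp
  | form m a =>
    have h : ((m + 1 : ℕ) : K)⁻¹ * ((m + 1 : ℕ) : K) = 1 :=
      inv_mul_cancel₀ (Nat.cast_ne_zero.2 m.succ_ne_zero)
    rw [diff_form, map_neg, integral_form, integral_form, eval_form, map_smul, map_sub, map_smul,
      diff_fn, diff_fn, Nat.cast_zero, add_tsub_cancel_right]
    simp only [Finsupp.single_zero]
    linear_combination (norm := module) h • form m a

end Path

/-! ### Quasi-isomorphisms -/

namespace DGLA

variable {K : Type u} [Field K]

/-- A deformation retraction is a quasi-isomorphism. -/
theorem Hom.isQuasiIso_of_homotopy {L L' : DGLA.{u, v} K} (f : L.Hom L')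
    (g : L'.carrier →ₗ[K] L.carrier) (H : L.carrier →ₗ[K] L.carrier)
    (hg : ∀ a, g (L'.d a) = L.d (g a)) (hfg : ∀ a, f.toLin (g a) = a)
    (hH : ∀ a, L.d (H a) + H (L.d a) = a - g (f.toLin a)) : f.IsQuasiIso := by
  constructor
  · rw [injective_iff_map_eq_zero]
    intro x hx
    obtain ⟨⟨z, hz⟩, rfl⟩ := Submodule.mkQ_surjective _ x
    rw [LinearMap.mem_ker] at hz
    rw [Submodule.mkQ_apply]
    obtain ⟨w, hw⟩ := (Submodule.Quotient.mk_eq_zero _).1 hx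
    have hw' : L'.d w = f.toLin z := hw
    apply (Submodule.Quotient.mk_eq_zero _).2
    refine ⟨H z + g w, ?_⟩
    have := hH z
    rw [hz, map_zero, add_zero] at this
    change _ = z
    rw [map_add, this, ← hg, hw', sub_add_cancel]
  · intro y
    obtain ⟨⟨z, hz⟩, rfl⟩ := Submodule.mkQ_surjective _ y
    rw [LinearMap.mem_ker] at hz
    refine ⟨L.cls ⟨g z, by rw [LinearMap.mem_ker, ← hg, hz, map_zero]⟩, ?_⟩
    change L'.cls ⟨f.toLin (g z), _⟩ = _
    congr 1
    exact Subtype.ext (hfg z)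

variable {A : Type v} [AddCommGroup A] [Module K A] {ℒ : ℤ → Submodule K A}
  [DirectSum.Decomposition ℒ] {d : A →ₗ[K] A} {br ρ : A →ₗ[K] A →ₗ[K] A}

/-- The evaluation at `t = c` as a morphism of DGLAs. -/
def evalHom (h : IsDGLA ℒ d br) (ht : IsTrivialization ℒ d br ρ) (c : K)
    {br' : A →ₗ[K] A →ₗ[K] A} (h' : IsDGLA ℒ d br') (hbr : br' = c • br) :
    (Path.isDGLA h ht).toDGLA.Hom h'.toDGLA where
  toLin := Path.eval c
  map_mem := by
    intro i p hp
    change Path.eval c p ∈ ℒ i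
    induction hp using Path.induction_of_mem with
    | zero => simp
    | add p q _ _ hp hq => rw [map_add]; exact add_mem hp hq
    | fn m a ha => rw [Path.eval_fn]; exact Submodule.smul_mem _ _ ha
    | form m a ha => simp
  map_d := by
    intro p
    change Path.eval c (Path.diff d p) = d (Path.eval c p)
    induction p using Path.induction with
    | zero => simp
    | add p q hp hq => simp only [map_add, hp, hq]
    | fn m a => simp
    | form m a => simp
  map_br := by
    intro p q
    subst hbr
    suffices H : ∀ p q : ℕ ⊕ ℕ →₀ A, Path.eval c (Path.bracket ℒ br ρ p q) =
        (c • br) (Path.eval c p) (Path.eval c q) from H p q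
    clear p q
    intro p q
    induction p using Path.induction with
    | zero => simp
    | add p p' hp hp' => simp only [map_add, LinearMap.add_apply, hp, hp']
    | fn m a =>
      induction q using Path.induction with
      | zero => simp
      | add q q' hq hq' => simp only [map_add, hq, hq']
      | fn n b =>
        simp only [Path.bracket_fn_fn, map_add, Path.eval_fn, Path.eval_form, map_smul,
          LinearMap.smul_apply, smul_smul, add_zero]
        congr 1
        ring
      | form n b => simp
    | form m a =>
      induction q using Path.induction with
      | zero => simp
      | add q q' hq hq' => simp only [map_add, hq, hq']
      | fn n b => simp
      | form n b => simp

/-- Constants give a section of the evaluation, with integration from `c` as homotopy. The target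
bracket `br'` is only propositionally equal to `c • br`, so that `c = 1` and `c = 0` land on `br`
and `0` themselves. -/
theorem evalHom_isQuasiIso [CharZero K] (h : IsDGLA ℒ d br) (ht : IsTrivialization ℒ d br ρ)
    (c : K) {br' : A →ₗ[K] A →ₗ[K] A} (h' : IsDGLA ℒ d br') (hbr : br' = c • br) :
    (evalHom h ht c h' hbr).IsQuasiIso :=
  Hom.isQuasiIso_of_homotopy _ (Finsupp.lsingle (Sum.inl 0)) (Path.integral c)
    (fun a : A => show Path.fn 0 (d a) = Path.diff d (Path.fn 0 a) by simp)
    (fun a : A => show Path.eval c (Path.fn 0 a) = a by simp)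
    (Path.diff_integral_add d c)

/-- A DGLA with a trivialization of its bracket is quasi-isomorphic to its underlying complex with
zero bracket. -/
theorem quasiIsomorphic_of_isTrivialization [CharZero K] (h : IsDGLA ℒ d br)
    (ht : IsTrivialization ℒ d br ρ) (h₀ : IsDGLA ℒ d 0) :
    QuasiIsomorphic h.toDGLA h₀.toDGLA :=
  -- Evaluation at `t = 1`, reversed, followed by evaluation at `t = 0`.
  .trans _ _ _ (.symm _ _ (.rel _ _ ⟨_, evalHom_isQuasiIso h ht 1 h (one_smul K br).symm⟩))
    (.rel _ _ ⟨_, evalHom_isQuasiIso h ht 0 h₀ (zero_smul K br).symm⟩)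

theorem brCohomology_eq_zero_of_isTrivialization (h : IsDGLA ℒ d br)
    (ht : IsTrivialization ℒ d br ρ) : h.toDGLA.brCohomology = 0 := by
  have key : ∀ a b : A, d a = 0 → d b = 0 → br a b = d (ρ a b) := by
    intro a b ha hb
    -- The sign in `br_eq` depends on the degree of `a`, but it multiplies `d b = 0`; hence the
    -- formula is linear in `a` and extends to inhomogeneous elements.
    have h1 : ∀ a b : A, d b = 0 → br a b = d (ρ a b) + ρ (d a) b := by
      intro a b hb
      induction a using DirectSum.Decomposition.inductionOn ℒ with
      | zero => simp
      | add a a' h h' =>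
        simp only [map_add, LinearMap.add_apply, h, h']
        abel
      | @homogeneous i a => rw [ht.br_eq i a a.2 b, hb, map_zero, smul_zero, add_zero]
    rw [h1 a b hb, ha, map_zero, LinearMap.zero_apply, add_zero]
  apply LinearMap.ext
  intro x
  apply LinearMap.ext
  intro y
  obtain ⟨z, rfl⟩ := Submodule.mkQ_surjective _ x
  obtain ⟨w, rfl⟩ := Submodule.mkQ_surjective _ y
  rw [brCohomology_cls]
  exact (Submodule.Quotient.mk_eq_zero _).2 ⟨ρ z.1 w.1, (key z.1 w.1 z.2 w.2).symm⟩

end DGLA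

/-! ### Representing cohomology classes when the induced bracket vanishes -/

namespace DGLA

variable {K : Type u} [Field K]

/-- An arbitrary linear section of `cls` need not respect degrees, so sections are chosen on each
`cohomologyGr i` and assembled. -/
theorem exists_graded_section (L : DGLA.{u, v} K) :
    ∃ s : L.Cohomology →ₗ[K] L.cocycles, (∀ x, L.cls (s x) = x) ∧
      ∀ i, ∀ x ∈ L.cohomologyGr i, (s x : L.carrier) ∈ L.gr i := by
  have h : ∀ i, ∃ σ : L.cohomologyGr i →ₗ[K] (L.gr i).submoduleOf L.cocycles,
      ∀ x, L.cls (σ x) = x := by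
    intro i
    let p : (L.gr i).submoduleOf L.cocycles →ₗ[K] L.cohomologyGr i :=
      (L.cls ∘ₗ Submodule.subtype _).codRestrict _ fun z => ⟨z, z.2, rfl⟩
    have hp : Function.Surjective p := by
      rintro ⟨_, z, hz, rfl⟩
      exact ⟨⟨z, hz⟩, rfl⟩
    obtain ⟨σ, hσ⟩ := p.exists_rightInverse_of_surjective (LinearMap.range_eq_top.2 hp)
    exact ⟨σ, fun x => congrArg Subtype.val (LinearMap.congr_fun hσ x)⟩
  choose σ hσ using h
  let s : L.Cohomology →ₗ[K] L.cocycles :=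
    DirectSum.toModule K ℤ _ (fun i => Submodule.subtype _ ∘ₗ σ i) ∘ₗ
      (DirectSum.decomposeLinearEquiv L.cohomologyGr).toLinearMap
  have hs : ∀ i (x : L.cohomologyGr i), s x = σ i x := by
    intro i x
    simp only [s, LinearMap.comp_apply, LinearEquiv.coe_coe,
      DirectSum.decomposeLinearEquiv_apply, DirectSum.decompose_coe]
    rw [← DirectSum.lof_eq_of K, DirectSum.toModule_lof]
    rfl
  refine ⟨s, ?_, ?_⟩
  · intro x
    induction x using DirectSum.Decomposition.inductionOn L.cohomologyGr with
    | zero => simp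
    | add x y hx hy => rw [map_add, map_add, hx, hy]
    | homogeneous x => rw [hs, hσ]
  · intro i x hx
    rw [hs i ⟨x, hx⟩]
    exact (σ i ⟨x, hx⟩).2

variable {A : Type v} [AddCommGroup A] [Module K A] {ℒ : ℤ → Submodule K A}
  [DirectSum.Decomposition ℒ] {d : A →ₗ[K] A} {br : A →ₗ[K] A →ₗ[K] A}

/-- If the bracket in cohomology is zero, the cohomology is quasi-isomorphic to the underlying
complex with zero bracket. -/
theorem quasiIsomorphic_cohomology_of_brCohomology_eq_zero (h : IsDGLA ℒ d br)
    (hbr : h.toDGLA.brCohomology = 0) (h₀ : IsDGLA ℒ d 0) :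
    QuasiIsomorphic h.toDGLA.cohomology h₀.toDGLA := by
  obtain ⟨s, hs, hsm⟩ := h.toDGLA.exists_graded_section
  have hb : ∀ x y, h.toDGLA.brCohomology x y = 0 := fun x y => by rw [hbr]; rfl
  have hd : ∀ x, d (s x).1 = 0 := fun x => (s x).2
  -- Choosing representatives is a morphism of DGLAs because both brackets vanish, the differential
  -- of the source is zero, and the representatives are cocycles.
  let f : h.toDGLA.cohomology.Hom h₀.toDGLA :=
    { toLin := h.toDGLA.cocycles.subtype ∘ₗ s
      map_mem := hsm
      map_d := fun x => by
        refine Eq.trans ?_ (hd x).symm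
        change (s 0).1 = 0
        rw [map_zero]
        rfl
      map_br := fun x y => by
        refine (congrArg (fun z => (s z).1) (hb x y)).trans ?_
        rw [map_zero]
        rfl }
  refine .rel _ _ ⟨f, ?_, ?_⟩
  · rw [injective_iff_map_eq_zero]
    intro x hx
    obtain ⟨⟨z, hz⟩, rfl⟩ := Submodule.mkQ_surjective _ x
    obtain ⟨w, hw⟩ := (Submodule.Quotient.mk_eq_zero _).1 hx
    -- If the representative of `z` is exact then `z`, being the class of that representative, is
    -- zero.
    have hz0 : z = 0 := by
      have : h.toDGLA.cls (s z) = 0 := (Submodule.Quotient.mk_eq_zero _).2 ⟨w, hw⟩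
      exact (hs z).symm.trans this
    subst hz0
    exact map_zero _
  · intro y
    obtain ⟨z, rfl⟩ := Submodule.mkQ_surjective _ y
    let x : h.toDGLA.Cohomology := h.toDGLA.cls z
    refine ⟨h.toDGLA.cohomology.cls ⟨x, rfl⟩, ?_⟩
    have hx : h.toDGLA.cls (s x) = h.toDGLA.cls z := hs x
    exact (Submodule.Quotient.eq _).2 ((Submodule.Quotient.eq _).1 hx)

end DGLA

/-! ### Linear and quadratic coderivations -/

namespace GrSym

variable {K : Type u} [Field K] {M : Type v} [AddCommGroup M] [Module K M]
variable {𝒱 : ℤ → Submodule K M}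

theorem counit_eq_zero_of_mem_deg {i : ℤ} (hi : i ≠ 0) {x : GrSym 𝒱} (hx : x ∈ deg 𝒱 i) :
    counit 𝒱 x = 0 := by
  have H : deg 𝒱 i ≤ LinearMap.ker (counit 𝒱).toLinearMap := by
    apply Submodule.span_le.2
    rintro _ ⟨l, rfl, rfl⟩
    cases l with
    | nil => simp at hi
    | cons a l =>
      rw [List.map_cons, List.prod_cons]
      exact counit_ι_mul _ _
  exact H hx

theorem apply_mem_of_mem {B : M →ₗ[K] M →ₗ[K] M} {p : ℤ}
    (hB : ∀ i j, ∀ a ∈ 𝒱 i, ∀ b ∈ 𝒱 j, B a b ∈ 𝒱 (i + j + p)) {i : ℤ} {a : M} (ha : a ∈ 𝒱 i) :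
    ∀ j, ∀ b ∈ 𝒱 j, B a b ∈ 𝒱 (j + (p + i)) := fun j b hb => by
  have := hB i j a ha b hb
  rwa [show i + j + p = j + (p + i) by ring] at this

theorem hasDeg_smul_counit {i : ℤ} {v : M} (hv : v ∈ 𝒱 i) :
    HasDeg ((counit 𝒱).toLinearMap.smulRight v) i := by
  intro j x hx
  rw [LinearMap.smulRight_apply, AlgHom.toLinearMap_apply]
  by_cases hj : j = 0
  · subst hj
    rw [zero_add]
    exact Submodule.smul_mem _ _ hv
  · rw [counit_eq_zero_of_mem_deg hj hx, zero_smul]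
    exact zero_mem _

variable [DirectSum.Decomposition 𝒱]

theorem toV_mem {i : ℤ} {x : GrSym 𝒱} (hx : x ∈ deg 𝒱 i) : toV 𝒱 x ∈ 𝒱 i := by
  have H : deg 𝒱 i ≤ (𝒱 i).comap (toV 𝒱) := by
    apply Submodule.span_le.2
    rintro _ ⟨l, rfl, rfl⟩
    rw [SetLike.mem_coe, Submodule.mem_comap]
    cases l with
    | nil => simp [toV_one]
    | cons a l =>
      rw [List.map_cons, List.map_cons, List.prod_cons, toV_ι_mul]
      cases l with
      | nil => simp [a.2.2]
      | cons b l => simp [counit]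
  exact H hx

theorem hasDeg_comp_toV {f : M →ₗ[K] M} {p : ℤ} (hf : ∀ i, ∀ a ∈ 𝒱 i, f a ∈ 𝒱 (i + p)) :
    HasDeg (f ∘ₗ toV 𝒱) p := fun i _ hx => hf i _ (toV_mem hx)

theorem hasDeg_quadratic {B : M →ₗ[K] M →ₗ[K] M} (h : IsGrSymm 𝒱 B) {p : ℤ}
    (hB : ∀ i j, ∀ a ∈ 𝒱 i, ∀ b ∈ 𝒱 j, B a b ∈ 𝒱 (i + j + p)) :
    HasDeg (quadratic 𝒱 B h) p := by
  intro i x hx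
  have H : deg 𝒱 i ≤ (𝒱 (i + p)).comap (quadratic 𝒱 B h) := by
    apply Submodule.span_le.2
    rintro _ ⟨l, rfl, rfl⟩
    rw [SetLike.mem_coe, Submodule.mem_comap]
    cases l with
    | nil => simp [quadratic_one]
    | cons a l =>
      rw [List.map_cons, List.map_cons, List.prod_cons, quadratic_ι_mul, List.sum_cons]
      exact hB _ _ _ a.2.2 _ (toV_mem (Submodule.subset_span ⟨l, rfl, rfl⟩))
  exact H hx

theorem toV_of_mem_len {n : ℤ} (hn : n ≠ 1) {x : GrSym 𝒱} (hx : x ∈ len 𝒱 n) : toV 𝒱 x = 0 := by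
  have H : len 𝒱 n ≤ LinearMap.ker (toV 𝒱) := by
    apply Submodule.span_le.2
    rintro _ ⟨l, rfl, rfl⟩
    rw [SetLike.mem_coe, LinearMap.mem_ker]
    rcases l with _ | ⟨a, _ | ⟨b, l⟩⟩
    · simp [toV_one]
    · simp at hn
    · simp only [List.map_cons, List.prod_cons, toV_ι_mul, counit_ι_mul, zero_smul]
  exact H hx

theorem hasArity_comp_toV (f : M →ₗ[K] M) : HasArity (f ∘ₗ toV 𝒱) 1 := fun n hn x hx => by
  rw [LinearMap.comp_apply, toV_of_mem_len hn hx, map_zero]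

theorem hasArity_quadratic {B : M →ₗ[K] M →ₗ[K] M} (h : IsGrSymm 𝒱 B) :
    HasArity (quadratic 𝒱 B h) 2 := by
  intro n hn x hx
  have H : len 𝒱 n ≤ LinearMap.ker (quadratic 𝒱 B h) := by
    apply Submodule.span_le.2
    rintro _ ⟨l, rfl, rfl⟩
    rw [SetLike.mem_coe, LinearMap.mem_ker]
    cases l with
    | nil => simp [quadratic_one]
    | cons a l =>
      rw [List.map_cons, List.prod_cons, quadratic_ι_mul, toV_of_mem_len (n := l.length),
        map_zero]
      · intro h'
        apply hn
        simp only [List.length_cons]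
        omega
      · exact Submodule.subset_span ⟨l, rfl, rfl⟩
  exact H hx

theorem quadratic_ι_mul_ι {B : M →ₗ[K] M →ₗ[K] M} (h : IsGrSymm 𝒱 B) (a b : M) :
    quadratic 𝒱 B h (ι 𝒱 a * ι 𝒱 b) = B a b := by
  rw [quadratic_ι_mul, toV_ι]

/-- A map `S(V) → V` of arity two is determined by its bilinear part. -/
theorem HasArity.eq_quadratic {G : GrSym 𝒱 →ₗ[K] M} (hG : HasArity G 2)
    {B : M →ₗ[K] M →ₗ[K] M} (h : IsGrSymm 𝒱 B) (hB : ∀ a b, G (ι 𝒱 a * ι 𝒱 b) = B a b) :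
    G = quadratic 𝒱 B h := by
  apply linearMap_ext_len
  intro n x hx
  by_cases hn : n = 2
  · subst hn
    have H : len 𝒱 2 ≤ LinearMap.eqLocus G (quadratic 𝒱 B h) := by
      apply Submodule.span_le.2
      rintro _ ⟨l, hl, rfl⟩
      obtain ⟨a, b, rfl⟩ := List.length_eq_two.1 (by exact_mod_cast hl)
      simp only [List.map_cons, List.map_nil, List.prod_cons, List.prod_nil, mul_one,
        SetLike.mem_coe, LinearMap.mem_eqLocus]
      rw [hB, quadratic_ι_mul_ι]
    exact H hx
  · rw [hG n hn x hx, hasArity_quadratic h n hn x hx]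

/-- Base case of the descent in arity: removing a letter turns a quadratic corestriction into a
linear one and a linear one into a constant one. A constant corestriction gives multiplication by a
vector, a coderivation that only makes sense on the unreduced coalgebra. -/
theorem hat_smulRight_counit {i : ℤ} {v : M} (hv : v ∈ 𝒱 i) (x : GrSym 𝒱) :
    hat ((counit 𝒱).toLinearMap.smulRight v) x = ι 𝒱 v * x := by
  induction x using word_induction with
  | zero => simp
  | add x y hx hy => rw [map_add, hx, hy, mul_add]
  | smul c x hx => rw [map_smul, hx, mul_smul_comm]
  | one => simp
  | mul j w hw y hy =>
    have h0 : (counit 𝒱).toLinearMap.smulRight v ∘ₗ mulι 𝒱 w = 0 := by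
      ext z
      simp [counit_ι_mul]
    rw [hat_ι_mul (hasDeg_smul_counit hv) hw, h0, hat_zero, hy, LinearMap.zero_apply, zero_add,
      ← mul_assoc, ← mul_assoc, ι_comm 𝒱 hv hw, smul_mul_assoc]

theorem hat_comp_toV_ι_mul {f : M →ₗ[K] M} {p : ℤ} (hf : ∀ i, ∀ a ∈ 𝒱 i, f a ∈ 𝒱 (i + p))
    {i : ℤ} {v : M} (hv : v ∈ 𝒱 i) (x : GrSym 𝒱) :
    hat (f ∘ₗ toV 𝒱) (ι 𝒱 v * x) =
      ι 𝒱 (f v) * x + ((-1 : K) ^ (p * i)) • (ι 𝒱 v * hat (f ∘ₗ toV 𝒱) x) := by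
  have h0 : (f ∘ₗ toV 𝒱) ∘ₗ mulι 𝒱 v = (counit 𝒱).toLinearMap.smulRight (f v) := by
    ext z
    simp [toV_ι_mul]
  rw [hat_ι_mul (hasDeg_comp_toV hf) hv, h0, hat_smulRight_counit (hf i v hv)]

theorem hat_quadratic_ι_mul {B : M →ₗ[K] M →ₗ[K] M} (h : IsGrSymm 𝒱 B) {p : ℤ}
    (hB : ∀ i j, ∀ a ∈ 𝒱 i, ∀ b ∈ 𝒱 j, B a b ∈ 𝒱 (i + j + p)) {i : ℤ} {v : M} (hv : v ∈ 𝒱 i)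
    (x : GrSym 𝒱) :
    hat (quadratic 𝒱 B h) (ι 𝒱 v * x) =
      hat (B v ∘ₗ toV 𝒱) x + ((-1 : K) ^ (p * i)) • (ι 𝒱 v * hat (quadratic 𝒱 B h) x) := by
  have h0 : quadratic 𝒱 B h ∘ₗ mulι 𝒱 v = B v ∘ₗ toV 𝒱 := by
    ext z
    simp [quadratic_ι_mul]
  rw [hat_ι_mul (hasDeg_quadratic h hB) hv, h0]

theorem hat_ι {G : GrSym 𝒱 →ₗ[K] M} {p : ℤ} (hG : HasDeg G p) (h1 : G 1 = 0) (v : M) :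
    hat G (ι 𝒱 v) = ι 𝒱 (G (ι 𝒱 v)) := by
  induction v using DirectSum.Decomposition.inductionOn 𝒱 with
  | zero => simp
  | add a b ha hb => simp only [map_add, ha, hb]
  | homogeneous v =>
    have := hat_ι_mul hG v.2 1
    simpa [h1] using this

theorem hat_comp_toV_ι {f : M →ₗ[K] M} {p : ℤ} (hf : ∀ i, ∀ a ∈ 𝒱 i, f a ∈ 𝒱 (i + p)) (v : M) :
    hat (f ∘ₗ toV 𝒱) (ι 𝒱 v) = ι 𝒱 (f v) := by
  rw [hat_ι (hasDeg_comp_toV hf) (by simp [toV_one]), LinearMap.comp_apply, toV_ι]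

theorem hat_quadratic_ι {B : M →ₗ[K] M →ₗ[K] M} (h : IsGrSymm 𝒱 B) {p : ℤ}
    (hB : ∀ i j, ∀ a ∈ 𝒱 i, ∀ b ∈ 𝒱 j, B a b ∈ 𝒱 (i + j + p)) (v : M) :
    hat (quadratic 𝒱 B h) (ι 𝒱 v) = 0 := by
  rw [hat_ι (hasDeg_quadratic h hB) (quadratic_one B h)]
  have := quadratic_ι_mul B h v 1
  rw [mul_one, toV_one, map_zero] at this
  rw [this, map_zero]

theorem hat_quadratic_two {B : M →ₗ[K] M →ₗ[K] M} (h : IsGrSymm 𝒱 B) {p : ℤ}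
    (hB : ∀ i j, ∀ a ∈ 𝒱 i, ∀ b ∈ 𝒱 j, B a b ∈ 𝒱 (i + j + p))
    {i : ℤ} {a : M} (ha : a ∈ 𝒱 i) (b : M) :
    hat (quadratic 𝒱 B h) (ι 𝒱 a * ι 𝒱 b) = ι 𝒱 (B a b) := by
  rw [hat_quadratic_ι_mul h hB ha, hat_quadratic_ι h hB,
    hat_comp_toV_ι (apply_mem_of_mem hB ha), mul_zero, smul_zero, add_zero]

/-- One term for each pair of letters fed to `B`. Identities between quadratic coderivations become
Jacobi-type identities through this formula. -/
theorem hat_quadratic_three {B : M →ₗ[K] M →ₗ[K] M} (h : IsGrSymm 𝒱 B) {p : ℤ}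
    (hB : ∀ i j, ∀ a ∈ 𝒱 i, ∀ b ∈ 𝒱 j, B a b ∈ 𝒱 (i + j + p))
    {i j : ℤ} {a b : M} (ha : a ∈ 𝒱 i) (hb : b ∈ 𝒱 j) (c : M) :
    hat (quadratic 𝒱 B h) (ι 𝒱 a * (ι 𝒱 b * ι 𝒱 c)) =
      ι 𝒱 (B a b) * ι 𝒱 c + ((-1 : K) ^ ((p + i) * j)) • (ι 𝒱 b * ι 𝒱 (B a c)) +
        ((-1 : K) ^ (p * i)) • (ι 𝒱 a * ι 𝒱 (B b c)) := by
  rw [hat_quadratic_ι_mul h hB ha, hat_quadratic_two h hB hb,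
    hat_comp_toV_ι_mul (apply_mem_of_mem hB ha) hb, hat_comp_toV_ι (apply_mem_of_mem hB ha)]

end GrSym

/-! ### Elements of `D(V)` as maps on `S(V)` -/

section Extension

variable {K : Type u} [Field K] {M : Type v} [AddCommGroup M] [Module K M]
variable {𝒱 : ℤ → Submodule K M}

theorem RedSym.proj_coe (x : RedSym 𝒱) : RedSym.proj 𝒱 x = x := by
  apply Subtype.ext
  rw [RedSym.coe_proj, mem_redSub.1 x.2, map_zero, sub_zero]

/-- The extension of `g ∈ D(V)` to `S(V)` by zero on `1`. -/
def D.ext (g : D 𝒱) : GrSym 𝒱 →ₗ[K] M := g ∘ₗ RedSym.proj 𝒱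

theorem D.ext_coe (g : D 𝒱) (x : RedSym 𝒱) : g.ext (x : GrSym 𝒱) = g x := by
  rw [D.ext, LinearMap.comp_apply, RedSym.proj_coe]

theorem D.ext_one (g : D 𝒱) : g.ext 1 = 0 := by
  have : RedSym.proj 𝒱 1 = 0 := Subtype.ext (by simp)
  rw [D.ext, LinearMap.comp_apply, this, map_zero]

theorem D.ext_add (f g : D 𝒱) : (f + g).ext = f.ext + g.ext := rfl

theorem D.hasDegree_of_hasDeg_ext {g : D 𝒱} {p : ℤ} (h : GrSym.HasDeg g.ext p) :
    g.HasDegree p := fun i x hx => by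
  rw [← D.ext_coe]
  exact h i x hx

theorem D.ext_ι_mul_ι (g : D 𝒱) (a b : M) :
    g.ext (GrSym.ι 𝒱 a * GrSym.ι 𝒱 b) = g.bilinear a b :=
  g.ext_coe (RedSym.mul 𝒱 (RedSym.ι 𝒱 a) (RedSym.ι 𝒱 b))

theorem D.bilinear_symm (g : D 𝒱) : IsGrSymm 𝒱 g.bilinear := by
  intro i j a ha b hb
  rw [← D.ext_ι_mul_ι, ← D.ext_ι_mul_ι, GrSym.ι_comm 𝒱 ha hb, map_smul]

theorem D.ext_ofBilinear {B : M →ₗ[K] M →ₗ[K] M} (h : IsGrSymm 𝒱 B) :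
    (D.ofBilinear 𝒱 B h).ext = GrSym.quadratic 𝒱 B h := by
  apply LinearMap.ext
  intro x
  change GrSym.quadratic 𝒱 B h (RedSym.proj 𝒱 x : GrSym 𝒱) = _
  rw [RedSym.coe_proj, map_sub, Algebra.algebraMap_eq_smul_one, map_smul, GrSym.quadratic_one,
    smul_zero, sub_zero]

theorem D.ext_ofLinear (f : M →ₗ[K] M) : (D.ofLinear 𝒱 f).ext = f ∘ₗ GrSym.toV 𝒱 := by
  apply LinearMap.ext
  intro x
  change f (GrSym.toV 𝒱 (RedSym.proj 𝒱 x : GrSym 𝒱)) = _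
  rw [RedSym.coe_proj, map_sub, Algebra.algebraMap_eq_smul_one, map_smul, GrSym.toV_one,
    smul_zero, sub_zero]
  rfl

variable [DirectSum.Decomposition 𝒱]

theorem coe_coder_eq_hat (g : D 𝒱) (x : RedSym 𝒱) :
    (coder g x : GrSym 𝒱) = GrSym.hat g.ext (x : GrSym 𝒱) := rfl

/-- The extension by zero kills `1` and its coderivation takes values in the kernel of the counit,
so passing to the reduced coalgebra loses nothing. -/
theorem coder_proj (g : D 𝒱) (x : GrSym 𝒱) :
    coder g (RedSym.proj 𝒱 x) = RedSym.proj 𝒱 (GrSym.hat g.ext x) := by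
  apply Subtype.ext
  rw [coe_coder_eq_hat, RedSym.coe_proj, RedSym.coe_proj, GrSym.counit_hat, map_zero, sub_zero,
    map_sub, Algebra.algebraMap_eq_smul_one, map_smul, GrSym.hat_one, D.ext_one, map_zero,
    smul_zero, sub_zero]

theorem D.ext_bullet (f g : D 𝒱) : (bullet f g).ext = f.ext ∘ₗ GrSym.hat g.ext := by
  apply LinearMap.ext
  intro x
  change f (coder g (RedSym.proj 𝒱 x)) = _
  rw [coder_proj]
  rfl

theorem D.ext_bracketD (p q : ℤ) (f g : D 𝒱) : (bracketD p q f g).ext =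
    f.ext ∘ₗ GrSym.hat g.ext - ((-1 : K) ^ (p * q)) • (g.ext ∘ₗ GrSym.hat f.ext) := by
  rw [← D.ext_bullet, ← D.ext_bullet]
  rfl

theorem coder_add (f g : D 𝒱) : coder (f + g) = coder f + coder g := by
  apply LinearMap.ext
  intro x
  apply Subtype.ext
  rw [coe_coder_eq_hat, D.ext_add, GrSym.hat_add]
  rfl

theorem coe_coder_pow (g : D 𝒱) (n : ℕ) (x : RedSym 𝒱) :
    ((coder g ^ n) x : GrSym 𝒱) = (GrSym.hat g.ext ^ n) (x : GrSym 𝒱) :=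
  map_pow_apply (X := RedSym 𝒱) (f := coder g) (g := GrSym.hat g.ext) (redSub 𝒱).subtype
    (fun _ => rfl) n x

theorem coder_locallyNilpotent {g : D 𝒱} {p m : ℤ} (hg : GrSym.HasDeg g.ext p)
    (hm : GrSym.HasArity g.ext m) (h2 : 2 ≤ m) : LocallyNilpotent (X := RedSym 𝒱) (coder g) := fun x =>
  (GrSym.exists_hat_pow_apply_eq_zero hg hm h2 x).imp fun n hn =>
    Subtype.ext ((coe_coder_pow g n x).trans hn)

theorem coder_mem_deg {g : D 𝒱} (hg : GrSym.HasDeg g.ext 0) {i : ℤ} {x : RedSym 𝒱}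
    (hx : (x : GrSym 𝒱) ∈ GrSym.deg 𝒱 i) (n : ℕ) :
    ((coder g ^ n) x : GrSym 𝒱) ∈ GrSym.deg 𝒱 i := by
  induction n with
  | zero => exact hx
  | succ n ih =>
    rw [pow_succ', Module.End.mul_apply, coe_coder_eq_hat]
    simpa using GrSym.hat_mem_deg hg ih

theorem expLN_coder_mem_deg {g : D 𝒱} (hg : GrSym.HasDeg g.ext 0)
    (hn : ∀ x, ∃ n : ℕ, (coder g ^ n) x = 0) {i : ℤ} {x : RedSym 𝒱}
    (hx : (x : GrSym 𝒱) ∈ GrSym.deg 𝒱 i) :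
    (expLN (X := RedSym 𝒱) (coder g) hn x : GrSym 𝒱) ∈ GrSym.deg 𝒱 i := by
  have h := expLN_mem (X := RedSym 𝒱) hn (S := (GrSym.deg 𝒱 i).comap (redSub 𝒱).subtype) (x := x)
    (coder_mem_deg hg hx)
  exact h

theorem comul_coder {g : D 𝒱} (hg : GrSym.HasDeg g.ext 0) (x : RedSym 𝒱) :
    RedSym.comul 𝒱 (coder g x) =
      TensorProduct.map (coder g) LinearMap.id (RedSym.comul 𝒱 x) +
        TensorProduct.map LinearMap.id (coder g) (RedSym.comul 𝒱 x) := by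
  change TensorProduct.map (RedSym.proj 𝒱) (RedSym.proj 𝒱)
    (GrSym.comul 𝒱 (GrSym.hat g.ext (x : GrSym 𝒱))) =
      TensorProduct.map (coder g) LinearMap.id
          (TensorProduct.map (RedSym.proj 𝒱) (RedSym.proj 𝒱) (GrSym.comul 𝒱 (x : GrSym 𝒱))) +
        TensorProduct.map LinearMap.id (coder g)
          (TensorProduct.map (RedSym.proj 𝒱) (RedSym.proj 𝒱) (GrSym.comul 𝒱 (x : GrSym 𝒱)))
  rw [GrSym.comul_hat hg, GrSym.sgn_zero, map_add]
  generalize GrSym.comul 𝒱 (x : GrSym 𝒱) = z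
  have hp : RedSym.proj 𝒱 ∘ₗ GrSym.hat g.ext = coder g ∘ₗ RedSym.proj 𝒱 :=
    LinearMap.ext fun y => (coder_proj g y).symm
  simp only [← LinearMap.comp_apply, ← TensorProduct.map_comp, hp, LinearMap.id_comp,
    LinearMap.comp_id]

/-- A codifferential of degree one squaring to zero is an `L_∞`-structure. -/
theorem isLInfinity_of_hat_hat {δ : D 𝒱} (h1 : GrSym.HasDeg δ.ext 1)
    (h2 : GrSym.hat δ.ext * GrSym.hat δ.ext = 0) : IsLInfinity 𝒱 δ where
  degree := D.hasDegree_of_hasDeg_ext h1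
  bracket := by
    have h : ∀ x : RedSym 𝒱, bullet δ δ x = 0 := fun x => by
      rw [← D.ext_coe, D.ext_bullet, LinearMap.comp_apply, ← GrSym.toV_hat h1, ← Module.End.mul_apply, h2,
        LinearMap.zero_apply, map_zero]
    apply LinearMap.ext
    intro x
    rw [bracketD, LinearMap.sub_apply, LinearMap.smul_apply, h]
    simp

/-- If `[r, δ] = q` and `[r, q] = 0` in `D(V)`, with `r` of degree zero, then `e^r` is an
`L_∞`-isomorphism from `δ` to `δ + q`. -/
theorem isLInfinityIso_expLN [CharZero K] {r δ q : D 𝒱} (hr : GrSym.HasDeg r.ext 0)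
    {hn : ∀ x, ∃ n : ℕ, (coder r ^ n) x = 0} (hδ : IsLInfinity 𝒱 δ) (hδq : IsLInfinity 𝒱 (δ + q))
    (h1 : GrSym.hat r.ext * GrSym.hat δ.ext - GrSym.hat δ.ext * GrSym.hat r.ext =
      GrSym.hat q.ext)
    (h2 : GrSym.hat r.ext * GrSym.hat q.ext = GrSym.hat q.ext * GrSym.hat r.ext) :
    IsLInfinityIso 𝒱 δ 𝒱 (δ + q) (expLN (X := RedSym 𝒱) (coder r) hn) where
  source := hδ
  target := hδq
  bijective := expLN_bijective (X := RedSym 𝒱) hn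
  degree := fun i x hx => expLN_coder_mem_deg hr hn hx
  map_comul := comul_expLN (X := RedSym 𝒱) hn (RedSym.comul 𝒱) (comul_coder hr)
  map_coder := fun x => by
    rw [coder_add]
    refine expLN_conj (X := RedSym 𝒱) (δ := coder δ) (q := coder q) hn ?_ ?_ x
    · exact fun y => Subtype.ext (LinearMap.congr_fun h1 (y : GrSym 𝒱))
    · exact fun y => Subtype.ext (LinearMap.congr_fun h2 (y : GrSym 𝒱))

end Extension

/-! ### The quadratic element `Q = [R, d]` -/

/-- In a ring without 2-torsion, if `d² = 0`, `q = [r, d]` and `[r, q] = 0` then `q² = 0`. -/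
theorem commutator_sq_eq_zero {S : Type*} [Ring S] {r d q : S} (h2 : ∀ x : S, x + x = 0 → x = 0)
    (hd : d * d = 0) (hq : q = r * d - d * r) (hrq : r * q = q * r) :
    d * q + q * d = 0 ∧ q * q = 0 := by
  have h1 : d * q + q * d = 0 := by
    rw [hq]
    have e : d * (r * d - d * r) + (r * d - d * r) * d = r * (d * d) - d * d * r := by
      noncomm_ring
    rw [e, hd, mul_zero, zero_mul, sub_zero]
  refine ⟨h1, h2 _ ?_⟩
  -- Apply `[r, ·]` to `d * q + q * d`: since `[r, d] = q` and `[r, q] = 0`, the result is `2q²`.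
  -- The last bracket collects the defect of `hq`, so that the identity holds in the free ring.
  have e : q * q + q * q = r * (d * q + q * d) - (r * q - q * r) * d - (d * q + q * d) * r -
      d * (r * q - q * r) + ((q - (r * d - d * r)) * q + q * (q - (r * d - d * r))) := by
    noncomm_ring
  rw [e, h1, hrq, ← hq]
  simp

section Quadratic

variable {K : Type u} [Field K] {M : Type v} [AddCommGroup M] [Module K M]
variable {𝒱 : ℤ → Submodule K M} [DirectSum.Decomposition 𝒱]
variable {d : M →ₗ[K] M} {R : M →ₗ[K] M →ₗ[K] M} {hR : IsGrSymm 𝒱 R} {Q : D 𝒱}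

open GrSym

/-- The square of an odd coderivation is half its graded commutator with itself, hence a
coderivation up to the factor two; here its corestriction comes from `d ∘ d`. -/
theorem hat_hat_comp_toV [CharZero K] (hd : ∀ i, ∀ a ∈ 𝒱 i, d a ∈ 𝒱 (i + 1))
    (hdd : ∀ a, d (d a) = 0) : hat (d ∘ₗ toV 𝒱) * hat (d ∘ₗ toV 𝒱) = 0 := by
  have hD := hasDeg_comp_toV hd
  have h0 : (d ∘ₗ toV 𝒱) ∘ₗ hat (d ∘ₗ toV 𝒱) = 0 := by
    apply LinearMap.ext
    intro x
    rw [LinearMap.comp_apply, LinearMap.comp_apply, toV_hat hD, LinearMap.comp_apply, hdd,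
      LinearMap.zero_apply]
  apply LinearMap.ext
  intro x
  have h := hat_commutator hD hD x
  rw [h0, smul_zero, sub_zero, hat_zero] at h
  have h' : (2 : K) • hat (d ∘ₗ toV 𝒱) (hat (d ∘ₗ toV 𝒱) x) = 0 := by
    rw [mul_one, zpow_one, LinearMap.zero_apply] at h
    linear_combination (norm := module) h
  exact (smul_eq_zero.1 h').resolve_left two_ne_zero

theorem ext_commutator (hQ : Q = bracketD 0 1 (D.ofBilinear 𝒱 R hR) (D.ofLinear 𝒱 d)) :
    Q.ext = quadratic 𝒱 R hR ∘ₗ hat (d ∘ₗ toV 𝒱) - (d ∘ₗ toV 𝒱) ∘ₗ hat (quadratic 𝒱 R hR) := by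
  rw [hQ, D.ext_bracketD, D.ext_ofBilinear, D.ext_ofLinear]
  simp

theorem hasDeg_ext_commutator (hd : ∀ i, ∀ a ∈ 𝒱 i, d a ∈ 𝒱 (i + 1))
    (hRdeg : ∀ i j, ∀ a ∈ 𝒱 i, ∀ b ∈ 𝒱 j, R a b ∈ 𝒱 (i + j + 0))
    (hQ : Q = bracketD 0 1 (D.ofBilinear 𝒱 R hR) (D.ofLinear 𝒱 d)) : HasDeg Q.ext 1 := by
  intro i x hx
  rw [ext_commutator hQ]
  refine sub_mem ?_ ?_
  · have := hasDeg_quadratic hR hRdeg _ _ (hat_mem_deg (hasDeg_comp_toV hd) hx)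
    rwa [add_zero] at this
  · have := hasDeg_comp_toV hd _ _ (hat_mem_deg (hasDeg_quadratic hR hRdeg) hx)
    rwa [add_zero] at this

/-- The coderivation of `d` preserves length and that of `R` lowers it by one, so both composites
vanish off words of length two. Hence `Q` is determined by its bilinear part. -/
theorem hasArity_ext_commutator (hd : ∀ i, ∀ a ∈ 𝒱 i, d a ∈ 𝒱 (i + 1))
    (hRdeg : ∀ i j, ∀ a ∈ 𝒱 i, ∀ b ∈ 𝒱 j, R a b ∈ 𝒱 (i + j + 0))
    (hQ : Q = bracketD 0 1 (D.ofBilinear 𝒱 R hR) (D.ofLinear 𝒱 d)) : HasArity Q.ext 2 := by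
  intro n hn x hx
  have h1 := hat_mem_len (hasDeg_comp_toV hd) (hasArity_comp_toV d) hx
  have h2 := hat_mem_len (hasDeg_quadratic hR hRdeg) (hasArity_quadratic hR) hx
  rw [ext_commutator hQ, LinearMap.sub_apply, LinearMap.comp_apply, LinearMap.comp_apply,
    hasArity_quadratic hR _ (by omega) _ h1, hasArity_comp_toV d _ (by omega) _ h2, sub_zero]

theorem ext_commutator_eq_quadratic (hd : ∀ i, ∀ a ∈ 𝒱 i, d a ∈ 𝒱 (i + 1))
    (hRdeg : ∀ i j, ∀ a ∈ 𝒱 i, ∀ b ∈ 𝒱 j, R a b ∈ 𝒱 (i + j + 0))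
    (hQ : Q = bracketD 0 1 (D.ofBilinear 𝒱 R hR) (D.ofLinear 𝒱 d)) :
    Q.ext = quadratic 𝒱 Q.bilinear Q.bilinear_symm :=
  (hasArity_ext_commutator hd hRdeg hQ).eq_quadratic _ Q.ext_ι_mul_ι

theorem bilinear_commutator (hd : ∀ i, ∀ a ∈ 𝒱 i, d a ∈ 𝒱 (i + 1))
    (hRdeg : ∀ i j, ∀ a ∈ 𝒱 i, ∀ b ∈ 𝒱 j, R a b ∈ 𝒱 (i + j + 0))
    (hQ : Q = bracketD 0 1 (D.ofBilinear 𝒱 R hR) (D.ofLinear 𝒱 d)) {i : ℤ} {a : M}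
    (ha : a ∈ 𝒱 i) (b : M) :
    Q.bilinear a b = R (d a) b + ((-1 : K) ^ i) • R a (d b) - d (R a b) := by
  rw [← D.ext_ι_mul_ι, ext_commutator hQ, LinearMap.sub_apply, LinearMap.comp_apply,
    LinearMap.comp_apply, hat_comp_toV_ι_mul hd ha, hat_comp_toV_ι hd,
    hat_quadratic_two hR hRdeg ha, map_add, map_smul, quadratic_ι_mul_ι, quadratic_ι_mul_ι,
    LinearMap.comp_apply, toV_ι, one_mul]

theorem bilinear_commutator_mem (hd : ∀ i, ∀ a ∈ 𝒱 i, d a ∈ 𝒱 (i + 1))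
    (hRdeg : ∀ i j, ∀ a ∈ 𝒱 i, ∀ b ∈ 𝒱 j, R a b ∈ 𝒱 (i + j + 0))
    (hQ : Q = bracketD 0 1 (D.ofBilinear 𝒱 R hR) (D.ofLinear 𝒱 d)) :
    ∀ i j, ∀ a ∈ 𝒱 i, ∀ b ∈ 𝒱 j, Q.bilinear a b ∈ 𝒱 (i + j + 1) := by
  intro i j a ha b hb
  rw [← D.ext_ι_mul_ι]
  exact hasDeg_ext_commutator hd hRdeg hQ _ _ (mulι_mem_deg ha (ι_mem_deg' hb))

theorem d_bilinear_commutator (hd : ∀ i, ∀ a ∈ 𝒱 i, d a ∈ 𝒱 (i + 1)) (hdd : ∀ a, d (d a) = 0)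
    (hRdeg : ∀ i j, ∀ a ∈ 𝒱 i, ∀ b ∈ 𝒱 j, R a b ∈ 𝒱 (i + j + 0))
    (hQ : Q = bracketD 0 1 (D.ofBilinear 𝒱 R hR) (D.ofLinear 𝒱 d)) {i : ℤ} {a : M}
    (ha : a ∈ 𝒱 i) (b : M) :
    d (Q.bilinear a b) = -Q.bilinear (d a) b - ((-1 : K) ^ i) • Q.bilinear a (d b) := by
  rw [bilinear_commutator hd hRdeg hQ ha, bilinear_commutator hd hRdeg hQ ha,
    bilinear_commutator hd hRdeg hQ (hd i a ha)]
  simp only [map_add, map_sub, map_smul, hdd, map_zero, LinearMap.zero_apply, neg_one_zpow_add,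
    zpow_one]
  module

theorem hat_ext_commutator (hd : ∀ i, ∀ a ∈ 𝒱 i, d a ∈ 𝒱 (i + 1))
    (hRdeg : ∀ i j, ∀ a ∈ 𝒱 i, ∀ b ∈ 𝒱 j, R a b ∈ 𝒱 (i + j + 0))
    (hQ : Q = bracketD 0 1 (D.ofBilinear 𝒱 R hR) (D.ofLinear 𝒱 d)) :
    hat Q.ext = hat (quadratic 𝒱 R hR) * hat (d ∘ₗ toV 𝒱) -
      hat (d ∘ₗ toV 𝒱) * hat (quadratic 𝒱 R hR) := by
  apply LinearMap.ext
  intro x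
  have h := hat_commutator (hasDeg_quadratic hR hRdeg) (hasDeg_comp_toV hd) x
  rw [zero_mul, zpow_zero, one_smul, one_smul] at h
  rw [ext_commutator hQ, ← h]
  rfl

theorem quadratic_hat_ext (hQR : bracketD 0 1 (D.ofBilinear 𝒱 R hR) Q = 0) (x : GrSym 𝒱) :
    quadratic 𝒱 R hR (hat Q.ext x) = Q.ext (hat (quadratic 𝒱 R hR) x) := by
  have h := D.ext_bracketD 0 1 (D.ofBilinear 𝒱 R hR) Q
  rw [hQR, D.ext_ofBilinear, zero_mul, zpow_zero, one_smul] at h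
  exact (sub_eq_zero.1 (LinearMap.congr_fun h x).symm)

theorem hat_quadratic_mul_hat_ext (hRdeg : ∀ i j, ∀ a ∈ 𝒱 i, ∀ b ∈ 𝒱 j, R a b ∈ 𝒱 (i + j + 0))
    (hQdeg : HasDeg Q.ext 1) (hQR : bracketD 0 1 (D.ofBilinear 𝒱 R hR) Q = 0) :
    hat (quadratic 𝒱 R hR) * hat Q.ext = hat Q.ext * hat (quadratic 𝒱 R hR) := by
  apply LinearMap.ext
  intro x
  have h := hat_commutator (hasDeg_quadratic hR hRdeg) hQdeg x
  have h0 : quadratic 𝒱 R hR ∘ₗ hat Q.ext - Q.ext ∘ₗ hat (quadratic 𝒱 R hR) = 0 :=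
    LinearMap.ext fun x => sub_eq_zero.2 (quadratic_hat_ext hQR x)
  rw [zero_mul, zpow_zero, one_smul, one_smul, h0, hat_zero] at h
  exact sub_eq_zero.1 h

theorem hat_ext_commutator_sq [CharZero K] (hd : ∀ i, ∀ a ∈ 𝒱 i, d a ∈ 𝒱 (i + 1))
    (hdd : ∀ a, d (d a) = 0)
    (hRdeg : ∀ i j, ∀ a ∈ 𝒱 i, ∀ b ∈ 𝒱 j, R a b ∈ 𝒱 (i + j + 0))
    (hQ : Q = bracketD 0 1 (D.ofBilinear 𝒱 R hR) (D.ofLinear 𝒱 d))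
    (hQR : bracketD 0 1 (D.ofBilinear 𝒱 R hR) Q = 0) :
    hat (d ∘ₗ toV 𝒱) * hat Q.ext + hat Q.ext * hat (d ∘ₗ toV 𝒱) = 0 ∧
      hat Q.ext * hat Q.ext = 0 :=
  commutator_sq_eq_zero (S := Module.End K (GrSym 𝒱))
    (fun x hx => by
      rw [← two_smul K] at hx
      exact (smul_eq_zero.1 hx).resolve_left two_ne_zero)
    (hat_hat_comp_toV hd hdd) (hat_ext_commutator hd hRdeg hQ)
    (hat_quadratic_mul_hat_ext hRdeg (hasDeg_ext_commutator hd hRdeg hQ) hQR)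

/-- The corestriction of `q² = 0` on `a ⊙ b ⊙ c`. -/
theorem bilinear_commutator_jacobi [CharZero K] (hd : ∀ i, ∀ a ∈ 𝒱 i, d a ∈ 𝒱 (i + 1))
    (hdd : ∀ a, d (d a) = 0)
    (hRdeg : ∀ i j, ∀ a ∈ 𝒱 i, ∀ b ∈ 𝒱 j, R a b ∈ 𝒱 (i + j + 0))
    (hQ : Q = bracketD 0 1 (D.ofBilinear 𝒱 R hR) (D.ofLinear 𝒱 d))
    (hQR : bracketD 0 1 (D.ofBilinear 𝒱 R hR) Q = 0) {i j : ℤ} {a b : M} (ha : a ∈ 𝒱 i)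
    (hb : b ∈ 𝒱 j) (c : M) :
    Q.bilinear (Q.bilinear a b) c + ((-1 : K) ^ ((1 + i) * j)) • Q.bilinear b (Q.bilinear a c) +
      ((-1 : K) ^ i) • Q.bilinear a (Q.bilinear b c) = 0 := by
  have h := LinearMap.congr_fun (hat_ext_commutator_sq hd hdd hRdeg hQ hQR).2
    (ι 𝒱 a * (ι 𝒱 b * ι 𝒱 c))
  have h' := congrArg (toV 𝒱) h
  rw [Module.End.mul_apply, toV_hat (hasDeg_ext_commutator hd hRdeg hQ),
    ext_commutator_eq_quadratic hd hRdeg hQ,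
    hat_quadratic_three _ (bilinear_commutator_mem hd hRdeg hQ) ha hb] at h'
  simpa only [map_add, map_smul, quadratic_ι_mul_ι, one_mul, LinearMap.zero_apply,
    map_zero] using h'

/-- The hypothesis `[R, Q] = 0` on `a ⊙ b ⊙ c`. It becomes the `dt` part of the Jacobi identity on
`A[t, dt]`. -/
theorem bilinear_commutator_mixed_jacobi (hd : ∀ i, ∀ a ∈ 𝒱 i, d a ∈ 𝒱 (i + 1))
    (hRdeg : ∀ i j, ∀ a ∈ 𝒱 i, ∀ b ∈ 𝒱 j, R a b ∈ 𝒱 (i + j + 0))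
    (hQ : Q = bracketD 0 1 (D.ofBilinear 𝒱 R hR) (D.ofLinear 𝒱 d))
    (hQR : bracketD 0 1 (D.ofBilinear 𝒱 R hR) Q = 0) {i j : ℤ} {a b : M} (ha : a ∈ 𝒱 i)
    (hb : b ∈ 𝒱 j) (c : M) :
    R (Q.bilinear a b) c + ((-1 : K) ^ ((1 + i) * j)) • R b (Q.bilinear a c) +
      ((-1 : K) ^ i) • R a (Q.bilinear b c) =
    Q.bilinear (R a b) c + ((-1 : K) ^ (i * j)) • Q.bilinear b (R a c) +
      Q.bilinear a (R b c) := by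
  have h := quadratic_hat_ext hQR (ι 𝒱 a * (ι 𝒱 b * ι 𝒱 c))
  rw [ext_commutator_eq_quadratic hd hRdeg hQ, hat_quadratic_three _ hRdeg ha hb,
    hat_quadratic_three _ (bilinear_commutator_mem hd hRdeg hQ) ha hb] at h
  simpa only [map_add, map_smul, quadratic_ι_mul_ι, one_mul, zero_mul, zero_add, zpow_zero,
    one_smul] using h

end Quadratic

/-! ### From symmetric operations on `A[2k]` to brackets on `A[2k-1]` -/

section Decalage

variable {K : Type u} [Field K] {A : Type v} [AddCommGroup A] [Module K A]
variable {𝒜 : ℤ → Submodule K A} [DirectSum.Decomposition 𝒜]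

theorem signMap_of_mem_shift {k l : ℤ} {a : A} (ha : a ∈ shift 𝒜 (2 * k) l) :
    signMap 𝒜 a = ((-1 : K) ^ l) • a := by
  rw [signMap_apply 𝒜 ha]
  congr 1
  exact neg_one_zpow_eq_of_even_sub ⟨k, by ring⟩

theorem decalage_of_mem_shift {k l : ℤ} {a : A} (ha : a ∈ shift 𝒜 (2 * k) l)
    (B : A →ₗ[K] A →ₗ[K] A) (b : A) : decalage 𝒜 B a b = ((-1 : K) ^ l) • B a b := by
  rw [decalage, LinearMap.comp_apply, signMap_of_mem_shift ha, map_smul, LinearMap.smul_apply]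

/-- Degrees in `A` and in `A[2k]` have the same parity, so the sign defining the bracket from `Q`
and the sign defining the `L_∞`-structure from the bracket cancel. -/
theorem decalage_shift_decalage (k : ℤ) (B : A →ₗ[K] A →ₗ[K] A) :
    decalage (shift 𝒜 (2 * k)) (decalage 𝒜 B) = B := by
  apply LinearMap.ext
  intro a
  induction a using DirectSum.Decomposition.inductionOn (shift 𝒜 (2 * k)) with
  | zero => simp
  | add a a' ha ha' => rw [map_add, map_add, ha, ha']
  | @homogeneous i a =>
    rw [decalage, LinearMap.comp_apply, signMap_apply _ a.2, map_smul, decalage,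
      LinearMap.comp_apply, signMap_of_mem_shift a.2, map_smul, smul_smul, neg_one_zpow_mul_self,
      one_smul]

theorem mem_shift_two_mul_of_mem {𝒜 : ℤ → Submodule K A} {k i : ℤ} {a : A}
    (ha : a ∈ shift 𝒜 (2 * k - 1) i) : a ∈ shift 𝒜 (2 * k) (i - 1) := by
  rwa [shift_two_mul, sub_add_cancel]

theorem mem_shift_of_mem_two_mul {𝒜 : ℤ → Submodule K A} {k i l : ℤ} {a : A}
    (ha : a ∈ shift 𝒜 (2 * k) l) (h : i = l + 1) : a ∈ shift 𝒜 (2 * k - 1) i := by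
  rwa [h, ← shift_two_mul]

theorem neg_one_zpow_succ_mul_succ (l m : ℤ) : (-1 : K) ^ ((l + 1) * (m + 1)) =
    -((-1 : K) ^ (l * m) * (-1 : K) ^ l * (-1 : K) ^ m) := by
  rw [show (l + 1) * (m + 1) = l * m + l + m + 1 by ring]
  simp only [neg_one_zpow_add, zpow_one]
  ring

section

variable {d : A →ₗ[K] A} {k : ℤ} {R : A →ₗ[K] A →ₗ[K] A}
  {hR : IsGrSymm (shift 𝒜 (2 * k)) R} {Q : D (shift 𝒜 (2 * k))}

/-- Degrees in `A[2k-1]` are written `l + 1`, where `l` is the degree in `A[2k]` and `(-1)^l` is the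
sign of the décalage. Antisymmetry, Leibniz and Jacobi then translate the graded symmetry of `Q`,
`[d, Q] = 0` and `[Q, Q] = 0`. -/
theorem isDGLA_decalage_commutator [CharZero K]
    (hd : ∀ i, ∀ a ∈ shift 𝒜 (2 * k) i, d a ∈ shift 𝒜 (2 * k) (i + 1)) (hdd : ∀ a, d (d a) = 0)
    (hRdeg : ∀ i j, ∀ a ∈ shift 𝒜 (2 * k) i, ∀ b ∈ shift 𝒜 (2 * k) j,
      R a b ∈ shift 𝒜 (2 * k) (i + j + 0))
    (hQ : Q = bracketD 0 1 (D.ofBilinear _ R hR) (D.ofLinear _ d))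
    (hQR : bracketD 0 1 (D.ofBilinear _ R hR) Q = 0) :
    IsDGLA (shift 𝒜 (2 * k - 1)) d (decalage 𝒜 Q.bilinear) where
  d_mem := by
    intro i a ha
    replace ha := mem_shift_two_mul_of_mem ha
    obtain ⟨l, rfl⟩ : ∃ l, i = l + 1 := ⟨i - 1, by ring⟩
    rw [add_sub_cancel_right] at ha
    exact mem_shift_of_mem_two_mul (hd l a ha) rfl
  d_d := hdd
  br_mem := by
    intro i j a ha b hb
    replace ha := mem_shift_two_mul_of_mem ha
    obtain ⟨l, rfl⟩ : ∃ l, i = l + 1 := ⟨i - 1, by ring⟩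
    rw [add_sub_cancel_right] at ha
    replace hb := mem_shift_two_mul_of_mem hb
    obtain ⟨m, rfl⟩ : ∃ m, j = m + 1 := ⟨j - 1, by ring⟩
    rw [add_sub_cancel_right] at hb
    rw [decalage_of_mem_shift ha]
    exact Submodule.smul_mem _ _
      (mem_shift_of_mem_two_mul (bilinear_commutator_mem hd hRdeg hQ l m a ha b hb) (by ring))
  br_symm := by
    intro i j a ha b hb
    replace ha := mem_shift_two_mul_of_mem ha
    obtain ⟨l, rfl⟩ : ∃ l, i = l + 1 := ⟨i - 1, by ring⟩
    rw [add_sub_cancel_right] at ha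
    replace hb := mem_shift_two_mul_of_mem hb
    obtain ⟨m, rfl⟩ : ∃ m, j = m + 1 := ⟨j - 1, by ring⟩
    rw [add_sub_cancel_right] at hb
    rw [decalage_of_mem_shift ha, decalage_of_mem_shift hb, Q.bilinear_symm l m a ha b hb,
      smul_smul, smul_smul]
    congr 1
    rw [neg_one_zpow_succ_mul_succ]
    linear_combination (-(-1 : K) ^ (l * m) * (-1 : K) ^ l) * neg_one_zpow_mul_self (K := K) m
  leibniz := by
    intro i a ha b
    replace ha := mem_shift_two_mul_of_mem ha
    obtain ⟨l, rfl⟩ : ∃ l, i = l + 1 := ⟨i - 1, by ring⟩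
    rw [add_sub_cancel_right] at ha
    rw [decalage_of_mem_shift ha, decalage_of_mem_shift (hd l a ha), decalage_of_mem_shift ha,
      map_smul, d_bilinear_commutator hd hdd hRdeg hQ ha, neg_one_zpow_add, zpow_one]
    module
  jacobi := by
    intro i j a ha b hb c
    replace ha := mem_shift_two_mul_of_mem ha
    obtain ⟨l, rfl⟩ : ∃ l, i = l + 1 := ⟨i - 1, by ring⟩
    rw [add_sub_cancel_right] at ha
    replace hb := mem_shift_two_mul_of_mem hb
    obtain ⟨m, rfl⟩ : ∃ m, j = m + 1 := ⟨j - 1, by ring⟩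
    rw [add_sub_cancel_right] at hb
    have h := bilinear_commutator_jacobi hd hdd hRdeg hQ hQR ha hb c
    have hab := bilinear_commutator_mem hd hRdeg hQ l m a ha b hb
    simp only [decalage_of_mem_shift ha, decalage_of_mem_shift hb, map_smul, LinearMap.smul_apply,
      decalage_of_mem_shift hab]
    have e1 := neg_one_zpow_mul_self (K := K) l
    have e2 := neg_one_zpow_mul_self (K := K) m
    have e3 : (-1 : K) ^ ((1 + l) * m) = (-1 : K) ^ m * (-1 : K) ^ (l * m) := by
      rw [add_mul, one_mul, neg_one_zpow_add]
    rw [e3] at h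
    rw [neg_one_zpow_succ_mul_succ]
    simp only [neg_one_zpow_add, zpow_one]
    -- The signs become indeterminates with `x * x = 1` and `y * y = 1`, which turns the claim into
    -- a linear identity modulo `h` and these relations.
    generalize (-1 : K) ^ (l * m) = s at *
    generalize (-1 : K) ^ l = x at *
    generalize (-1 : K) ^ m = y at *
    linear_combination (norm := module) y • h + e1 • (y • Q.bilinear (Q.bilinear a b) c) +
      e1 • ((s * y * y) • Q.bilinear b (Q.bilinear a c))

/-- Multiplying the formula for `Q = [R, d]` by `(-1)^l` gives `br_eq`; the minus sign in `ρ` comes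
from the term `- d (R a b)`. The compatibility with Jacobi is `[R, Q] = 0`. -/
theorem isTrivialization_decalage [CharZero K]
    (hd : ∀ i, ∀ a ∈ shift 𝒜 (2 * k) i, d a ∈ shift 𝒜 (2 * k) (i + 1))
    (hRdeg : ∀ i j, ∀ a ∈ shift 𝒜 (2 * k) i, ∀ b ∈ shift 𝒜 (2 * k) j,
      R a b ∈ shift 𝒜 (2 * k) (i + j + 0))
    (hQ : Q = bracketD 0 1 (D.ofBilinear _ R hR) (D.ofLinear _ d))
    (hQR : bracketD 0 1 (D.ofBilinear _ R hR) Q = 0) :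
    IsTrivialization (shift 𝒜 (2 * k - 1)) d (decalage 𝒜 Q.bilinear) (-decalage 𝒜 R) where
  mem := by
    intro i j a ha b hb
    replace ha := mem_shift_two_mul_of_mem ha
    obtain ⟨l, rfl⟩ : ∃ l, i = l + 1 := ⟨i - 1, by ring⟩
    rw [add_sub_cancel_right] at ha
    replace hb := mem_shift_two_mul_of_mem hb
    obtain ⟨m, rfl⟩ : ∃ m, j = m + 1 := ⟨j - 1, by ring⟩
    rw [add_sub_cancel_right] at hb
    rw [LinearMap.neg_apply, LinearMap.neg_apply, decalage_of_mem_shift ha]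
    exact neg_mem (Submodule.smul_mem _ _
      (mem_shift_of_mem_two_mul (hRdeg l m a ha b hb) (by ring)))
  symm := by
    intro i j a ha b hb
    replace ha := mem_shift_two_mul_of_mem ha
    obtain ⟨l, rfl⟩ : ∃ l, i = l + 1 := ⟨i - 1, by ring⟩
    rw [add_sub_cancel_right] at ha
    replace hb := mem_shift_two_mul_of_mem hb
    obtain ⟨m, rfl⟩ : ∃ m, j = m + 1 := ⟨j - 1, by ring⟩
    rw [add_sub_cancel_right] at hb
    simp only [LinearMap.neg_apply]
    rw [decalage_of_mem_shift ha, decalage_of_mem_shift hb, hR l m a ha b hb,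
      neg_one_zpow_succ_mul_succ]
    linear_combination (norm := module) neg_one_zpow_mul_self (K := K) m •
      (((-1 : K) ^ (l * m) * (-1 : K) ^ l) • R b a)
  br_eq := by
    intro i a ha b
    replace ha := mem_shift_two_mul_of_mem ha
    obtain ⟨l, rfl⟩ : ∃ l, i = l + 1 := ⟨i - 1, by ring⟩
    rw [add_sub_cancel_right] at ha
    simp only [LinearMap.neg_apply]
    rw [decalage_of_mem_shift ha, decalage_of_mem_shift (hd l a ha), decalage_of_mem_shift ha,
      decalage_of_mem_shift ha, map_neg, map_smul, bilinear_commutator hd hRdeg hQ ha,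
      neg_one_zpow_add, zpow_one]
    module
  jacobi := by
    intro i j a ha b hb c
    replace ha := mem_shift_two_mul_of_mem ha
    obtain ⟨l, rfl⟩ : ∃ l, i = l + 1 := ⟨i - 1, by ring⟩
    rw [add_sub_cancel_right] at ha
    replace hb := mem_shift_two_mul_of_mem hb
    obtain ⟨m, rfl⟩ : ∃ m, j = m + 1 := ⟨j - 1, by ring⟩
    rw [add_sub_cancel_right] at hb
    have h := bilinear_commutator_mixed_jacobi hd hRdeg hQ hQR ha hb c
    have hab := bilinear_commutator_mem hd hRdeg hQ l m a ha b hb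
    have hab' := hRdeg l m a ha b hb
    rw [add_zero] at hab'
    simp only [LinearMap.neg_apply, decalage_of_mem_shift ha, decalage_of_mem_shift hb, map_smul,
      map_neg, LinearMap.smul_apply, decalage_of_mem_shift hab, decalage_of_mem_shift hab']
    have e1 := neg_one_zpow_mul_self (K := K) l
    have e2 := neg_one_zpow_mul_self (K := K) m
    have e3 : (-1 : K) ^ ((1 + l) * m) = (-1 : K) ^ m * (-1 : K) ^ (l * m) := by
      rw [add_mul, one_mul, neg_one_zpow_add]
    rw [e3] at h
    rw [neg_one_zpow_succ_mul_succ]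
    simp only [neg_one_zpow_add, zpow_one]
    generalize (-1 : K) ^ (l * m) = s at *
    generalize (-1 : K) ^ l = x at *
    generalize (-1 : K) ^ m = y at *
    linear_combination (norm := module) (-y) • h +
      e1 • (y • Q.bilinear a (R b c) - y • R (Q.bilinear a b) c + y • Q.bilinear (R a b) c -
        (s * y * y) • R b (Q.bilinear a c) + (s * y * y * y) • Q.bilinear b (R a c)) +
      e2 • ((s * y) • Q.bilinear b (R a c))

end

end Decalage

/-! ### The codifferentials of the two DGLAs -/

section Codifferential

variable {K : Type u} [Field K] {A : Type v} [AddCommGroup A] [Module K A]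
variable {𝒜 : ℤ → Submodule K A} [DirectSum.Decomposition 𝒜] {k : ℤ} {d : A →ₗ[K] A}

theorem IsDGLA.ext_toD {br : A →ₗ[K] A →ₗ[K] A} (h : IsDGLA (shift 𝒜 (2 * k - 1)) d br) :
    (h.toD _ (shift_two_mul 𝒜 k)).ext = d ∘ₗ GrSym.toV (shift 𝒜 (2 * k)) +
      GrSym.quadratic _ (decalage (shift 𝒜 (2 * k)) br)
        (h.decalage_symm (shift_two_mul 𝒜 k)) := by
  rw [IsDGLA.toD, D.ext_add, D.ext_ofLinear, D.ext_ofBilinear]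

theorem D.ext_injective {M : Type w} [AddCommGroup M] [Module K M] {𝒱 : ℤ → Submodule K M}
    {f g : D 𝒱} (h : f.ext = g.ext) : f = g := by
  apply LinearMap.ext
  intro x
  rw [← D.ext_coe, ← D.ext_coe, h]

theorem toD_zero (h : IsDGLA (shift 𝒜 (2 * k - 1)) d 0) :
    h.toD _ (shift_two_mul 𝒜 k) = D.ofLinear _ d := by
  apply D.ext_injective
  rw [h.ext_toD, D.ext_ofLinear]
  have : GrSym.quadratic _ (decalage (shift 𝒜 (2 * k)) 0)
      (h.decalage_symm (shift_two_mul 𝒜 k)) = 0 :=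
    (GrSym.HasArity.eq_quadratic (fun _ _ _ _ => rfl) _ (fun a b => by simp [decalage])).symm
  rw [this, add_zero]

/-- Identifies the target codifferential with `d + Q`, the form in which conjugation by the
exponential produces it. -/
theorem toD_decalage {Q : D (shift 𝒜 (2 * k))}
    (h : IsDGLA (shift 𝒜 (2 * k - 1)) d (decalage 𝒜 Q.bilinear))
    (hQ : Q.ext = GrSym.quadratic _ Q.bilinear Q.bilinear_symm) :
    h.toD _ (shift_two_mul 𝒜 k) = D.ofLinear _ d + Q := by
  apply D.ext_injective
  rw [h.ext_toD, D.ext_add, D.ext_ofLinear, hQ]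
  congr 1
  exact (GrSym.hasArity_quadratic _).eq_quadratic _
    (fun a b => by rw [decalage_shift_decalage, GrSym.quadratic_ι_mul_ι]) |>.symm

end Codifferential

end

end FormalityCriterion

/-! ### The main theorem -/

theorem theorem2p2 {K : Type*} [Field K] [CharZero K] {A : Type*} [AddCommGroup A] [Module K A]
    (𝒜 : ℤ → Submodule K A) [DirectSum.Decomposition 𝒜]
    (d : A →ₗ[K] A) (hd : ∀ i : ℤ, ∀ a ∈ 𝒜 i, d a ∈ 𝒜 (i + 1)) (hdd : ∀ a, d (d a) = 0)
    (k : ℤ)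
    (R : A →ₗ[K] A →ₗ[K] A) (hR : IsGrSymm 𝒜 R)
    (hRdeg : ∀ i j : ℤ, ∀ a ∈ 𝒜 i, ∀ b ∈ 𝒜 j, R a b ∈ 𝒜 (i + j - 2 * k))
    (r Q : D (shift 𝒜 (2 * k)))
    (hr : r = D.ofBilinear _ R (hR.shift_even k))
    (hQ : Q = bracketD 0 1 r (D.ofLinear _ d))
    (hRQ : bracketD 0 1 r Q = 0) :
    ∃ (h₀ : IsDGLA (shift 𝒜 (2 * k - 1)) d 0)
      (h : IsDGLA (shift 𝒜 (2 * k - 1)) d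
        (decalage 𝒜 Q.bilinear)),
      h.toDGLA.IsFormal ∧ h.toDGLA.IsHomotopyAbelian ∧
      ∃ hnil : ∀ x, ∃ n : ℕ, (coder r ^ n) x = 0,
        IsLInfinityIso
          (shift 𝒜 (2 * k))
          (h₀.toD _ (shift_two_mul 𝒜 k))
          (shift 𝒜 (2 * k))
          (h.toD _ (shift_two_mul 𝒜 k))
          (expLN (X := RedSym (shift 𝒜 (2 * k))) (coder r) hnil) := by
  subst hr
  have hd' : ∀ i, ∀ a ∈ shift 𝒜 (2 * k) i, d a ∈ shift 𝒜 (2 * k) (i + 1) := fun i a ha => by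
    have := hd _ a ha
    rwa [show i + 2 * k + 1 = i + 1 + 2 * k by ring] at this
  -- Both arguments and the value are shifted by `2k`, so `R` has degree zero on `A[2k]`; the
  -- summand `0` is the general degree `p` of a bilinear map.
  have hR' : ∀ i j, ∀ a ∈ shift 𝒜 (2 * k) i, ∀ b ∈ shift 𝒜 (2 * k) j,
      R a b ∈ shift 𝒜 (2 * k) (i + j + 0) := fun i j a ha b hb => by
    have := hRdeg _ _ a ha b hb
    rwa [show i + 2 * k + (j + 2 * k) - 2 * k = i + j + 0 + 2 * k by ring] at this
  have h := isDGLA_decalage_commutator hd' hdd hR' hQ hRQ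
  have ht := isTrivialization_decalage hd' hR' hQ hRQ
  have h₀ : IsDGLA (shift 𝒜 (2 * k - 1)) d 0 :=
    { d_mem := h.d_mem
      d_d := hdd
      br_mem := by simp
      br_symm := by simp
      leibniz := by simp
      jacobi := by simp }
  have hq := DGLA.quasiIsomorphic_of_isTrivialization h ht h₀
  have hrdeg : GrSym.HasDeg (D.ofBilinear _ R (hR.shift_even k)).ext 0 := by
    rw [D.ext_ofBilinear]
    exact GrSym.hasDeg_quadratic _ hR'
  have hnil : ∀ x, ∃ n : ℕ, (coder (D.ofBilinear _ R (hR.shift_even k)) ^ n) x = 0 :=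
    coder_locallyNilpotent hrdeg (m := 2)
      (by rw [D.ext_ofBilinear]; exact GrSym.hasArity_quadratic _) le_rfl
  have hQdeg := hasDeg_ext_commutator hd' hR' hQ
  have hd2 := hat_hat_comp_toV hd' hdd
  have hq2 := hat_ext_commutator_sq hd' hdd hR' hQ hRQ
  have hab : h₀.toDGLA.IsAbelian := rfl
  -- Formality passes through the complex with zero bracket, which is linked both to the given DGLA
  -- and to its cohomology.
  refine ⟨h₀, h, hq.trans _ _ _ (.symm _ _
    (DGLA.quasiIsomorphic_cohomology_of_brCohomology_eq_zero h
      (DGLA.brCohomology_eq_zero_of_isTrivialization h ht) h₀)), ⟨_, hab, hq⟩, hnil, ?_⟩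
  rw [toD_zero, toD_decalage h (ext_commutator_eq_quadratic hd' hR' hQ)]
  apply isLInfinityIso_expLN hrdeg
  · apply isLInfinity_of_hat_hat
    · rw [D.ext_ofLinear]
      exact GrSym.hasDeg_comp_toV hd'
    · rw [D.ext_ofLinear]
      exact hd2
  · apply isLInfinity_of_hat_hat
    · rw [D.ext_add, D.ext_ofLinear]
      exact fun i x hx => add_mem (GrSym.hasDeg_comp_toV hd' i x hx) (hQdeg i x hx)
    -- Expanding `(δ + q)²` leaves `δ²`, `q²` and the anticommutator, all of which vanish.
    · rw [D.ext_add, D.ext_ofLinear, GrSym.hat_add, add_mul, mul_add, mul_add, hd2, hq2.2,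
        zero_add, add_zero, hq2.1]
  · rw [D.ext_ofLinear, D.ext_ofBilinear]
    exact (hat_ext_commutator hd' hR' hQ).symm
  · rw [D.ext_ofBilinear]
    exact hat_quadratic_mul_hat_ext hR' hQdeg hRQ
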